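/- **Setting.** Let $\Omega\subset\mathbb R^d$, $d\in\{2,3\}$, be a bounded open set satisfying the cone condition (every point of $\Omega$ is the vertex of a finite cone contained in $\Omega$, all these cones being congruent; e.g. a bounded Lipschitz or a polytopal domain). Let $\|\cdot\|$, $(\cdot,\cdot)$ be the norm and inner product of $L^2(\Omega)$, let $\|\cdot\|_\ell$, $|\cdot|_\ell$ be the norm and seminorm of $H^\ell(\Omega)$, and put $X=H^1_0(\Omega)^d$, $Q=\{q\in L^2(\Omega):\int_\Omega q=0\}$, $V=\{v\in X:(q,\nabla\cdot v)=0\ \forall q\in Q\}$, $X^{-1}=X'$ with $\|g\|_{-1}=\sup_{0\ne v\in X}g(v)/\|\nabla v\|$, and $b(u,v,w)=\frac12((u\cdot\nabla)v,w)-\frac12((u\cdot\nabla)w,v)$. For $j=1,\dots,J$ let $(u^j,p^j)$ solve the Navier–Stokes equations with viscosity $\nu>0$ on $(0,T)$: $u^j_t+(u^j\cdot\nabla)u^j-\nu\Delta u^j+\nabla p^j=f^j$ in $X^{-1}$ at every $t\in(0,T)$, $u^j(t)\in V$ for $t\in[0,T]$, $p^j(t)\in Q$ for $t\in(0,T)$,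 $u^j(0)=u^j_0$. Let $0=t_0<\dots<t_N=T$, $k_n=t_{n+1}-t_n$, $k_{\max}=\max_n k_n$, $\varepsilon_n=\frac{k_n-k_{n-1}}{k_n+k_{n-1}}$. For $\theta\in(0,1)$ put $\alpha_2=\frac{\theta+1}2$, $\alpha_1=-\theta$, $\alpha_0=\frac{\theta-1}2$, $\widehat k_n=\alpha_2k_n-\alpha_0k_{n-1}$, and $$\beta^{(n)}_{2}=\tfrac14\Big(1+\tfrac{1-\theta^2}{(1+\varepsilon_n\theta)^2}+\varepsilon_n^2\tfrac{\theta(1-\theta^2)}{(1+\varepsilon_n\theta)^2}+\theta\Big),\quad \beta^{(n)}_1=\tfrac12\Big(1-\tfrac{1-\theta^2}{(1+\varepsilon_n\theta)^2}\Big),\quad \beta^{(n)}_0=1-\beta_1^{(n)}-\beta_2^{(n)}.$$ For a sequence $z$ put $z_{n,\alpha}=\sum_{\ell=0}^2\alpha_\ell z_{n-1+\ell}$, $z_{n,\beta}=\sum_{\ell=0}^2\beta^{(n)}_\ell z_{n-1+\ell}$, and $z_{n,\ast}=\big(\beta_2^{(n)}(1+\frac{k_n}{k_{n-1}})+\beta^{(n)}_1\big)z_n+\big(\beta_0^{(n)}-\beta_2^{(n)}\frac{k_n}{k_{n-1}}\big)z_{n-1}$.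 Let $h\in(0,1]$ and let $X^h\subset X$, $Q^h\subset Q$ be finite-dimensional (finite element) spaces such that, for integers $r\ge1$, $s\ge0$ and constants $C_{\rm app},C_{\rm inv}$, $C_{\rm is}>0$, * $\inf_{v^h\in X^h}\|v-v^h\|_{\ell}\le C_{\rm app}h^{r+1-\ell}|v|_{r+1}$ for $\ell=0,1$ and $v\in H^{r+1}(\Omega)^d\cap X$, and $\inf_{q^h\in Q^h}\|q-q^h\|\le C_{\rm app}h^{s+1}|q|_{s+1}$ for $q\in H^{s+1}(\Omega)\cap Q$; * $|v^h|_1\le C_{\rm inv}h^{-1}\|v^h\|$ for $v^h\in X^h$; * $\sup_{0\neq v^h\in X^h}(\nabla\cdot v^h,q^h)/\|\nabla v^h\|\ge C_{\rm is}\|q^h\|$ for $q^h\in Q^h$. The DLN-ensemble scheme: $u^{j,h}_n\in X^h$, $p^{j,h}_n\in Q^h$ $(0\le n\le N)$ satisfy, for $1\le n\le N-1$, all $j$ and all $v^h\in X^h$, $q^h\in Q^h$, with $\langle u^h\rangle_n=\frac1J\sum_ju^{j,h}_n$, $$\Big(\tfrac{u^{j,h}_{n,\alpha}}{\widehat k_n},v^h\Big)+b(\langle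 u^h\rangle_{n,\ast},u^{j,h}_{n,\beta},v^h)-(p^{j,h}_{n,\beta},\nabla\cdot v^h)+\nu(\nabla u^{j,h}_{n,\beta},\nabla v^h)=(f^j(t_{n,\beta}),v^h)-b(u^{j,h}_{n,\ast}-\langle u^h\rangle_{n,\ast},u^{j,h}_{n,\ast},v^h),$$ $$(\nabla\cdot u^{j,h}_{n,\beta},q^h)=0 .$$ **Theorem.** Let $\Omega$, $\theta\in(0,1)$ and $C_{\rm inv}$ be given. There is a constant $C_\ast>0$, depending only on these, such that for all $r\ge 1$, $s\ge 0$, $C_{\rm app}$, $C_{\rm is}>0$, $C_L,C_U>0$, $\nu>0$, $T>0$, $R$, $c_0$ there is a constant $C$, independent of $h$, of the spaces $X^h,Q^h$, of the time grid, of $J$ and of the solutions, with the following property. Assume, for all $j$ and $1\le n\le N-1$, 1. (CFL-like conditions) $1-C_\ast\big(\frac{1+\varepsilon_n\theta}{1-\varepsilon_n}\big)^2\frac{\widehat k_n}{h\nu}\big\|\nabla(u^{j,h}_{n,\ast}-\langle u^h\rangle_{n,\ast})\big\|^2\ge0$; 2. (step ratios) $C_L<k_n/k_{n-1}<C_U$;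 3. (regularity) $\max_{0\le n\le N}\|u^j(t_n)\|_r$, $\max_{1\le n\le N-1}\|u^j(t_{n,\beta})\|_{r+1}$, $\big(\sum_{n=1}^{N-1}(k_n+k_{n-1})\|p^j(t_{n,\beta})\|_{s+1}^2\big)^{1/2}$, $\|u^j_t\|_{L^2(0,T;H^{r+1})}$, $\|u^j_{tt}\|_{L^2(0,T;H^{r+1})}$ and $\|u^j_{ttt}\|_{L^2(0,T;X^{-1})}$ are finite and at most $R$; 4. (starting values) $\|u^j(t_n)-u^{j,h}_n\|\le c_0\big(h^r+h^{s+1}+k_{\max}^2+h^{1/2}k_{\max}^{3/2}\big)$ for $n=0,1$. Then for every $j$, with $u^j_n=u^j(t_n)$, $$\max_{0\le n\le N}\|u^j_n-u^{j,h}_n\|+\Big(\nu\sum_{n=1}^{N-1}\widehat k_n\|\nabla(u^j_{n,\beta}-u^{j,h}_{n,\beta})\|^2\Big)^{1/2}\le C\big(h^r+h^{s+1}+k_{\max}^2+h^{1/2}k_{\max}^{3/2}\big).$$ -/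

import Mathlib

open MeasureTheory Set
open scoped ENNReal ContDiff RealInnerProductSpace

noncomputable section

namespace DLN

/-! ### Domains -/

/-- The finite cone condition: every point of `Ω` is the vertex of a cone contained in `Ω`, all
these cones having the same height `ρ` and the same opening (bounded Lipschitz domains and polytopal
domains have this property). -/
def ConeCondition {d : ℕ} (Ω : Set (EuclideanSpace ℝ (Fin d))) : Prop :=
  ∃ ρ > (0 : ℝ), ∃ a ∈ Ioo (0 : ℝ) 1, ∀ x ∈ Ω, ∃ ξ : EuclideanSpace ℝ (Fin d), ‖ξ‖ = 1 ∧
    ∀ y, ‖y - x‖ ≤ ρ → a * ‖y - x‖ ≤ ⟪y - x, ξ⟫ → y ∈ Ω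

/-! ### Sobolev spaces -/

/-- `L²(Ω; F)`. -/
abbrev L2 {d : ℕ} (Ω : Set (EuclideanSpace ℝ (Fin d))) (F : Type) [NormedAddCommGroup F] : Type :=
  Lp F 2 (volume.restrict Ω)

/-- `∂_{I 0} ⋯ ∂_{I (k-1)} φ`. -/
def partialDeriv {d k : ℕ} (I : Fin k → Fin d) (φ : EuclideanSpace ℝ (Fin d) → ℝ)
    (x : EuclideanSpace ℝ (Fin d)) : ℝ :=
  iteratedFDeriv ℝ k φ x (fun m => EuclideanSpace.single (I m) 1)

/-- `g` is the weak derivative `∂_{I 0} ⋯ ∂_{I (k-1)} f` on `Ω`. -/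
def HasWeakDeriv {d k : ℕ} (Ω : Set (EuclideanSpace ℝ (Fin d))) {F : Type}
    [NormedAddCommGroup F] [InnerProductSpace ℝ F] (I : Fin k → Fin d) (f g : L2 Ω F) : Prop :=
  ∀ φ : EuclideanSpace ℝ (Fin d) → ℝ, ContDiff ℝ ∞ φ → HasCompactSupport φ → tsupport φ ⊆ Ω →
    ∫ x in Ω, partialDeriv I φ x • f x = (-1 : ℝ) ^ k • ∫ x in Ω, φ x • g x

/-- Index set of all partial derivatives of order at most `ℓ`. -/
abbrev DerivIdx (d ℓ : ℕ) : Type := (k : Fin (ℓ + 1)) × (Fin (k : ℕ) → Fin d)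

/-- The index of order zero. -/
def zeroIdx (d ℓ : ℕ) : DerivIdx d ℓ := ⟨⟨0, Nat.succ_pos ℓ⟩, fun a => Fin.elim0 a⟩

section

variable {d : ℕ} (Ω : Set (EuclideanSpace ℝ (Fin d)))
  (F : Type) [NormedAddCommGroup F] [InnerProductSpace ℝ F]

theorem integrable_smul_test {φ : EuclideanSpace ℝ (Fin d) → ℝ} (hφ : Continuous φ)
    (hc : HasCompactSupport φ) (f : L2 Ω F) :
    Integrable (fun x => φ x • f x) (volume.restrict Ω) := by
  have hf : LocallyIntegrable f (volume.restrict Ω) :=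
    (Lp.memLp f).locallyIntegrable (by norm_num)
  exact hf.integrable_smul_left_of_hasCompactSupport hφ hc

theorem continuous_partialDeriv {k : ℕ} (I : Fin k → Fin d) {φ : EuclideanSpace ℝ (Fin d) → ℝ}
    (hφ : ContDiff ℝ ∞ φ) : Continuous (partialDeriv I φ) :=
  (ContinuousMultilinearMap.apply ℝ (fun _ : Fin k => EuclideanSpace ℝ (Fin d)) ℝ
    (fun m => EuclideanSpace.single (I m) 1)).continuous.comp
      (hφ.continuous_iteratedFDeriv (by exact_mod_cast le_top))

theorem hasCompactSupport_partialDeriv {k : ℕ} (I : Fin k → Fin d)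
    {φ : EuclideanSpace ℝ (Fin d) → ℝ} (hc : HasCompactSupport φ) :
    HasCompactSupport (partialDeriv I φ) :=
  HasCompactSupport.comp_left
    (g := fun A : ContinuousMultilinearMap ℝ (fun _ : Fin k => EuclideanSpace ℝ (Fin d)) ℝ =>
      A (fun m => EuclideanSpace.single (I m) 1)) (hc.iteratedFDeriv (𝕜 := ℝ) k) rfl

/-- `H^ℓ(Ω; F)`: an element is the family of all weak derivatives (in `L²`) of order at most `ℓ` of
one function, the function itself being the member of order zero. The norm is
`‖v‖_ℓ = (∑_{k ≤ ℓ} ∑_{I} ‖∂_I v‖²)^{1/2}`. -/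
def Hs (ℓ : ℕ) : Submodule ℝ (PiLp 2 (fun _ : DerivIdx d ℓ => L2 Ω F)) where
  carrier := {w | ∀ i : DerivIdx d ℓ, HasWeakDeriv Ω i.2 (w (zeroIdx d ℓ)) (w i)}
  add_mem' := by
    intro v w hv hw i φ h1 h2 h3
    have e (j : DerivIdx d ℓ) (ψ : EuclideanSpace ℝ (Fin d) → ℝ) (hψ : Continuous ψ)
        (hψc : HasCompactSupport ψ) :
        ∫ x in Ω, ψ x • ((v + w) j : L2 Ω F) x
          = (∫ x in Ω, ψ x • (v j : L2 Ω F) x) + ∫ x in Ω, ψ x • (w j : L2 Ω F) x := by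
      rw [← integral_add (integrable_smul_test Ω F hψ hψc _) (integrable_smul_test Ω F hψ hψc _)]
      refine integral_congr_ae ?_
      filter_upwards [Lp.coeFn_add (v j : L2 Ω F) (w j)] with x hx
      rw [PiLp.add_apply, hx, Pi.add_apply, smul_add]
    rw [e _ _ (continuous_partialDeriv _ h1) (hasCompactSupport_partialDeriv _ h2),
      e _ _ h1.continuous h2, hv i φ h1 h2 h3, hw i φ h1 h2 h3, smul_add]
  zero_mem' := by
    intro i φ _ _ _
    have e (ψ : EuclideanSpace ℝ (Fin d) → ℝ) : ∫ x in Ω, ψ x • (0 : L2 Ω F) x = 0 := by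
      rw [← integral_zero (EuclideanSpace ℝ (Fin d)) F (μ := volume.restrict Ω)]
      refine integral_congr_ae ?_
      filter_upwards [Lp.coeFn_zero F 2 (volume.restrict Ω)] with x hx
      rw [hx, Pi.zero_apply, smul_zero]
    simp only [PiLp.zero_apply]
    rw [e, e, smul_zero]
  smul_mem' := by
    intro c v hv i φ h1 h2 h3
    have e (j : DerivIdx d ℓ) (ψ : EuclideanSpace ℝ (Fin d) → ℝ) :
        ∫ x in Ω, ψ x • ((c • v) j : L2 Ω F) x = c • ∫ x in Ω, ψ x • (v j : L2 Ω F) x := by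
      rw [← integral_smul]
      refine integral_congr_ae ?_
      filter_upwards [Lp.coeFn_smul c (v j : L2 Ω F)] with x hx
      rw [PiLp.smul_apply, hx, Pi.smul_apply, smul_comm]
    rw [e, e, hv i φ h1 h2 h3, smul_comm]

variable {Ω F}

/-- The function underlying an element of `H^ℓ(Ω; F)`. -/
def Hs.toL2 {ℓ : ℕ} : Hs Ω F ℓ →L[ℝ] L2 Ω F :=
  (PiLp.proj 2 (fun _ : DerivIdx d ℓ => L2 Ω F) (zeroIdx d ℓ)).comp (Hs Ω F ℓ).subtypeL

/-- The seminorm `|w|_ℓ` of `w ∈ H^ℓ(Ω; F)`: all derivatives of order exactly `ℓ`. -/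
def Hs.seminorm {ℓ : ℕ} (w : Hs Ω F ℓ) : ℝ :=
  √(∑ I : Fin ℓ → Fin d, ‖w.1 ⟨⟨ℓ, Nat.lt_succ_self ℓ⟩, I⟩‖ ^ 2)

/-- `‖f‖_ℓ` of an `L²` function, with the value `∞` if `f ∉ H^ℓ(Ω; F)`. -/
def sobNorm (ℓ : ℕ) (f : L2 Ω F) : ℝ≥0∞ := ⨅ (w : Hs Ω F ℓ) (_ : Hs.toL2 w = f), ‖w‖ₑ

/-- `w ∈ L²(0,T; H^ℓ(Ω; F))` with norm at most `R`. -/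
def BochnerBound (T : ℝ) (ℓ : ℕ) (w : ℝ → L2 Ω F) (R : ℝ) : Prop :=
  ∃ W : ℝ → Hs Ω F ℓ, (∀ᵐ t ∂(volume.restrict (Ioo 0 T)), Hs.toL2 (W t) = w t) ∧
    MemLp W 2 (volume.restrict (Ioo 0 T)) ∧
    eLpNorm W 2 (volume.restrict (Ioo 0 T)) ≤ ENNReal.ofReal R

end

/-! ### Velocity and pressure spaces -/

section

variable {d : ℕ} (Ω : Set (EuclideanSpace ℝ (Fin d)))

/-- The velocity space `X = H¹₀(Ω)^d`: the closure of the smooth vector fields with compact support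
in `Ω` in the norm of `H¹(Ω)^d`. -/
def X : Submodule ℝ (Hs Ω (EuclideanSpace ℝ (Fin d)) 1) :=
  (Submodule.span ℝ {w : Hs Ω (EuclideanSpace ℝ (Fin d)) 1 |
    ∃ φ : EuclideanSpace ℝ (Fin d) → EuclideanSpace ℝ (Fin d), ContDiff ℝ ∞ φ ∧
      HasCompactSupport φ ∧ tsupport φ ⊆ Ω ∧
      Hs.toL2 w =ᵐ[volume.restrict Ω] φ}).topologicalClosure

/-- The pressure space `Q = L²₀(Ω)`. -/
def Q : Set (L2 Ω ℝ) := {q | ∫ x in Ω, q x = 0}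

variable {Ω}

/-- The vector field underlying an element of `X`. -/
def fld : X Ω →L[ℝ] L2 Ω (EuclideanSpace ℝ (Fin d)) := Hs.toL2.comp (X Ω).subtypeL

/-- `∂_i v`. -/
def pd (v : X Ω) (i : Fin d) : L2 Ω (EuclideanSpace ℝ (Fin d)) :=
  v.1.1 ⟨⟨1, Nat.lt_succ_self 1⟩, fun _ => i⟩

/-- `(∇u, ∇v)`. -/
def gradInner (u v : X Ω) : ℝ := ∑ i, ⟪pd u i, pd v i⟫

/-- `‖∇v‖ = |v|₁`. -/
def gradNorm (v : X Ω) : ℝ := √(∑ i, ‖pd v i‖ ^ 2)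

/-- `(q, ∇ · v)`. -/
def divPair (q : L2 Ω ℝ) (v : X Ω) : ℝ := ∫ x in Ω, q x * ∑ i, (pd v i x) i

variable (Ω) in
/-- The divergence-free space `V`. -/
def V : Set (X Ω) := {v | ∀ q ∈ Q Ω, divPair q v = 0}

/-- `((u · ∇) v, w)`. -/
def conv (u v w : X Ω) : ℝ := ∫ x in Ω, ∑ i, (fld u x) i * ⟪pd v i x, fld w x⟫

/-- `b(u, v, w) = ½ ((u · ∇) v, w) - ½ ((u · ∇) w, v)`. -/
def b (u v w : X Ω) : ℝ := 1 / 2 * conv u v w - 1 / 2 * conv u w v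

/-- The dual norm `‖g‖₋₁ = sup_{0 ≠ v ∈ X} g(v) / ‖∇v‖` on `X⁻¹`. -/
def dualNorm (g : StrongDual ℝ (X Ω)) : ℝ≥0∞ :=
  ⨆ (v : X Ω) (_ : v ≠ 0), ENNReal.ofReal (g v) / ENNReal.ofReal (gradNorm v)

/-- The inclusion of `L²(Ω)^d` in `X⁻¹`. -/
def toDual (f : L2 Ω (EuclideanSpace ℝ (Fin d))) : StrongDual ℝ (X Ω) := (innerSL ℝ f).comp fld

end

/-! ### Time derivatives -/

/-- `w` is absolutely continuous on `[0,T]` with time derivative `w'`. -/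
def IsTimeDeriv {B : Type} [NormedAddCommGroup B] [NormedSpace ℝ B] (T : ℝ) (w w' : ℝ → B) :
    Prop :=
  IntervalIntegrable w' volume 0 T ∧ ∀ t ∈ Icc 0 T, w t = w 0 + ∫ τ in (0 : ℝ)..t, w' τ

/-- `w'` is the time derivative of (an almost everywhere representative of) `w` on `(0,T)`. -/
def IsWeakTimeDeriv {B : Type} [NormedAddCommGroup B] [NormedSpace ℝ B] (T : ℝ) (w w' : ℝ → B) :
    Prop :=
  IntervalIntegrable w' volume 0 T ∧ ∃ w₀ : B, ∀ᵐ t ∂(volume.restrict (Ioo 0 T)),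
    w t = w₀ + ∫ τ in (0 : ℝ)..t, w' τ

/-! ### The DLN coefficients; the grid is `t 0 < t 1 < ⋯ < t N` -/

/-- `k_n = t_{n+1} - t_n`. -/
def step (t : ℕ → ℝ) (n : ℕ) : ℝ := t (n + 1) - t n

/-- `k_max = max_{0 ≤ n ≤ N-1} k_n`. -/
def stepMax (t : ℕ → ℝ) (N : ℕ) : ℝ := ⨆ n : Fin N, step t n

/-- `ε_n = (k_n - k_{n-1}) / (k_n + k_{n-1})`. -/
def eps (t : ℕ → ℝ) (n : ℕ) : ℝ :=
  (step t n - step t (n - 1)) / (step t n + step t (n - 1))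

def alpha2 (θ : ℝ) : ℝ := (θ + 1) / 2
def alpha1 (θ : ℝ) : ℝ := -θ
def alpha0 (θ : ℝ) : ℝ := (θ - 1) / 2

def beta2 (θ ε : ℝ) : ℝ :=
  1 / 4 * (1 + (1 - θ ^ 2) / (1 + ε * θ) ^ 2 + ε ^ 2 * (θ * (1 - θ ^ 2) / (1 + ε * θ) ^ 2) + θ)
def beta1 (θ ε : ℝ) : ℝ := 1 / 2 * (1 - (1 - θ ^ 2) / (1 + ε * θ) ^ 2)
def beta0 (θ ε : ℝ) : ℝ :=
  1 / 4 * (1 + (1 - θ ^ 2) / (1 + ε * θ) ^ 2 - ε ^ 2 * (θ * (1 - θ ^ 2) / (1 + ε * θ) ^ 2) - θ)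

/-- The average step `α₂ k_n - α₀ k_{n-1}`. -/
def khat (θ : ℝ) (t : ℕ → ℝ) (n : ℕ) : ℝ := alpha2 θ * step t n - alpha0 θ * step t (n - 1)

section

variable {M : Type} [AddCommGroup M] [Module ℝ M]

/-- `z_{n,α}`. -/
def alphaComb (θ : ℝ) (z : ℕ → M) (n : ℕ) : M :=
  alpha2 θ • z (n + 1) + alpha1 θ • z n + alpha0 θ • z (n - 1)

/-- `z_{n,β}`. -/
def betaComb (θ : ℝ) (t : ℕ → ℝ) (z : ℕ → M) (n : ℕ) : M :=
  beta2 θ (eps t n) • z (n + 1) + beta1 θ (eps t n) • z n + beta0 θ (eps t n) • z (n - 1)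

/-- `z_{n,∗}`. -/
def starComb (θ : ℝ) (t : ℕ → ℝ) (z : ℕ → M) (n : ℕ) : M :=
  (beta2 θ (eps t n) * (1 + step t n / step t (n - 1)) + beta1 θ (eps t n)) • z n
    + (beta0 θ (eps t n) - beta2 θ (eps t n) * (step t n / step t (n - 1))) • z (n - 1)

/-- The ensemble average `⟨z⟩_n`. -/
def ensMean {J : ℕ} (z : Fin J → ℕ → M) (n : ℕ) : M := (J : ℝ)⁻¹ • ∑ j, z j n

end

/-- `t_{n,β}`. -/
def tbeta (θ : ℝ) (t : ℕ → ℝ) (n : ℕ) : ℝ := betaComb θ t t n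

/-- `0 = t_0 < t_1 < ⋯ < t_N = T`. -/
structure IsGrid (T : ℝ) (N : ℕ) (t : ℕ → ℝ) : Prop where
  start : t 0 = 0
  finish : t N = T
  lt : ∀ n < N, t n < t (n + 1)

/-! ### Exact solutions, finite element spaces, and the ensemble scheme -/

section

variable {d : ℕ} {Ω : Set (EuclideanSpace ℝ (Fin d))}

/-- `(u, p)` solves the incompressible Navier-Stokes equations on `(0,T)` with viscosity `ν`, body
force `f`, homogeneous Dirichlet condition and initial velocity `u₀`; `ut` is the time derivative of
`u`. The momentum equation holds in `X⁻¹` at every time. -/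
structure IsNSESolution (ν T : ℝ) (u₀ : X Ω) (f : ℝ → StrongDual ℝ (X Ω))
    (u : ℝ → X Ω) (ut : ℝ → L2 Ω (EuclideanSpace ℝ (Fin d))) (p : ℝ → L2 Ω ℝ) : Prop where
  deriv : IsTimeDeriv T (fun t => fld (u t)) ut
  init : u 0 = u₀
  div_free : ∀ t ∈ Icc 0 T, u t ∈ V Ω
  pressure : ∀ t ∈ Ioo 0 T, p t ∈ Q Ω
  momentum : ∀ t ∈ Ioo 0 T, ∀ v : X Ω,
    ⟪ut t, fld v⟫ + conv (u t) (u t) v + ν * gradInner (u t) v - divPair (p t) v = f t v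

/-- The regularity of an exact solution, all norms being bounded by `R`:
`u ∈ ℓ^∞({t_n}; H^r) ∩ ℓ^{∞,β}({t_n}; H^{r+1})`, `p ∈ ℓ^{2,β}({t_n}; H^{s+1})`,
`u_t, u_tt ∈ L²(0,T; H^{r+1})`, `u_ttt ∈ L²(0,T; X⁻¹)`. -/
structure Regularity (r s : ℕ) (θ T R : ℝ) (N : ℕ) (t : ℕ → ℝ)
    (u : ℝ → X Ω) (ut : ℝ → L2 Ω (EuclideanSpace ℝ (Fin d))) (p : ℝ → L2 Ω ℝ) : Prop where
  u_grid : ∀ n ≤ N, sobNorm r (fld (u (t n))) ≤ ENNReal.ofReal R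
  u_beta : ∀ n, 1 ≤ n → n + 1 ≤ N →
    sobNorm (r + 1) (fld (u (tbeta θ t n))) ≤ ENNReal.ofReal R
  p_beta : ∑ n ∈ Finset.Ico 1 N, ENNReal.ofReal (step t n + step t (n - 1)) *
    sobNorm (s + 1) (p (tbeta θ t n)) ^ 2 ≤ ENNReal.ofReal R ^ 2
  ut_bound : BochnerBound T (r + 1) ut R
  higher : ∃ (utt : ℝ → L2 Ω (EuclideanSpace ℝ (Fin d))) (uttt : ℝ → StrongDual ℝ (X Ω)),
    IsTimeDeriv T ut utt ∧ BochnerBound T (r + 1) utt R ∧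
    IsWeakTimeDeriv T (fun τ => toDual (utt τ)) uttt ∧
    ∫⁻ τ in Ioo 0 T, dualNorm (uttt τ) ^ 2 ≤ ENNReal.ofReal R ^ 2

/-- The standing assumptions on the pair `(X^h, Q^h)` of finite element spaces: conformity, the
approximation properties of degrees `r` and `s` with constant `Capp`, the inverse inequality with
constant `Cinv`, and the discrete inf-sup condition with constant `Cis`. -/
structure IsFEPair (r s : ℕ) (Capp Cinv Cis h : ℝ)
    (Xh : Submodule ℝ (X Ω)) (Qh : Submodule ℝ (L2 Ω ℝ)) : Prop where
  finX : FiniteDimensional ℝ Xh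
  finQ : FiniteDimensional ℝ Qh
  subQ : ∀ q ∈ Qh, q ∈ Q Ω
  approxX_zero : ∀ (v : X Ω) (w : Hs Ω (EuclideanSpace ℝ (Fin d)) (r + 1)),
    Hs.toL2 w = fld v → ⨅ vh : Xh, ‖fld (v - (vh : X Ω))‖ ≤ Capp * h ^ (r + 1) * Hs.seminorm w
  approxX_one : ∀ (v : X Ω) (w : Hs Ω (EuclideanSpace ℝ (Fin d)) (r + 1)),
    Hs.toL2 w = fld v → ⨅ vh : Xh, ‖v - (vh : X Ω)‖ ≤ Capp * h ^ r * Hs.seminorm w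
  approxQ : ∀ w : Hs Ω ℝ (s + 1), Hs.toL2 w ∈ Q Ω →
    ⨅ qh : Qh, ‖Hs.toL2 w - (qh : L2 Ω ℝ)‖ ≤ Capp * h ^ (s + 1) * Hs.seminorm w
  inverse : ∀ vh ∈ Xh, gradNorm vh ≤ Cinv * h⁻¹ * ‖fld vh‖
  infsup : ∀ qh ∈ Qh, Cis * ‖qh‖ ≤ ⨆ vh : Xh, divPair qh vh / gradNorm (vh : X Ω)

/-- The velocities `uh j n ∈ X^h` and pressures `ph j n ∈ Q^h` (`0 ≤ n ≤ N`) satisfy the variable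
step DLN-ensemble scheme for `n = 1, …, N - 1`. -/
structure IsDLNEnsemble {J : ℕ} (θ ν : ℝ) (N : ℕ) (t : ℕ → ℝ)
    (Xh : Submodule ℝ (X Ω)) (Qh : Submodule ℝ (L2 Ω ℝ)) (f : Fin J → ℝ → StrongDual ℝ (X Ω))
    (uh : Fin J → ℕ → X Ω) (ph : Fin J → ℕ → L2 Ω ℝ) : Prop where
  mem_X : ∀ j, ∀ n ≤ N, uh j n ∈ Xh
  mem_Q : ∀ j, ∀ n ≤ N, ph j n ∈ Qh
  momentum : ∀ j n, 1 ≤ n → n + 1 ≤ N → ∀ vh ∈ Xh,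
    ⟪(khat θ t n)⁻¹ • fld (alphaComb θ (uh j) n), fld vh⟫
        + b (starComb θ t (ensMean uh) n) (betaComb θ t (uh j) n) vh
        - divPair (betaComb θ t (ph j) n) vh
        + ν * gradInner (betaComb θ t (uh j) n) vh
      = f j (tbeta θ t n) vh
        - b (starComb θ t (uh j) n - starComb θ t (ensMean uh) n) (starComb θ t (uh j) n) vh
  incompressible : ∀ j n, 1 ≤ n → n + 1 ≤ N → ∀ qh ∈ Qh,
    divPair qh (betaComb θ t (uh j) n) = 0

/-- The CFL-like conditions with constant `Ccfl`. -/
def CFLLike {J : ℕ} (Ccfl θ ν h : ℝ) (N : ℕ) (t : ℕ → ℝ) (uh : Fin J → ℕ → X Ω) : Prop :=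
  ∀ j n, 1 ≤ n → n + 1 ≤ N →
    0 ≤ 1 - Ccfl * ((1 + eps t n * θ) / (1 - eps t n)) ^ 2 * (khat θ t n / (h * ν)) *
      gradNorm (starComb θ t (uh j) n - starComb θ t (ensMean uh) n) ^ 2

/-- The time step ratio bounds. -/
def RatioBounds (CL CU : ℝ) (N : ℕ) (t : ℕ → ℝ) : Prop :=
  ∀ n, 1 ≤ n → n + 1 ≤ N →
    CL < step t n / step t (n - 1) ∧ step t n / step t (n - 1) < CU

end

/-- `h^r + h^{s+1} + k² + h^{1/2} k^{3/2}`. -/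
def rate (r s : ℕ) (h k : ℝ) : ℝ :=
  h ^ r + h ^ (s + 1) + k ^ 2 + h ^ (1 / 2 : ℝ) * k ^ (3 / 2 : ℝ)

end DLN

end

/-!
The error `u - u^h` is split into the projection error `u - P u` and the discrete error
`φ = P u - u^h`, where `P` is the `H¹`-orthogonal projection onto the discretely divergence-free
functions. The discrete inf-sup condition gives `‖v - P v‖₁ ≲ h^r ‖v‖_{r+1}` for `v ∈ V`
(`IsFEPair.norm_sub_proj_le`), so that it suffices to bound `φ`.

*Stability.* The DLN method is `G`-stable (`inner_alpha_beta`): testing the difference of the two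
weak equations with `φ_β` produces the increment of a discrete energy, the viscous term
`ν ‖∇φ_β‖²`, and a numerical dissipation, which is a multiple of `‖φ_β - φ_*‖²`
(`betaComb_sub_starComb`).

*The nonlinear terms.* They are arranged in `error_equation` so that each is a consistency error,
or contains `φ_*`, which only involves old time levels, or is `b(w, φ_β - φ_*, φ_β)`, where `w` is
the fluctuation `u^{j,h}_* - ⟨u^h⟩_*`. Integration by parts and interpolation of `L³` between `L²`
and `L⁶` bound the last one by `‖∇w‖ ‖v‖^{1/2} ‖∇v‖^{1/2} ‖∇φ_β‖` with `v = φ_β - φ_*`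
(`SobolevBounds.abs_b_le_interp`), and by the inverse inequality by
`h^{-1/2} ‖∇w‖ ‖φ_β - φ_*‖ ‖∇φ_β‖`. Under the CFL-like conditions the numerical dissipation absorbs
the square of this (`cfl_bounds`). The same conditions give `k̂ₙ ‖∇w‖² ≲ h`, and the consistency
error that contains `w` therefore contributes `h^{1/2} k^{3/2}` (`consistency_sq_le`). In the terms
with `φ_*` the inverse inequality costs a power of `h`, which the projection error pays for, as
`r ≥ 1` (`error_estimate`).

*Consistency in time.* The coefficients `α` annihilate constants and `(s - t_{n,β})²`
(`alpha_sq_moment`), and both interpolation and extrapolation are exact for affine functions. With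
the Taylor expansions of functions with square integrable time derivatives this gives errors of
second order that are square summable over the steps (`exists_timeBounds`). The truncation error of
the time derivative is tested with a fixed function before it is expanded (`abs_truncation_le`),
because the third derivative takes its values in `X⁻¹`.

*Conclusion.* The discrete energies satisfy a recursion (`exists_energy_step`), to which
`discrete_gronwall` applies.

*Sobolev embeddings.* The trilinear form is bounded by means of `H¹₀ ⊆ L⁶`, which follows from the
Gagliardo-Nirenberg-Sobolev inequality of Mathlib, and of `H¹(Ω) ⊆ L⁴` and `H²(Ω) ⊆ W^{1,4} ∩ L^∞`.
For the latter the cone condition gives a pointwise estimate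
(`ConeCondition.exists_ae_le_coneBound`): a function is bounded at `x` by integrals of itself and of
its weak gradient over the translates of a ball that shrinks to `x`, and Hölder's inequality bounds
these in dimension at most three.
-/

noncomputable section

namespace DLN

/-! ### Sobolev spaces -/

section

variable {d : ℕ} {Ω : Set (EuclideanSpace ℝ (Fin d))}
  {F : Type} [NormedAddCommGroup F] [InnerProductSpace ℝ F]

theorem continuous_integral_smul_test [CompleteSpace F] {φ : EuclideanSpace ℝ (Fin d) → ℝ}
    (hφ : Continuous φ) (hc : HasCompactSupport φ) :
    Continuous (fun f : L2 Ω F => ∫ x in Ω, φ x • f x) := by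
  have hφm : MemLp φ 2 (volume.restrict Ω) := hφ.memLp_of_hasCompactSupport hc
  let T : L2 Ω F →ₗ[ℝ] F :=
    { toFun := fun f => ∫ x in Ω, φ x • f x
      map_add' := by
        intro f g
        rw [← integral_add (integrable_smul_test Ω F hφ hc f) (integrable_smul_test Ω F hφ hc g)]
        refine integral_congr_ae ?_
        filter_upwards [Lp.coeFn_add f g] with x hx
        rw [hx, Pi.add_apply, smul_add]
      map_smul' := by
        intro c f
        rw [RingHom.id_apply, ← integral_smul]
        refine integral_congr_ae ?_
        filter_upwards [Lp.coeFn_smul c f] with x hx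
        rw [hx, Pi.smul_apply, smul_comm] }
  refine (T.mkContinuous (eLpNorm φ 2 (volume.restrict Ω)).toReal fun f => ?_).continuous
  have h1 : ‖T f‖ₑ ≤ eLpNorm φ 2 (volume.restrict Ω) * eLpNorm f 2 (volume.restrict Ω) := by
    refine (enorm_integral_le_lintegral_enorm _).trans ?_
    rw [← eLpNorm_one_eq_lintegral_enorm]
    exact eLpNorm_smul_le_mul_eLpNorm (Lp.aestronglyMeasurable f) hφm.1
  rw [Lp.norm_def, ← ENNReal.toReal_mul, ← toReal_enorm]
  exact ENNReal.toReal_mono (ENNReal.mul_ne_top hφm.2.ne (Lp.eLpNorm_ne_top f)) h1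

theorem Hs.isClosed [CompleteSpace F] (ℓ : ℕ) :
    IsClosed (Hs Ω F ℓ : Set (PiLp 2 (fun _ : DerivIdx d ℓ => L2 Ω F))) := by
  have : (Hs Ω F ℓ : Set (PiLp 2 (fun _ : DerivIdx d ℓ => L2 Ω F))) =
      ⋂ (i : DerivIdx d ℓ) (φ : EuclideanSpace ℝ (Fin d) → ℝ) (_ : ContDiff ℝ ∞ φ)
        (_ : HasCompactSupport φ) (_ : tsupport φ ⊆ Ω),
        {w | ∫ x in Ω, partialDeriv i.2 φ x • (w (zeroIdx d ℓ) : L2 Ω F) x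
          = (-1 : ℝ) ^ (i.1 : ℕ) • ∫ x in Ω, φ x • (w i : L2 Ω F) x} := by
    ext w
    simp only [mem_iInter]
    rfl
  rw [this]
  refine isClosed_iInter fun i => isClosed_iInter fun φ => isClosed_iInter fun h1 =>
    isClosed_iInter fun h2 => isClosed_iInter fun _ => isClosed_eq ?_ ?_
  · exact (continuous_integral_smul_test (continuous_partialDeriv _ h1)
      (hasCompactSupport_partialDeriv _ h2)).comp (PiLp.continuous_apply 2 _ (zeroIdx d ℓ))
  · exact ((continuous_integral_smul_test h1.continuous h2).comp
      (PiLp.continuous_apply 2 _ i)).const_smul _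

instance Hs.completeSpace [CompleteSpace F] (ℓ : ℕ) : CompleteSpace (Hs Ω F ℓ) :=
  (Hs.isClosed ℓ).completeSpace_coe

/-- The fundamental lemma of the calculus of variations in `L²(Ω)`. -/
theorem ae_eq_of_integral_test_eq [CompleteSpace F] (hΩ : IsOpen Ω) {f g : L2 Ω F}
    (h : ∀ φ : EuclideanSpace ℝ (Fin d) → ℝ, ContDiff ℝ ∞ φ → HasCompactSupport φ →
      tsupport φ ⊆ Ω → ∫ x in Ω, φ x • f x = ∫ x in Ω, φ x • g x) : f = g := by
  have hloc : LocallyIntegrable (fun x => f x - g x) (volume.restrict Ω) :=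
    ((Lp.memLp f).locallyIntegrable (by norm_num)).sub
      ((Lp.memLp g).locallyIntegrable (by norm_num))
  have key := IsOpen.ae_eq_zero_of_integral_contDiff_smul_eq_zero (μ := volume.restrict Ω) hΩ
    (hloc.locallyIntegrableOn Ω) (fun φ h1 h2 h3 => by
      simp_rw [smul_sub]
      rw [integral_sub (integrable_smul_test Ω F h1.continuous h2 f)
        (integrable_smul_test Ω F h1.continuous h2 g), h φ h1 h2 h3, sub_self])
  refine Lp.ext ?_
  filter_upwards [key, ae_restrict_mem hΩ.measurableSet] with x hx hxΩ
  exact sub_eq_zero.1 (hx hxΩ)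

theorem HasWeakDeriv.unique [CompleteSpace F] (hΩ : IsOpen Ω) {k : ℕ} {I : Fin k → Fin d}
    {f g g' : L2 Ω F} (hg : HasWeakDeriv Ω I f g) (hg' : HasWeakDeriv Ω I f g') : g = g' := by
  refine ae_eq_of_integral_test_eq hΩ fun φ h1 h2 h3 => ?_
  have := (hg φ h1 h2 h3).symm.trans (hg' φ h1 h2 h3)
  exact smul_right_injective F (pow_ne_zero k (by norm_num : (-1 : ℝ) ≠ 0)) this

theorem Hs.toL2_injective [CompleteSpace F] (hΩ : IsOpen Ω) (ℓ : ℕ) :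
    Function.Injective (Hs.toL2 : Hs Ω F ℓ → L2 Ω F) := by
  intro v w hvw
  have h0 : v.1 (zeroIdx d ℓ) = w.1 (zeroIdx d ℓ) := hvw
  refine Subtype.ext (PiLp.ext fun i => ?_)
  refine HasWeakDeriv.unique hΩ (v.2 i) ?_
  have := w.2 i
  rwa [← h0] at this

/-- The inclusion of index sets of derivatives. -/
def DerivIdx.castLE {m ℓ : ℕ} (h : m ≤ ℓ) (i : DerivIdx d m) : DerivIdx d ℓ :=
  ⟨⟨i.1, lt_of_lt_of_le i.1.2 (Nat.succ_le_succ h)⟩, i.2⟩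

theorem DerivIdx.castLE_injective {m ℓ : ℕ} (h : m ≤ ℓ) :
    Function.Injective (DerivIdx.castLE (d := d) h) := by
  rintro ⟨⟨a, ha⟩, I⟩ ⟨⟨b, hb⟩, I'⟩ hab
  simp only [DerivIdx.castLE, Sigma.mk.injEq, Fin.mk.injEq] at hab
  obtain ⟨rfl, hI⟩ := hab
  simp only [heq_eq_eq] at hI
  subst hI
  rfl

/-- The inclusion `H^ℓ ⊆ H^m` for `m ≤ ℓ`, which forgets the derivatives of order above `m`. -/
def Hs.inclₗ {m ℓ : ℕ} (h : m ≤ ℓ) : Hs Ω F ℓ →ₗ[ℝ] Hs Ω F m where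
  toFun := fun w => ⟨WithLp.toLp 2 fun i => w.1 (DerivIdx.castLE h i), fun i =>
    w.2 (DerivIdx.castLE h i)⟩
  map_add' := fun _ _ => rfl
  map_smul' := fun _ _ => rfl

theorem Hs.norm_inclₗ_le {m ℓ : ℕ} (h : m ≤ ℓ) (w : Hs Ω F ℓ) : ‖Hs.inclₗ h w‖ ≤ ‖w‖ := by
  change ‖WithLp.toLp 2 fun i => w.1 (DerivIdx.castLE h i)‖ ≤ ‖w.1‖
  rw [PiLp.norm_eq_of_L2, PiLp.norm_eq_of_L2]
  refine Real.sqrt_le_sqrt ?_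
  have := Finset.sum_map Finset.univ ⟨_, DerivIdx.castLE_injective (d := d) h⟩
    (fun i => ‖w.1 i‖ ^ 2)
  simp only [Function.Embedding.coeFn_mk] at this
  rw [← this]
  exact Finset.sum_le_sum_of_subset_of_nonneg (Finset.subset_univ _) fun _ _ _ => by positivity

/-- The continuous inclusion `H^ℓ ⊆ H^m` for `m ≤ ℓ`. -/
def Hs.incl {m ℓ : ℕ} (h : m ≤ ℓ) : Hs Ω F ℓ →L[ℝ] Hs Ω F m :=
  (Hs.inclₗ h).mkContinuous 1 fun w => (Hs.norm_inclₗ_le h w).trans_eq (one_mul _).symm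

theorem Hs.norm_incl_le {m ℓ : ℕ} (h : m ≤ ℓ) (w : Hs Ω F ℓ) : ‖Hs.incl h w‖ ≤ ‖w‖ :=
  Hs.norm_inclₗ_le h w

theorem Hs.norm_apply_le {ℓ : ℕ} (w : Hs Ω F ℓ) (i : DerivIdx d ℓ) : ‖w.1 i‖ ≤ ‖w‖ :=
  PiLp.norm_apply_le w.1 i

theorem Hs.seminorm_le_norm {ℓ : ℕ} (w : Hs Ω F ℓ) : Hs.seminorm w ≤ ‖w‖ := by
  change _ ≤ ‖w.1‖
  rw [PiLp.norm_eq_of_L2]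
  refine Real.sqrt_le_sqrt ?_
  rw [Fintype.sum_sigma]
  exact Finset.single_le_sum (f := fun k : Fin (ℓ + 1) => ∑ I : Fin (k : ℕ) → Fin d,
    ‖w.1 ⟨k, I⟩‖ ^ 2) (fun _ _ => by positivity) (Finset.mem_univ (⟨ℓ, Nat.lt_succ_self ℓ⟩))

theorem Hs.norm_sq_one (w : Hs Ω F 1) :
    ‖w‖ ^ 2 = ‖Hs.toL2 w‖ ^ 2 + ∑ i, ‖w.1 ⟨⟨1, Nat.lt_succ_self 1⟩, fun _ => i⟩‖ ^ 2 := by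
  change ‖w.1‖ ^ 2 = _
  rw [PiLp.norm_sq_eq_of_L2, Fintype.sum_sigma, Fin.sum_univ_two]
  congr 1
  · change ∑ I : Fin 0 → Fin d, ‖w.1 ⟨⟨0, Nat.succ_pos 1⟩, I⟩‖ ^ 2 = _
    rw [Fintype.sum_unique]
    have : (default : Fin 0 → Fin d) = fun a => Fin.elim0 a := funext fun a => Fin.elim0 a
    rw [this]
    rfl
  · refine Fintype.sum_equiv (Equiv.funUnique (Fin 1) (Fin d)) _ _ fun I => ?_
    have : I = fun _ => (Equiv.funUnique (Fin 1) (Fin d)) I := by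
      funext a
      simp [Subsingleton.elim a 0]
    conv_lhs => rw [this]
    rfl

/-- Weak derivatives on an open set are unique, so that the infimum in the definition of `sobNorm`
is taken over a single element. -/
theorem sobNorm_eq [CompleteSpace F] (hΩ : IsOpen Ω) {ℓ : ℕ} (w : Hs Ω F ℓ) :
    sobNorm ℓ (Hs.toL2 w) = ‖w‖ₑ := by
  refine le_antisymm (iInf₂_le (f := fun (v : Hs Ω F ℓ) (_ : Hs.toL2 v = Hs.toL2 w) => ‖v‖ₑ)
    w rfl) (le_iInf₂ fun v hv => ?_)
  rw [Hs.toL2_injective hΩ ℓ hv]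

/-- A finite bound of the extended norm provides a representative in `H^ℓ`. The bound `R` may be
negative, in which case `f = 0`. -/
theorem exists_of_sobNorm_le [CompleteSpace F] (hΩ : IsOpen Ω) {ℓ : ℕ} {f : L2 Ω F} {R : ℝ}
    (h : sobNorm ℓ f ≤ ENNReal.ofReal R) : ∃ w : Hs Ω F ℓ, Hs.toL2 w = f ∧ ‖w‖ ≤ max R 0 := by
  have hlt : sobNorm ℓ f < ⊤ := h.trans_lt ENNReal.ofReal_lt_top
  simp only [sobNorm, iInf_lt_iff] at hlt
  obtain ⟨w, hw, -⟩ := hlt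
  refine ⟨w, hw, ?_⟩
  rw [← hw, sobNorm_eq hΩ] at h
  rw [← toReal_enorm, ← ENNReal.toReal_ofReal']
  exact ENNReal.toReal_mono ENNReal.ofReal_ne_top h

/-- The second derivative `∂ᵢ∂ⱼφ` as an iterated first derivative. -/
theorem partialDeriv_two (i j : Fin d) {φ : EuclideanSpace ℝ (Fin d) → ℝ} (hφ : ContDiff ℝ ∞ φ)
    (x : EuclideanSpace ℝ (Fin d)) :
    partialDeriv ![i, j] φ x
      = partialDeriv (fun _ : Fin 1 => i) (partialDeriv (fun _ : Fin 1 => j) φ) x := by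
  have h1 (ψ : EuclideanSpace ℝ (Fin d) → ℝ) (l : Fin d) (y : EuclideanSpace ℝ (Fin d)) :
      partialDeriv (fun _ : Fin 1 => l) ψ y = fderiv ℝ ψ y (EuclideanSpace.single l 1) := by
    simp [partialDeriv, iteratedFDeriv_one_apply]
  have h2 : partialDeriv (fun _ : Fin 1 => j) φ =
      fun y => fderiv ℝ φ y (EuclideanSpace.single j 1) := funext fun y => h1 φ j y
  rw [h1, h2, partialDeriv, iteratedFDeriv_two_apply]
  have : DifferentiableAt ℝ (fderiv ℝ φ) x :=
    ((hφ.fderiv_right (m := ∞) (by exact_mod_cast le_top)).differentiable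
      (by simp)).differentiableAt
  rw [fderiv_clm_apply this (differentiableAt_const _)]
  simp

theorem partialDeriv_one (l : Fin d) (ψ : EuclideanSpace ℝ (Fin d) → ℝ)
    (y : EuclideanSpace ℝ (Fin d)) :
    partialDeriv (fun _ : Fin 1 => l) ψ y = fderiv ℝ ψ y (EuclideanSpace.single l 1) := by
  simp [partialDeriv, iteratedFDeriv_one_apply]

theorem contDiff_partialDeriv_one (l : Fin d) {φ : EuclideanSpace ℝ (Fin d) → ℝ}
    (hφ : ContDiff ℝ ∞ φ) : ContDiff ℝ ∞ (partialDeriv (fun _ : Fin 1 => l) φ) := by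
  rw [funext (partialDeriv_one l φ)]
  exact (hφ.fderiv_right (m := ∞) (by exact_mod_cast le_top)).clm_apply contDiff_const

theorem tsupport_partialDeriv_one_subset (l : Fin d) (φ : EuclideanSpace ℝ (Fin d) → ℝ) :
    tsupport (partialDeriv (fun _ : Fin 1 => l) φ) ⊆ tsupport φ := by
  rw [funext (partialDeriv_one l φ)]
  exact tsupport_fderiv_apply_subset ℝ _

/-- The first derivatives of `U ∈ H²` have weak derivatives, the second derivatives of `U`. -/
theorem Hs.hasWeakDeriv_deriv (U : Hs Ω F 2) (i j : Fin d) :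
    HasWeakDeriv Ω (fun _ : Fin 1 => j) (U.1 ⟨⟨1, by norm_num⟩, fun _ => i⟩)
      (U.1 ⟨⟨2, by norm_num⟩, ![i, j]⟩) := by
  intro φ h1 h2 h3
  have a := U.2 ⟨⟨2, by norm_num⟩, ![i, j]⟩ φ h1 h2 h3
  have b := U.2 ⟨⟨1, by norm_num⟩, fun _ => i⟩ (partialDeriv (fun _ : Fin 1 => j) φ)
    (contDiff_partialDeriv_one j h1) (hasCompactSupport_partialDeriv _ h2)
    ((tsupport_partialDeriv_one_subset j φ).trans h3)
  simp only [partialDeriv_two i j h1] at a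
  rw [a] at b
  simp only [pow_one] at b ⊢
  rw [pow_two] at b
  have b' := congrArg (fun z : F => (-1 : ℝ) • z) b
  simp only [smul_smul] at b'
  norm_num at b'
  norm_num
  exact b'.symm

end

/-! ### Test functions moved along segments -/

section

variable {d : ℕ} {Ω : Set (EuclideanSpace ℝ (Fin d))}
  {F : Type} [NormedAddCommGroup F] [InnerProductSpace ℝ F]

theorem hasCompactSupport_translate {φ : EuclideanSpace ℝ (Fin d) → ℝ}
    (hc : HasCompactSupport φ) (z : EuclideanSpace ℝ (Fin d)) :
    HasCompactSupport fun y => φ (y - z) :=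
  hc.comp_homeomorph (Homeomorph.subRight z)

theorem tsupport_translate_subset {φ : EuclideanSpace ℝ (Fin d) → ℝ}
    {z : EuclideanSpace ℝ (Fin d)} (h : ∀ y ∈ tsupport φ, y + z ∈ Ω) :
    tsupport (fun y => φ (y - z)) ⊆ Ω := by
  intro y hy
  have : y - z ∈ tsupport φ := by
    have := tsupport_comp_subset_preimage φ (f := fun y => y - z) (by fun_prop) hy
    exact this
  simpa using h _ this

/-- The weak gradient bounds the pairing of `f` with a directional derivative of a nonnegative test
function. -/
theorem enorm_integral_directional_le [CompleteSpace F]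
    {f : L2 Ω F} {g : Fin d → L2 Ω F}
    (hg : ∀ j, HasWeakDeriv Ω (fun _ : Fin 1 => j) f (g j))
    {φ : EuclideanSpace ℝ (Fin d) → ℝ} (hφ : ContDiff ℝ ∞ φ) (hc : HasCompactSupport φ)
    (h0 : ∀ x, 0 ≤ φ x) (hs : tsupport φ ⊆ Ω) (z : EuclideanSpace ℝ (Fin d)) :
    ‖∫ x in Ω, fderiv ℝ φ x z • f x‖ₑ ≤
      ‖z‖ₑ * ∫⁻ x in Ω, ENNReal.ofReal (φ x) * ∑ j, ‖g j x‖ₑ := by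
  have hz : ∀ x, fderiv ℝ φ x z • f x
      = ∑ j, z j • (partialDeriv (fun _ : Fin 1 => j) φ x • f x) := by
    intro x
    simp_rw [partialDeriv_one, smul_smul]
    rw [← Finset.sum_smul]
    congr 1
    conv_lhs => rw [← (EuclideanSpace.basisFun (Fin d) ℝ).sum_repr z]
    simp
  have h1 : ∫ x in Ω, fderiv ℝ φ x z • f x = -∑ j, z j • ∫ x in Ω, φ x • g j x := by
    simp_rw [hz]
    rw [integral_finsetSum _ fun j _ => ?_]
    · rw [← Finset.sum_neg_distrib]
      refine Finset.sum_congr rfl fun j _ => ?_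
      rw [integral_smul, hg j φ hφ hc hs]
      simp
    · exact (integrable_smul_test Ω F (continuous_partialDeriv _ hφ)
        (hasCompactSupport_partialDeriv _ hc) f).smul (z j)
  rw [h1, enorm_neg]
  have hm : ∀ j, AEMeasurable (fun x => ENNReal.ofReal (φ x) * ‖g j x‖ₑ)
      (volume.restrict Ω) := fun j =>
    hφ.continuous.measurable.ennreal_ofReal.aemeasurable.mul
      (Lp.aestronglyMeasurable (g j)).enorm
  simp_rw [Finset.mul_sum]
  rw [lintegral_finsetSum' _ fun j _ => hm j, Finset.mul_sum]
  refine (enorm_sum_le _ _).trans (Finset.sum_le_sum fun j _ => ?_)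
  rw [enorm_smul]
  gcongr
  · simpa [enorm_le_iff_norm_le] using PiLp.norm_apply_le z j
  · refine (enorm_integral_le_lintegral_enorm _).trans (lintegral_mono fun x => ?_)
    rw [enorm_smul, Real.enorm_eq_ofReal (h0 x)]

/-- Moving a test function along a segment inside `Ω` controls its pairing with `f` by a translated
pairing and by the pairings of the weak gradient along the segment. -/
theorem enorm_integral_test_le_translate [CompleteSpace F] (hΩb : Bornology.IsBounded Ω)
    {f : L2 Ω F} {g : Fin d → L2 Ω F}
    (hg : ∀ j, HasWeakDeriv Ω (fun _ : Fin 1 => j) f (g j))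
    {φ : EuclideanSpace ℝ (Fin d) → ℝ} (hφ : ContDiff ℝ ∞ φ) (hc : HasCompactSupport φ)
    (h0 : ∀ x, 0 ≤ φ x) (z : EuclideanSpace ℝ (Fin d))
    (hs : ∀ s ∈ Icc (0 : ℝ) 1, ∀ y ∈ tsupport φ, y + s • z ∈ Ω) :
    ‖∫ x in Ω, φ x • f x‖ₑ ≤ (∫⁻ x in Ω, ENNReal.ofReal (φ (x - z)) * ‖f x‖ₑ)
      + ‖z‖ₑ * ∫⁻ s in Ioc (0 : ℝ) 1, ∫⁻ x in Ω,
          ENNReal.ofReal (φ (x - s • z)) * ∑ j, ‖g j x‖ₑ := by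
  have : IsFiniteMeasure (volume.restrict Ω) :=
    ⟨by rw [Measure.restrict_apply_univ]; exact hΩb.measure_lt_top⟩
  have hfi : Integrable f (volume.restrict Ω) := (Lp.memLp f).integrable (by norm_num)
  have hD : Continuous fun y => fderiv ℝ φ y z :=
    (hφ.continuous_fderiv (by simp)).clm_apply continuous_const
  obtain ⟨B, hB⟩ : ∃ B : ℝ, ∀ y, ‖fderiv ℝ φ y z‖ ≤ B :=
    hD.bounded_above_of_compact_support (HasCompactSupport.comp_left
      (g := fun L : EuclideanSpace ℝ (Fin d) →L[ℝ] ℝ => L z) (hc.fderiv (𝕜 := ℝ)) rfl)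
  -- the fundamental theorem of calculus for the pairing with the moving test function
  set ψ : ℝ → F := fun s => ∫ x in Ω, φ (x - s • z) • f x with hψ
  set ψ' : ℝ → F := fun s => ∫ x in Ω, (-fderiv ℝ φ (x - s • z) z) • f x with hψ'
  have hderiv : ∀ s, HasDerivAt ψ (ψ' s) s := by
    intro s
    refine (hasDerivAt_integral_of_dominated_loc_of_deriv_le (s := univ)
      (F := fun s x => φ (x - s • z) • f x) (F' := fun s x => (-fderiv ℝ φ (x - s • z) z) • f x)
      (bound := fun x => B * ‖f x‖) Filter.univ_mem ?_ ?_ ?_ ?_ ?_ ?_).2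
    · refine Filter.Eventually.of_forall fun s => ?_
      exact (hφ.continuous.comp
        (by fun_prop : Continuous fun x => x - s • z)).aestronglyMeasurable.smul hfi.1
    · exact integrable_smul_test Ω F (hφ.continuous.comp (by fun_prop))
        (hasCompactSupport_translate hc _) f
    · exact (hD.neg.comp (by fun_prop : Continuous fun x => x - s • z)).aestronglyMeasurable.smul
        hfi.1
    · refine Filter.Eventually.of_forall fun x s _ => ?_
      rw [norm_smul, norm_neg]
      gcongr
      exact hB _
    · exact hfi.norm.const_mul B
    · refine Filter.Eventually.of_forall fun x s _ => ?_
      refine HasDerivAt.smul_const ?_ _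
      have h1 : HasDerivAt (fun s : ℝ => x - s • z) (-z) s := by
        simpa using ((hasDerivAt_id s).smul_const z).const_sub x
      have h2 : HasDerivAt (fun s : ℝ => φ (x - s • z)) (fderiv ℝ φ (x - s • z) (-z)) s :=
        ((hφ.differentiable (by simp)).differentiableAt
          (x := x - s • z)).hasFDerivAt.comp_hasDerivAt s h1
      rwa [map_neg] at h2
  have hcont : Continuous ψ' := by
    refine continuous_of_dominated (bound := fun x => B * ‖f x‖) ?_ ?_ ?_ ?_
    · exact fun s => (hD.neg.comp
        (by fun_prop : Continuous fun x => x - s • z)).aestronglyMeasurable.smul hfi.1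
    · refine fun s => Filter.Eventually.of_forall fun x => ?_
      rw [norm_smul, norm_neg]
      gcongr
      exact hB _
    · exact hfi.norm.const_mul B
    · refine Filter.Eventually.of_forall fun x => ?_
      exact (hD.neg.comp (by fun_prop : Continuous fun s : ℝ => x - s • z)).smul continuous_const
  have hftc : ∫ s in (0 : ℝ)..1, ψ' s = ψ 1 - ψ 0 :=
    intervalIntegral.integral_eq_sub_of_hasDerivAt (fun s _ => hderiv s)
      (hcont.intervalIntegrable _ _)
  have h00 : ∫ x in Ω, φ x • f x = ψ 1 - ∫ s in (0 : ℝ)..1, ψ' s := by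
    rw [hftc]; simp [hψ]
  rw [h00, sub_eq_add_neg]
  refine (enorm_add_le _ _).trans (add_le_add ?_ ?_)
  · refine (enorm_integral_le_lintegral_enorm _).trans (lintegral_mono fun x => ?_)
    rw [enorm_smul, Real.enorm_eq_ofReal (h0 _), one_smul]
  · rw [enorm_neg, intervalIntegral.integral_of_le zero_le_one]
    refine (enorm_integral_le_lintegral_enorm _).trans ?_
    rw [← lintegral_const_mul' _ _ (by simp)]
    refine setLIntegral_mono' measurableSet_Ioc fun s hs' => ?_
    have key := enorm_integral_directional_le hg (φ := fun y => φ (y - s • z))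
      (hφ.comp (contDiff_id.sub contDiff_const))
      (hasCompactSupport_translate hc _) (fun x => h0 _)
      (tsupport_translate_subset (hs s ⟨hs'.1.le, hs'.2⟩)) (z)
    refine le_trans (le_of_eq ?_) key
    rw [hψ', ← enorm_neg, ← integral_neg]
    simp_rw [neg_smul, neg_neg, fderiv_comp_sub]

end

/-! ### Integrals over shrinking balls -/

section

variable {d : ℕ}

theorem lintegral_mul_rpow_le {α : Type*} [MeasurableSpace α] (μ : Measure α) {p q : ℝ}
    (hpq : p.HolderConjugate q) {f g : α → ℝ≥0∞} (hf : AEMeasurable f μ) (hg : AEMeasurable g μ) :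
    (∫⁻ a, f a * g a ∂μ) ^ p ≤ (∫⁻ a, f a ^ p ∂μ) * (∫⁻ a, g a ^ q ∂μ) ^ (p / q) := by
  have h := ENNReal.rpow_le_rpow (ENNReal.lintegral_mul_le_Lp_mul_Lq μ hpq hf hg) hpq.nonneg
  refine h.trans_eq ?_
  rw [ENNReal.mul_rpow_of_nonneg _ _ hpq.nonneg, ← ENNReal.rpow_mul, ← ENNReal.rpow_mul,
    one_div_mul_cancel hpq.ne_zero, ENNReal.rpow_one, one_div, inv_mul_eq_div]

theorem lintegral_sq_le {α : Type*} [MeasurableSpace α] (μ : Measure α) {f : α → ℝ≥0∞}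
    (hf : AEMeasurable f μ) : (∫⁻ a, f a ∂μ) ^ 2 ≤ μ univ * ∫⁻ a, f a ^ 2 ∂μ := by
  have h := lintegral_mul_rpow_le μ (p := 2) (q := 2) (by norm_num [Real.holderConjugate_iff]) hf
    (g := fun _ => 1) aemeasurable_const
  simpa [mul_comm] using h

theorem lintegral_pow_four_le {α : Type*} [MeasurableSpace α] (μ : Measure α) {f : α → ℝ≥0∞}
    (hf : AEMeasurable f μ) : (∫⁻ a, f a ∂μ) ^ 4 ≤ μ univ ^ 3 * ∫⁻ a, f a ^ 4 ∂μ := by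
  have h := lintegral_mul_rpow_le μ (p := 4) (q := 4 / 3) (by norm_num [Real.holderConjugate_iff])
    hf (g := fun _ => 1) aemeasurable_const
  norm_num at h
  rw [mul_comm]
  exact_mod_cast h

/-- The integral of `a` over the translated and scaled ball `x + s B(0, ρ)`, in the coordinates of
the unscaled ball. -/
def ballInt (ρ s : ℝ) (a : EuclideanSpace ℝ (Fin d) → ℝ≥0∞) (x : EuclideanSpace ℝ (Fin d)) :
    ℝ≥0∞ :=
  ∫⁻ z in Metric.ball (0 : EuclideanSpace ℝ (Fin d)) ρ, a (x + s • z)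

theorem lintegral_comp_add_smul {a : EuclideanSpace ℝ (Fin d) → ℝ≥0∞} (ha : Measurable a)
    (x : EuclideanSpace ℝ (Fin d)) {s : ℝ} (hs : 0 < s) :
    ∫⁻ z, a (x + s • z) = ENNReal.ofReal ((s ^ d)⁻¹) * ∫⁻ z, a z := by
  have h1 : ∫⁻ z, a (x + s • z) = ∫⁻ z, a (x + z) ∂(Measure.map (s • ·) volume) := by
    exact (lintegral_map (ha.comp (measurable_const_add x)) (measurable_const_smul s)).symm
  rw [h1, Measure.map_addHaar_smul _ hs.ne', lintegral_smul_measure, lintegral_add_left_eq_self,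
    abs_of_pos (by positivity), finrank_euclideanSpace_fin, smul_eq_mul]

theorem measurable_ballInt {ρ : ℝ} {a : EuclideanSpace ℝ (Fin d) → ℝ≥0∞} (ha : Measurable a) :
    Measurable fun q : ℝ × EuclideanSpace ℝ (Fin d) => ballInt ρ q.1 a q.2 := by
  unfold ballInt
  refine Measurable.lintegral_prod_right'
    (f := fun r : (ℝ × EuclideanSpace ℝ (Fin d)) × EuclideanSpace ℝ (Fin d) =>
      a (r.1.2 + r.1.1 • r.2)) (ha.comp ?_)
  fun_prop

/-- The Cauchy-Schwarz inequality on the ball; the change of variables costs `s⁻ᵈ`. -/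
theorem ballInt_sq_le (ρ : ℝ) {a : EuclideanSpace ℝ (Fin d) → ℝ≥0∞} (ha : Measurable a)
    (x : EuclideanSpace ℝ (Fin d)) {s : ℝ} (hs : 0 < s) :
    ballInt ρ s a x ^ 2 ≤ volume (Metric.ball (0 : EuclideanSpace ℝ (Fin d)) ρ) *
      (ENNReal.ofReal ((s ^ d)⁻¹) * ∫⁻ z, a z ^ 2) := by
  have hm : Measurable fun z : EuclideanSpace ℝ (Fin d) => a (x + s • z) := ha.comp (by fun_prop)
  refine (lintegral_sq_le _ hm.aemeasurable).trans ?_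
  rw [Measure.restrict_apply_univ]
  gcongr
  rw [← lintegral_comp_add_smul (ha.pow_const 2) x hs]
  exact setLIntegral_le_lintegral _ _

theorem ballInt_pow_four_le (ρ : ℝ) {a : EuclideanSpace ℝ (Fin d) → ℝ≥0∞} (ha : Measurable a)
    (x : EuclideanSpace ℝ (Fin d)) {s : ℝ} (hs : 0 < s) :
    ballInt ρ s a x ^ 4 ≤ volume (Metric.ball (0 : EuclideanSpace ℝ (Fin d)) ρ) ^ 3 *
      (ENNReal.ofReal ((s ^ d)⁻¹) * ∫⁻ z, a z ^ 4) := by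
  have hm : Measurable fun z : EuclideanSpace ℝ (Fin d) => a (x + s • z) := ha.comp (by fun_prop)
  refine (lintegral_pow_four_le _ hm.aemeasurable).trans ?_
  rw [Measure.restrict_apply_univ]
  gcongr
  rw [← lintegral_comp_add_smul (ha.pow_const 4) x hs]
  exact setLIntegral_le_lintegral _ _

theorem lintegral_ballInt (ρ s : ℝ) {a : EuclideanSpace ℝ (Fin d) → ℝ≥0∞} (ha : Measurable a) :
    ∫⁻ x, ballInt ρ s a x
      = volume (Metric.ball (0 : EuclideanSpace ℝ (Fin d)) ρ) * ∫⁻ z, a z := by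
  unfold ballInt
  rw [lintegral_lintegral_swap]
  · simp_rw [lintegral_add_right_eq_self a]
    rw [lintegral_const, Measure.restrict_apply_univ, mul_comm]
  · exact (ha.comp (by fun_prop)).aemeasurable

/-- Two of the four powers are bounded uniformly in `x` by `ballInt_sq_le`, the other two are
integrated, which gains a factor `s^d` over the uniform bound of all four. -/
theorem lintegral_ballInt_pow_four_le (ρ : ℝ) {a : EuclideanSpace ℝ (Fin d) → ℝ≥0∞}
    (ha : Measurable a) {s : ℝ} (hs : 0 < s) :
    ∫⁻ x, ballInt ρ s a x ^ 4 ≤ volume (Metric.ball (0 : EuclideanSpace ℝ (Fin d)) ρ) ^ 3 *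
      (ENNReal.ofReal ((s ^ d)⁻¹) * (∫⁻ z, a z ^ 2) ^ 2) := by
  set b := volume (Metric.ball (0 : EuclideanSpace ℝ (Fin d)) ρ)
  have h2 : ∀ x, ballInt ρ s a x ^ 2 ≤ b * ballInt ρ s (fun z => a z ^ 2) x := fun x => by
    have hm : Measurable fun z : EuclideanSpace ℝ (Fin d) => a (x + s • z) := ha.comp (by fun_prop)
    refine (lintegral_sq_le _ hm.aemeasurable).trans_eq ?_
    rw [Measure.restrict_apply_univ]
    rfl
  have hm : Measurable fun x => ballInt ρ s (fun z => a z ^ 2) x :=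
    (measurable_ballInt (ha.pow_const 2)).comp (by fun_prop : Measurable fun x => (s, x))
  calc ∫⁻ x, ballInt ρ s a x ^ 4
      ≤ ∫⁻ x, (b * (ENNReal.ofReal ((s ^ d)⁻¹) * ∫⁻ z, a z ^ 2)) *
          (b * ballInt ρ s (fun z => a z ^ 2) x) := by
        refine lintegral_mono fun x => ?_
        rw [show (4 : ℕ) = 2 + 2 from rfl, pow_add]
        exact mul_le_mul' (ballInt_sq_le ρ ha x hs) (h2 x)
    _ = _ := by
        rw [lintegral_const_mul _ (hm.const_mul _), lintegral_const_mul _ hm,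
          lintegral_ballInt ρ s (ha.pow_const 2)]
        ring

theorem measurable_ofReal_rpow (r : ℝ) : Measurable fun s : ℝ => ENNReal.ofReal (s ^ r) :=
  (measurable_id.pow_const r).ennreal_ofReal

theorem setLIntegral_rpow_lt_top {r : ℝ} (hr : -1 < r) :
    ∫⁻ s in Ioc (0 : ℝ) 1, ENNReal.ofReal (s ^ r) < ⊤ := by
  have h := (intervalIntegral.intervalIntegrable_rpow' (a := 0) (b := 1) hr).1
  exact h.lintegral_lt_top

theorem inv_pow_le_rpow (hd : d ≤ 3) {s : ℝ} (hs : s ∈ Ioc (0 : ℝ) 1) :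
    (s ^ d)⁻¹ ≤ s ^ (-3 : ℝ) := by
  rw [Real.rpow_neg hs.1.le]
  have : s ^ 3 ≤ s ^ d := pow_le_pow_of_le_one hs.1.le hs.2 hd
  have h3 : 0 < s ^ 3 := pow_pos hs.1 3
  exact_mod_cast inv_anti₀ h3 this

/-- The operator `a ↦ ∫₀¹ ballInt ρ s a ds` maps `L²` to `L⁴` in dimension at most three. -/
theorem exists_lintegral_pow_four_le (hd : d ≤ 3) (ρ : ℝ) :
    ∃ C : ℝ≥0∞, C < ⊤ ∧ ∀ a : EuclideanSpace ℝ (Fin d) → ℝ≥0∞, Measurable a →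
      ∫⁻ x, (∫⁻ s in Ioc (0 : ℝ) 1, ballInt ρ s a x) ^ 4 ≤ C * (∫⁻ z, a z ^ 2) ^ 2 := by
  set b := volume (Metric.ball (0 : EuclideanSpace ℝ (Fin d)) ρ)
  have hb : b < ⊤ := measure_ball_lt_top
  refine ⟨(∫⁻ s in Ioc (0 : ℝ) 1, ENNReal.ofReal (s ^ (-(5 / 6) : ℝ))) ^ 3 *
    (b ^ 3 * ∫⁻ s in Ioc (0 : ℝ) 1, ENNReal.ofReal (s ^ (-(1 / 2) : ℝ))), ?_, fun a ha => ?_⟩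
  · exact ENNReal.mul_lt_top (ENNReal.pow_lt_top (setLIntegral_rpow_lt_top (by norm_num)))
      (ENNReal.mul_lt_top (ENNReal.pow_lt_top hb) (setLIntegral_rpow_lt_top (by norm_num)))
  set A := ∫⁻ s in Ioc (0 : ℝ) 1, ENNReal.ofReal (s ^ (-(5 / 6) : ℝ))
  have hbm := measurable_ballInt (ρ := ρ) ha
  -- Hölder's inequality with the weight `s ^ (5/8)`, which lies between `1/2` and `3/4`
  have h1 : ∀ x, (∫⁻ s in Ioc (0 : ℝ) 1, ballInt ρ s a x) ^ 4 ≤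
      (∫⁻ s in Ioc (0 : ℝ) 1, ENNReal.ofReal (s ^ (5 / 2 : ℝ)) * ballInt ρ s a x ^ 4) * A ^ 3 := by
    intro x
    have hx : Measurable fun s : ℝ => ballInt ρ s a x :=
      hbm.comp (by fun_prop : Measurable fun s : ℝ => (s, x))
    have h := lintegral_mul_rpow_le (volume.restrict (Ioc (0 : ℝ) 1)) (p := 4) (q := 4 / 3)
      (by norm_num [Real.holderConjugate_iff])
      (((measurable_ofReal_rpow (5 / 8)).mul hx).aemeasurable)
      (measurable_ofReal_rpow (-(5 / 8))).aemeasurable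
    have e1 : ∫⁻ s in Ioc (0 : ℝ) 1, ballInt ρ s a x = ∫⁻ s in Ioc (0 : ℝ) 1,
        ((fun s : ℝ => ENNReal.ofReal (s ^ (5 / 8 : ℝ))) * fun s => ballInt ρ s a x) s *
          ENNReal.ofReal (s ^ (-(5 / 8) : ℝ)) := by
      refine setLIntegral_congr_fun measurableSet_Ioc fun s hs => ?_
      simp only [Pi.mul_apply]
      rw [mul_right_comm, ← ENNReal.ofReal_mul (Real.rpow_nonneg hs.1.le _), ← Real.rpow_add hs.1]
      norm_num
    have e2 : ∫⁻ s in Ioc (0 : ℝ) 1, (((fun s : ℝ => ENNReal.ofReal (s ^ (5 / 8 : ℝ))) *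
        fun s => ballInt ρ s a x) s) ^ (4 : ℝ)
        = ∫⁻ s in Ioc (0 : ℝ) 1, ENNReal.ofReal (s ^ (5 / 2 : ℝ)) * ballInt ρ s a x ^ 4 := by
      refine setLIntegral_congr_fun measurableSet_Ioc fun s hs => ?_
      simp only [Pi.mul_apply]
      rw [ENNReal.mul_rpow_of_nonneg _ _ (by norm_num),
        ENNReal.ofReal_rpow_of_nonneg (Real.rpow_nonneg hs.1.le _) (by norm_num),
        ← Real.rpow_mul hs.1.le]
      norm_num
    have e3 : ∫⁻ s in Ioc (0 : ℝ) 1, ENNReal.ofReal (s ^ (-(5 / 8) : ℝ)) ^ (4 / 3 : ℝ) = A := by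
      refine setLIntegral_congr_fun measurableSet_Ioc fun s hs => ?_
      rw [ENNReal.ofReal_rpow_of_nonneg (Real.rpow_nonneg hs.1.le _) (by norm_num),
        ← Real.rpow_mul hs.1.le]
      norm_num
    rw [← e1, e2, e3] at h
    norm_num at h
    exact_mod_cast h
  have hm1 : Measurable fun q : ℝ × EuclideanSpace ℝ (Fin d) =>
      ENNReal.ofReal (q.1 ^ (5 / 2 : ℝ)) * ballInt ρ q.1 a q.2 ^ 4 :=
    ((measurable_fst.pow_const _).ennreal_ofReal).mul (hbm.pow_const 4)
  calc ∫⁻ x, (∫⁻ s in Ioc (0 : ℝ) 1, ballInt ρ s a x) ^ 4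
      ≤ ∫⁻ x, (∫⁻ s in Ioc (0 : ℝ) 1, ENNReal.ofReal (s ^ (5 / 2 : ℝ)) * ballInt ρ s a x ^ 4)
          * A ^ 3 := lintegral_mono h1
    _ = A ^ 3 * ∫⁻ s in Ioc (0 : ℝ) 1, ∫⁻ x,
          ENNReal.ofReal (s ^ (5 / 2 : ℝ)) * ballInt ρ s a x ^ 4 := by
        rw [lintegral_mul_const' _ _
          (ENNReal.pow_ne_top (setLIntegral_rpow_lt_top (by norm_num)).ne), mul_comm,
          lintegral_lintegral_swap]
        exact (hm1.comp measurable_swap).aemeasurable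
    _ ≤ A ^ 3 * ∫⁻ s in Ioc (0 : ℝ) 1, ENNReal.ofReal (s ^ (-(1 / 2) : ℝ)) *
          (b ^ 3 * (∫⁻ z, a z ^ 2) ^ 2) := by
        refine mul_le_mul_right (setLIntegral_mono' measurableSet_Ioc fun s hs => ?_) _
        rw [lintegral_const_mul' _ _ ENNReal.ofReal_ne_top]
        refine (mul_le_mul_right (lintegral_ballInt_pow_four_le ρ ha hs.1) _).trans ?_
        have : ENNReal.ofReal (s ^ (5 / 2 : ℝ)) * ENNReal.ofReal ((s ^ d)⁻¹) ≤
            ENNReal.ofReal (s ^ (-(1 / 2) : ℝ)) := by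
          rw [← ENNReal.ofReal_mul (Real.rpow_nonneg hs.1.le _)]
          refine ENNReal.ofReal_le_ofReal ?_
          calc s ^ (5 / 2 : ℝ) * (s ^ d)⁻¹ ≤ s ^ (5 / 2 : ℝ) * s ^ (-3 : ℝ) :=
                mul_le_mul_of_nonneg_left (inv_pow_le_rpow hd hs) (Real.rpow_nonneg hs.1.le _)
            _ = s ^ (-(1 / 2) : ℝ) := by rw [← Real.rpow_add hs.1]; norm_num
        calc _ = (ENNReal.ofReal (s ^ (5 / 2 : ℝ)) * ENNReal.ofReal ((s ^ d)⁻¹)) *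
              (b ^ 3 * (∫⁻ z, a z ^ 2) ^ 2) := by ring
          _ ≤ _ := mul_le_mul_left this _
    _ = _ := by
        rw [lintegral_mul_const _ (measurable_ofReal_rpow _)]
        ring

/-- The operator `a ↦ ∫₀¹ ballInt ρ s a ds` maps `L⁴` to `L^∞` in dimension at most three. -/
theorem exists_lintegral_ballInt_le (hd : d ≤ 3) (ρ : ℝ) :
    ∃ C : ℝ≥0∞, C < ⊤ ∧ ∀ a : EuclideanSpace ℝ (Fin d) → ℝ≥0∞, Measurable a → ∀ x,
      ∫⁻ s in Ioc (0 : ℝ) 1, ballInt ρ s a x ≤ C * (∫⁻ z, a z ^ 4) ^ (1 / 4 : ℝ) := by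
  set b := volume (Metric.ball (0 : EuclideanSpace ℝ (Fin d)) ρ)
  have hb : b < ⊤ := measure_ball_lt_top
  refine ⟨(∫⁻ s in Ioc (0 : ℝ) 1, ENNReal.ofReal (s ^ (-(3 / 4) : ℝ))) * (b ^ 3) ^ (1 / 4 : ℝ),
    ?_, fun a ha x => ?_⟩
  · exact ENNReal.mul_lt_top (setLIntegral_rpow_lt_top (by norm_num))
      (ENNReal.rpow_lt_top_of_nonneg (by norm_num) (ENNReal.pow_lt_top hb).ne)
  rw [mul_assoc, ← lintegral_mul_const _ (measurable_ofReal_rpow _)]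
  refine setLIntegral_mono' measurableSet_Ioc fun s hs => ?_
  have h := ballInt_pow_four_le ρ ha x hs.1
  have e : ∀ t : ℝ≥0∞, t = (t ^ 4) ^ (1 / 4 : ℝ) := fun t => by
    rw [← ENNReal.rpow_ofNat, ← ENNReal.rpow_mul]; norm_num
  rw [e (ballInt ρ s a x), ← ENNReal.mul_rpow_of_nonneg _ _ (by norm_num)]
  have e' : ENNReal.ofReal (s ^ (-(3 / 4) : ℝ)) = ENNReal.ofReal (s ^ (-3 : ℝ)) ^ (1 / 4 : ℝ) := by
    rw [ENNReal.ofReal_rpow_of_nonneg (Real.rpow_nonneg hs.1.le _) (by norm_num),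
      ← Real.rpow_mul hs.1.le]
    norm_num
  rw [e', ← ENNReal.mul_rpow_of_nonneg _ _ (by norm_num)]
  refine ENNReal.rpow_le_rpow (h.trans ?_) (by norm_num)
  calc b ^ 3 * (ENNReal.ofReal ((s ^ d)⁻¹) * ∫⁻ z, a z ^ 4)
      ≤ b ^ 3 * (ENNReal.ofReal (s ^ (-3 : ℝ)) * ∫⁻ z, a z ^ 4) := by
        gcongr
        exact inv_pow_le_rpow hd hs
    _ = _ := by ring

end

/-! ### The pointwise estimate on domains with the cone condition -/

section

variable {d : ℕ} {Ω : Set (EuclideanSpace ℝ (Fin d))} {F : Type} [NormedAddCommGroup F]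

/-- The size of `f`, extended by zero outside `Ω`. -/
def extNorm (f : L2 Ω F) (y : EuclideanSpace ℝ (Fin d)) : ℝ≥0∞ := Ω.indicator (fun y => ‖f y‖ₑ) y

/-- The size `∑ⱼ |gⱼ|` of a family of functions, extended by zero outside `Ω`. -/
def extSum (g : Fin d → L2 Ω F) (y : EuclideanSpace ℝ (Fin d)) : ℝ≥0∞ :=
  Ω.indicator (fun y => ∑ j, ‖g j y‖ₑ) y

theorem measurable_extNorm (hΩ : IsOpen Ω) (f : L2 Ω F) : Measurable (extNorm f) :=
  (Lp.stronglyMeasurable f).enorm.indicator hΩ.measurableSet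

theorem measurable_extSum (hΩ : IsOpen Ω) (g : Fin d → L2 Ω F) : Measurable (extSum g) :=
  (Finset.measurable_fun_sum _ fun j _ => (Lp.stronglyMeasurable (g j)).enorm).indicator
    hΩ.measurableSet

/-- The right-hand side of the pointwise estimate: the integral of `f` over a ball and that of its
gradient `g` over the family of shrinking balls. -/
def coneBound (ρ : ℝ) (f : L2 Ω F) (g : Fin d → L2 Ω F) (x : EuclideanSpace ℝ (Fin d)) : ℝ≥0∞ :=
  ballInt ρ 1 (extNorm f) x
    + ENNReal.ofReal ρ * ∫⁻ s in Ioc (0 : ℝ) 1, ballInt ρ s (extSum g) x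

theorem measurable_ballInt_fixed {ρ s : ℝ} {a : EuclideanSpace ℝ (Fin d) → ℝ≥0∞}
    (ha : Measurable a) : Measurable fun x => ballInt ρ s a x :=
  (measurable_ballInt ha).comp (by fun_prop : Measurable fun x => (s, x))

theorem measurable_lintegral_ballInt {ρ : ℝ} {a : EuclideanSpace ℝ (Fin d) → ℝ≥0∞}
    (ha : Measurable a) : Measurable fun x => ∫⁻ s in Ioc (0 : ℝ) 1, ballInt ρ s a x :=
  Measurable.lintegral_prod_left' (measurable_ballInt ha)

theorem measurable_coneBound (hΩ : IsOpen Ω) (ρ : ℝ) (f : L2 Ω F) (g : Fin d → L2 Ω F) :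
    Measurable (coneBound ρ f g) :=
  (measurable_ballInt_fixed (measurable_extNorm hΩ f)).add
    ((measurable_lintegral_ballInt (measurable_extSum hΩ g)).const_mul _)

/-- The pointwise bound is integrable, so that its mollifications converge to it almost
everywhere. -/
theorem lintegral_coneBound_lt_top (hΩ : IsOpen Ω) (hΩb : Bornology.IsBounded Ω) (ρ : ℝ)
    (f : L2 Ω F) (g : Fin d → L2 Ω F) : ∫⁻ x, coneBound ρ f g x < ⊤ := by
  have : IsFiniteMeasure (volume.restrict Ω) :=
    ⟨by rw [Measure.restrict_apply_univ]; exact hΩb.measure_lt_top⟩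
  have hb : volume (Metric.ball (0 : EuclideanSpace ℝ (Fin d)) ρ) < ⊤ := measure_ball_lt_top
  have h1 : ∀ f : L2 Ω F, ∫⁻ x in Ω, ‖f x‖ₑ < ⊤ := fun f =>
    ((Lp.memLp f).integrable (by norm_num)).2
  have hf := measurable_extNorm hΩ f
  have hg := measurable_extSum hΩ g
  unfold coneBound
  rw [lintegral_add_left (measurable_ballInt_fixed hf),
    lintegral_const_mul _ (measurable_lintegral_ballInt hg), lintegral_ballInt _ _ hf]
  have hsw : ∫⁻ x, ∫⁻ s in Ioc (0 : ℝ) 1, ballInt ρ s (extSum g) x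
      = ∫⁻ s in Ioc (0 : ℝ) 1, ∫⁻ x, ballInt ρ s (extSum g) x :=
    lintegral_lintegral_swap (f := fun x s => ballInt ρ s (extSum g) x)
      ((measurable_ballInt hg).comp measurable_swap).aemeasurable
  simp_rw [hsw, lintegral_ballInt _ _ hg]
  rw [lintegral_const, Measure.restrict_apply_univ]
  refine ENNReal.add_lt_top.2 ⟨ENNReal.mul_lt_top hb ?_, ENNReal.mul_lt_top ENNReal.ofReal_lt_top
    (ENNReal.mul_lt_top (ENNReal.mul_lt_top hb ?_) (by simp))⟩
  · unfold extNorm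
    rw [lintegral_indicator hΩ.measurableSet]
    exact h1 f
  · unfold extSum
    rw [lintegral_indicator hΩ.measurableSet,
      lintegral_finsetSum _ fun j _ => (Lp.stronglyMeasurable (g j)).enorm]
    exact ENNReal.sum_lt_top.2 fun j _ => h1 (g j)

end

section

variable {d : ℕ} {Ω : Set (EuclideanSpace ℝ (Fin d))}
  {F : Type} [NormedAddCommGroup F] [InnerProductSpace ℝ F]

/-- If a test function can be moved inside `Ω` along every segment from `0` to a point of the ball
`K = B(z₀, r) ⊆ B(0, ρ)`, then the estimates of `enorm_integral_test_le_translate` may be integrated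
over `K`, and `K` enlarged to `B(0, ρ)`. -/
theorem enorm_integral_test_le_coneBound [CompleteSpace F] (hΩ : IsOpen Ω)
    (hΩb : Bornology.IsBounded Ω) {f : L2 Ω F} {g : Fin d → L2 Ω F}
    (hg : ∀ j, HasWeakDeriv Ω (fun _ : Fin 1 => j) f (g j))
    {φ : EuclideanSpace ℝ (Fin d) → ℝ} (hφ : ContDiff ℝ ∞ φ) (hc : HasCompactSupport φ)
    (h0 : ∀ x, 0 ≤ φ x) {z₀ : EuclideanSpace ℝ (Fin d)} {r ρ : ℝ}
    (hK : Metric.closedBall z₀ r ⊆ Metric.ball 0 ρ)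
    (hs : ∀ z ∈ Metric.closedBall z₀ r, ∀ s ∈ Icc (0 : ℝ) 1, ∀ y ∈ tsupport φ, y + s • z ∈ Ω) :
    volume (Metric.closedBall (0 : EuclideanSpace ℝ (Fin d)) r) * ‖∫ x in Ω, φ x • f x‖ₑ ≤
      ∫⁻ x, ENNReal.ofReal (φ x) * coneBound ρ f g x := by
  set B := Metric.ball (0 : EuclideanSpace ℝ (Fin d)) ρ
  have hf' := measurable_extNorm hΩ f
  have hg' := measurable_extSum hΩ g
  have hφm : Measurable fun x => ENNReal.ofReal (φ x) :=
    hφ.continuous.measurable.ennreal_ofReal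
  have e1 : ∀ z, (∫⁻ x in Ω, ENNReal.ofReal (φ (x - z)) * ‖f x‖ₑ)
      = ∫⁻ x, ENNReal.ofReal (φ x) * extNorm f (x + z) := fun z => by
    rw [← lintegral_indicator hΩ.measurableSet,
      ← lintegral_add_right_eq_self _ z]
    refine lintegral_congr fun x => ?_
    simp only [extNorm, indicator]
    split_ifs <;> simp
  have e2 : ∀ z, (∫⁻ x in Ω, ENNReal.ofReal (φ (x - z)) * ∑ j, ‖g j x‖ₑ)
      = ∫⁻ x, ENNReal.ofReal (φ x) * extSum g (x + z) := fun z => by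
    rw [← lintegral_indicator hΩ.measurableSet,
      ← lintegral_add_right_eq_self _ z]
    refine lintegral_congr fun x => ?_
    simp only [extSum, indicator]
    split_ifs <;> simp
  have m1 : Measurable fun z : EuclideanSpace ℝ (Fin d) =>
      ∫⁻ x, ENNReal.ofReal (φ x) * extNorm f (x + z) :=
    Measurable.lintegral_prod_right' (f := fun q : EuclideanSpace ℝ (Fin d) ×
      EuclideanSpace ℝ (Fin d) => ENNReal.ofReal (φ q.2) * extNorm f (q.2 + q.1))
      ((hφm.comp measurable_snd).mul (hf'.comp (by fun_prop)))
  calc volume (Metric.closedBall (0 : EuclideanSpace ℝ (Fin d)) r) * ‖∫ x in Ω, φ x • f x‖ₑ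
      = ∫⁻ _ in Metric.closedBall z₀ r, ‖∫ x in Ω, φ x • f x‖ₑ := by
        rw [lintegral_const, Measure.restrict_apply_univ, mul_comm,
          Measure.addHaar_closedBall_center volume z₀ r]
    _ ≤ ∫⁻ z in Metric.closedBall z₀ r, ((∫⁻ x, ENNReal.ofReal (φ x) * extNorm f (x + z)) +
          ENNReal.ofReal ρ * ∫⁻ s in Ioc (0 : ℝ) 1, ∫⁻ x,
            ENNReal.ofReal (φ x) * extSum g (x + s • z)) := by
        refine setLIntegral_mono' measurableSet_closedBall fun z hz => ?_
        have := enorm_integral_test_le_translate hΩb hg hφ hc h0 z (hs z hz)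
        simp_rw [e1, e2] at this
        refine this.trans ?_
        gcongr
        rw [← ofReal_norm]
        exact ENNReal.ofReal_le_ofReal (mem_ball_zero_iff.1 (hK hz)).le
    _ ≤ ∫⁻ z in B, ((∫⁻ x, ENNReal.ofReal (φ x) * extNorm f (x + z)) +
          ENNReal.ofReal ρ * ∫⁻ s in Ioc (0 : ℝ) 1, ∫⁻ x,
            ENNReal.ofReal (φ x) * extSum g (x + s • z)) := lintegral_mono_set hK
    _ = ∫⁻ x, ENNReal.ofReal (φ x) * coneBound ρ f g x := by
        have m2 : Measurable fun q : (EuclideanSpace ℝ (Fin d) × ℝ) × EuclideanSpace ℝ (Fin d) =>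
            ENNReal.ofReal (φ q.2) * extSum g (q.2 + q.1.2 • q.1.1) :=
          (hφm.comp measurable_snd).mul (hg'.comp (by fun_prop))
        unfold coneBound
        simp_rw [mul_add]
        have m3 : Measurable fun x => ENNReal.ofReal (φ x) * ballInt ρ 1 (extNorm f) x :=
          hφm.mul (measurable_ballInt_fixed hf')
        rw [lintegral_add_left m1, lintegral_add_left m3]
        congr 1
        · rw [lintegral_lintegral_swap]
          · refine lintegral_congr fun x => ?_
            unfold ballInt
            rw [lintegral_const_mul' _ _ ENNReal.ofReal_ne_top]
            simp [B]
          · exact ((hφm.comp measurable_snd).mul (hf'.comp (by fun_prop))).aemeasurable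
        · rw [lintegral_const_mul' _ _ ENNReal.ofReal_ne_top]
          have e3 : ∀ x, ENNReal.ofReal (φ x) * (ENNReal.ofReal ρ *
              ∫⁻ s in Ioc (0 : ℝ) 1, ballInt ρ s (extSum g) x) = ENNReal.ofReal ρ *
              ∫⁻ s in Ioc (0 : ℝ) 1, ENNReal.ofReal (φ x) * ballInt ρ s (extSum g) x := by
            intro x
            rw [lintegral_const_mul' _ _ ENNReal.ofReal_ne_top]
            ring
          simp_rw [e3]
          rw [lintegral_const_mul' _ _ ENNReal.ofReal_ne_top]
          congr 1
          have hsw : ∫⁻ x, ∫⁻ s in Ioc (0 : ℝ) 1, ENNReal.ofReal (φ x) * ballInt ρ s (extSum g) x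
              = ∫⁻ s in Ioc (0 : ℝ) 1, ∫⁻ x, ENNReal.ofReal (φ x) * ballInt ρ s (extSum g) x :=
            lintegral_lintegral_swap
              (f := fun x s => ENNReal.ofReal (φ x) * ballInt ρ s (extSum g) x)
              ((hφm.comp measurable_fst).mul
                ((measurable_ballInt hg').comp measurable_swap)).aemeasurable
          rw [lintegral_lintegral_swap (Measurable.lintegral_prod_right' m2).aemeasurable, hsw]
          · refine lintegral_congr fun s => ?_
            rw [lintegral_lintegral_swap]
            · refine lintegral_congr fun x => ?_
              unfold ballInt
              rw [lintegral_const_mul' _ _ ENNReal.ofReal_ne_top]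
            · exact ((hφm.comp measurable_snd).mul (hg'.comp (by fun_prop))).aemeasurable

/-- The pointwise form of the Sobolev embeddings on a domain with the cone condition: `f(x)` is
bounded by integrals of `f` and of its weak gradient over the translates of a ball that shrinks to
`x`. A mollifier at `x` is moved along all segments that lead to a ball inside the cone with
vertex `x`; then its support shrinks to `x`. -/
theorem ConeCondition.exists_ae_le_coneBound [CompleteSpace F] (hΩ : IsOpen Ω)
    (hΩb : Bornology.IsBounded Ω) (hcone : ConeCondition Ω) :
    ∃ r ρ : ℝ, 0 < r ∧ ∀ (f : L2 Ω F) (g : Fin d → L2 Ω F),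
      (∀ j, HasWeakDeriv Ω (fun _ : Fin 1 => j) f (g j)) → ∀ᵐ x ∂(volume.restrict Ω),
        volume (Metric.closedBall (0 : EuclideanSpace ℝ (Fin d)) r) * ‖f x‖ₑ
          ≤ coneBound ρ f g x := by
  obtain ⟨ρ, hρ, a, ⟨ha0, ha1⟩, hcone⟩ := hcone
  have hr : 0 < (1 - a) * ρ / 4 := by have := sub_pos.2 ha1; positivity
  refine ⟨(1 - a) * ρ / 4, ρ, hr, fun f g hg => ?_⟩
  set r := (1 - a) * ρ / 4 with hrdef
  set κ := volume (Metric.closedBall (0 : EuclideanSpace ℝ (Fin d)) r)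
  have hκ : κ ≠ ⊤ := measure_closedBall_lt_top.ne
  have : IsFiniteMeasure (volume.restrict Ω) :=
    ⟨by rw [Measure.restrict_apply_univ]; exact hΩb.measure_lt_top⟩
  have hMm := measurable_coneBound hΩ ρ f g
  have hMi := lintegral_coneBound_lt_top hΩ hΩb ρ f g
  have hMr : Integrable fun x => (coneBound ρ f g x).toReal :=
    integrable_toReal_of_lintegral_ne_top hMm.aemeasurable hMi.ne
  have hMfin : ∀ᵐ x, coneBound ρ f g x < ⊤ := ae_lt_top hMm hMi.ne
  have hfi : Integrable (Ω.indicator f) := by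
    rw [integrable_indicator_iff hΩ.measurableSet]
    exact (Lp.memLp f).integrable (by norm_num)
  let φ : ℕ → ContDiffBump (0 : EuclideanSpace ℝ (Fin d)) := fun n =>
    ⟨1 / (n + 1 : ℝ), 2 * (1 / (n + 1 : ℝ)), by positivity,
      by have : (0 : ℝ) < 1 / (n + 1 : ℝ) := by positivity
         linarith⟩
  have hφ0 : Filter.Tendsto (fun n => (φ n).rOut) Filter.atTop (nhds 0) := by
    simpa [φ] using (tendsto_one_div_add_atTop_nhds_zero_nat (𝕜 := ℝ)).const_mul 2
  have hφK : ∀ᶠ n in Filter.atTop, (φ n).rOut ≤ 2 * (φ n).rIn :=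
    Filter.Eventually.of_forall fun n => le_rfl
  rw [ae_restrict_iff' hΩ.measurableSet]
  filter_upwards [hMfin, ContDiffBump.ae_convolution_tendsto_right_of_locallyIntegrable
      (μ := volume) hφ0 hφK hfi.locallyIntegrable,
    ContDiffBump.ae_convolution_tendsto_right_of_locallyIntegrable
      (μ := volume) hφ0 hφK hMr.locallyIntegrable] with x hx1 hx2 hx3 hxΩ
  -- the ball `B((ρ/2)ξ, r)` with `r = (1 - a)ρ/4` lies in the cone with axis `ξ`
  obtain ⟨ξ, hξ, hcx⟩ := hcone x hxΩ
  set K := Metric.closedBall ((ρ / 2) • ξ) r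
  have hKz : ∀ z ∈ K, ‖z‖ < ρ ∧ a * ‖z‖ ≤ ⟪z, ξ⟫ := by
    intro z hz
    have hz' : ‖z - (ρ / 2) • ξ‖ ≤ r := mem_closedBall_iff_norm.1 hz
    have hn : ‖(ρ / 2) • ξ‖ = ρ / 2 := by
      rw [norm_smul, hξ, mul_one, Real.norm_of_nonneg (by positivity)]
    have h1 : ‖z‖ ≤ r + ρ / 2 := by
      have := norm_add_le (z - (ρ / 2) • ξ) ((ρ / 2) • ξ)
      rw [sub_add_cancel, hn] at this
      linarith
    have h2 : ρ / 2 - r ≤ ⟪z, ξ⟫ := by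
      have e : ⟪z, ξ⟫ = ⟪z - (ρ / 2) • ξ, ξ⟫ + ρ / 2 := by
        rw [inner_sub_left, real_inner_smul_left, real_inner_self_eq_norm_sq, hξ]; ring
      have := abs_real_inner_le_norm (z - (ρ / 2) • ξ) ξ
      rw [hξ, mul_one] at this
      have := (abs_le.1 this).1
      linarith
    have haρ := mul_pos ha0 hρ
    refine ⟨by nlinarith, ?_⟩
    have : a * ‖z‖ ≤ a * (r + ρ / 2) := by gcongr
    nlinarith
  -- the segments from `x` to that ball form a compact subset of `Ω`, so that mollifiers with small
  -- support around `x` stay in `Ω` when they are moved along the segments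
  let T : Set (EuclideanSpace ℝ (Fin d)) :=
    (fun q : ℝ × EuclideanSpace ℝ (Fin d) => x + q.1 • q.2) '' (Icc (0 : ℝ) 1 ×ˢ K)
  have hT : IsCompact T :=
    (isCompact_Icc.prod (isCompact_closedBall _ _)).image (by fun_prop)
  have hTΩ : T ⊆ Ω := by
    rintro _ ⟨⟨s, z⟩, ⟨hs, hz⟩, rfl⟩
    obtain ⟨hz1, hz2⟩ := hKz z hz
    have hsn : ‖s • z‖ = s * ‖z‖ := by rw [norm_smul, Real.norm_of_nonneg hs.1]
    refine hcx _ ?_ ?_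
    · simp only [add_sub_cancel_left]
      rw [hsn]
      nlinarith [norm_nonneg z, hs.1, hs.2]
    · simp only [add_sub_cancel_left]
      rw [hsn, real_inner_smul_left]
      nlinarith [hs.1]
  obtain ⟨δ, hδ, hδΩ⟩ := hT.exists_cthickening_subset_open hΩ hTΩ
  have hle : ∀ᶠ n in Filter.atTop,
      κ * ‖convolution ((φ n).normed volume) (Ω.indicator f)
          (ContinuousLinearMap.lsmul ℝ ℝ) volume x‖ₑ ≤
        ENNReal.ofReal (convolution ((φ n).normed volume) (fun x => (coneBound ρ f g x).toReal)
          (ContinuousLinearMap.lsmul ℝ ℝ) volume x) := by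
    filter_upwards [hφ0.eventually (gt_mem_nhds hδ)] with n hn
    set χ : EuclideanSpace ℝ (Fin d) → ℝ := fun y => (φ n).normed volume (x - y)
    have hχ0 : ∀ y, 0 ≤ χ y := fun y => (φ n).nonneg_normed _
    have hχs : ContDiff ℝ ∞ χ := (φ n).contDiff_normed.comp (contDiff_const.sub contDiff_id)
    have hχc : HasCompactSupport χ :=
      (φ n).hasCompactSupport_normed.comp_homeomorph (Homeomorph.subLeft x)
    have hχt : ∀ y ∈ tsupport χ, dist y x ≤ δ := by
      intro y hy
      have h1 : x - y ∈ tsupport ((φ n).normed volume) :=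
        tsupport_comp_subset_preimage _ (f := fun y => x - y) (by fun_prop) hy
      rw [(φ n).tsupport_normed_eq, mem_closedBall_zero_iff] at h1
      rw [dist_comm, dist_eq_norm]
      exact h1.trans hn.le
    have key := enorm_integral_test_le_coneBound hΩ hΩb hg hχs hχc hχ0 (z₀ := (ρ / 2) • ξ)
      (r := r) (ρ := ρ) (fun z hz => mem_ball_zero_iff.2 (hKz z hz).1)
      (fun z hz s hs y hy => hδΩ (Metric.mem_cthickening_of_dist_le _ (x + s • z) _ _
        ⟨(s, z), ⟨hs, hz⟩, rfl⟩ (by rw [dist_add_right]; exact hχt y hy)))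
    simp only [convolution_eq_swap, ContinuousLinearMap.lsmul_apply]
    refine le_trans (le_of_eq ?_) (key.trans (le_of_eq ?_))
    · rw [← integral_indicator hΩ.measurableSet]
      congr 2
      refine integral_congr_ae (Filter.Eventually.of_forall fun y => ?_)
      simp only [indicator]
      split_ifs <;> simp [χ]
    · have hint : Integrable fun y => χ y • (coneBound ρ f g y).toReal := by
        have := hMr.locallyIntegrable.integrable_smul_left_of_hasCompactSupport hχs.continuous hχc
        exact this
      have : ∫⁻ y, ENNReal.ofReal (χ y) * coneBound ρ f g y
          = ∫⁻ y, ENNReal.ofReal (χ y • (coneBound ρ f g y).toReal) := by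
        refine lintegral_congr_ae ?_
        filter_upwards [hMfin] with y hy
        rw [smul_eq_mul, ENNReal.ofReal_mul (hχ0 y), ENNReal.ofReal_toReal hy.ne]
      rw [this, ofReal_integral_eq_lintegral_ofReal hint
        (Filter.Eventually.of_forall fun y => smul_nonneg (hχ0 y) ENNReal.toReal_nonneg)]
  have hlim1 := ENNReal.Tendsto.const_mul (a := κ) hx2.enorm (Or.inr hκ)
  have hlim2 := ENNReal.tendsto_ofReal hx3
  have := le_of_tendsto_of_tendsto hlim1 hlim2 hle
  rwa [ENNReal.ofReal_toReal hx1.ne, indicator_of_mem hxΩ] at this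

end

/-! ### Sobolev embeddings on domains with the cone condition -/

section

theorem eLpNorm_natCast_pow {α G : Type*} [MeasurableSpace α] {μ : Measure α}
    [NormedAddCommGroup G] (f : α → G) {n : ℕ} (hn : n ≠ 0) :
    eLpNorm f n μ ^ n = ∫⁻ x, ‖f x‖ₑ ^ n ∂μ := by
  rw [eLpNorm_eq_lintegral_rpow_enorm_toReal (by exact_mod_cast hn) (by simp)]
  rw [← ENNReal.rpow_natCast, ← ENNReal.rpow_mul]
  have : (n : ℝ) ≠ 0 := by exact_mod_cast hn
  simp [this]

theorem rpow_quarter_pow_four (t : ℝ≥0∞) : (t ^ 4) ^ (1 / 4 : ℝ) = t := by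
  rw [← ENNReal.rpow_ofNat, ← ENNReal.rpow_mul]; norm_num

variable {d : ℕ} {Ω : Set (EuclideanSpace ℝ (Fin d))}
  {F : Type} [NormedAddCommGroup F]

theorem lintegral_extNorm_pow (hΩ : IsOpen Ω) (f : L2 Ω F) {n : ℕ} (hn : n ≠ 0) :
    ∫⁻ y, extNorm f y ^ n = eLpNorm f n (volume.restrict Ω) ^ n := by
  rw [eLpNorm_natCast_pow _ hn, ← lintegral_indicator hΩ.measurableSet]
  refine lintegral_congr fun y => ?_
  simp only [extNorm, indicator]
  split_ifs <;> simp [hn]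

theorem lintegral_extSum_pow_le (hΩ : IsOpen Ω) (g : Fin d → L2 Ω F) {n : ℕ} (hn : n ≠ 0)
    {N : ℝ≥0∞} (hg : ∀ j, eLpNorm (g j) n (volume.restrict Ω) ≤ N) :
    ∫⁻ y, extSum g y ^ n ≤ (d : ℝ≥0∞) ^ (n - 1) * (d * N ^ n) := by
  have hm : ∀ j, Measurable fun y => ‖g j y‖ₑ ^ n := fun j =>
    (Lp.stronglyMeasurable (g j)).enorm.pow_const n
  calc ∫⁻ y, extSum g y ^ n = ∫⁻ y in Ω, (∑ j, ‖g j y‖ₑ) ^ n := by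
        rw [← lintegral_indicator hΩ.measurableSet]
        refine lintegral_congr fun y => ?_
        simp only [extSum, indicator]
        split_ifs <;> simp [hn]
    _ ≤ ∫⁻ y in Ω, (d : ℝ≥0∞) ^ (n - 1) * ∑ j, ‖g j y‖ₑ ^ n := by
        refine lintegral_mono fun y => ?_
        have := ENNReal.rpow_sum_le_const_mul_sum_rpow Finset.univ (fun j => ‖g j y‖ₑ)
          (p := n) (by exact_mod_cast Nat.one_le_iff_ne_zero.2 hn)
        have e : ((n : ℝ) - 1) = ((n - 1 : ℕ) : ℝ) := by
          rw [Nat.cast_sub (Nat.one_le_iff_ne_zero.2 hn)]; simp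
        rw [e] at this
        simpa only [ENNReal.rpow_natCast, Finset.card_univ, Fintype.card_fin] using this
    _ = (d : ℝ≥0∞) ^ (n - 1) * ∑ j, eLpNorm (g j) n (volume.restrict Ω) ^ n := by
        rw [lintegral_const_mul _ (Finset.measurable_fun_sum _ fun j _ => hm j),
          lintegral_finsetSum _ fun j _ => hm j]
        simp_rw [eLpNorm_natCast_pow _ hn]
    _ ≤ (d : ℝ≥0∞) ^ (n - 1) * ∑ _j : Fin d, N ^ n := by
        gcongr with j
        exact hg j
    _ = _ := by simp

end

section

variable {d : ℕ} {Ω : Set (EuclideanSpace ℝ (Fin d))}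
  {F : Type} [NormedAddCommGroup F] [InnerProductSpace ℝ F]

/-- Functions in `L²` with weak gradient in `L²` are in `L⁴`. -/
theorem ConeCondition.exists_eLpNorm_four_le [CompleteSpace F] (hd : d ≤ 3) (hΩ : IsOpen Ω)
    (hΩb : Bornology.IsBounded Ω) (hcone : ConeCondition Ω) :
    ∃ C : ℝ≥0∞, C < ⊤ ∧ ∀ (f : L2 Ω F) (g : Fin d → L2 Ω F) (N : ℝ≥0∞),
      (∀ j, HasWeakDeriv Ω (fun _ : Fin 1 => j) f (g j)) →
      eLpNorm f 2 (volume.restrict Ω) ≤ N → (∀ j, eLpNorm (g j) 2 (volume.restrict Ω) ≤ N) →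
      eLpNorm f 4 (volume.restrict Ω) ≤ C * N := by
  obtain ⟨r, ρ, hr, hpt⟩ := ConeCondition.exists_ae_le_coneBound (F := F) hΩ hΩb hcone
  obtain ⟨C₀, hC₀, hL⟩ := exists_lintegral_pow_four_le hd ρ
  set κ := volume (Metric.closedBall (0 : EuclideanSpace ℝ (Fin d)) r)
  have hκ : κ ≠ ⊤ := measure_closedBall_lt_top.ne
  have hκ0 : κ ≠ 0 := (Metric.measure_closedBall_pos volume _ hr).ne'
  set b := volume (Metric.ball (0 : EuclideanSpace ℝ (Fin d)) ρ)
  have hb : b < ⊤ := measure_ball_lt_top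
  set D : ℝ≥0∞ := 2 ^ 3 * (b ^ 3 + ENNReal.ofReal ρ ^ 4 * (C₀ * ((d : ℝ≥0∞) * d) ^ 2))
  have hD : D < ⊤ := by
    refine ENNReal.mul_lt_top (by norm_num) (ENNReal.add_lt_top.2 ⟨ENNReal.pow_lt_top hb, ?_⟩)
    exact ENNReal.mul_lt_top (ENNReal.pow_lt_top ENNReal.ofReal_lt_top) (ENNReal.mul_lt_top hC₀
      (ENNReal.pow_lt_top (ENNReal.mul_lt_top (by simp) (by simp))))
  refine ⟨D ^ (1 / 4 : ℝ) / κ, ENNReal.div_lt_top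
    (ENNReal.rpow_lt_top_of_nonneg (by norm_num) hD.ne).ne hκ0, fun f g N hg hf hgN => ?_⟩
  have hf' := measurable_extNorm hΩ f
  have hg' := measurable_extSum hΩ g
  have key : (κ * eLpNorm f 4 (volume.restrict Ω)) ^ 4 ≤ D * N ^ 4 := by
    have h4 : eLpNorm f 4 (volume.restrict Ω) ^ 4 = ∫⁻ x in Ω, ‖f x‖ₑ ^ 4 := by
      exact_mod_cast eLpNorm_natCast_pow (μ := volume.restrict Ω) f (n := 4) (by norm_num)
    calc (κ * eLpNorm f 4 (volume.restrict Ω)) ^ 4 = ∫⁻ x in Ω, (κ * ‖f x‖ₑ) ^ 4 := by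
          simp_rw [mul_pow]
          rw [lintegral_const_mul _ ((Lp.stronglyMeasurable f).enorm.pow_const 4), h4]
      _ ≤ ∫⁻ x in Ω, coneBound ρ f g x ^ 4 :=
          lintegral_mono_ae ((hpt f g hg).mono fun x hx => pow_le_pow_left₀ zero_le hx 4)
      _ ≤ ∫⁻ x, coneBound ρ f g x ^ 4 := setLIntegral_le_lintegral _ _
      _ ≤ ∫⁻ x, 2 ^ 3 * (ballInt ρ 1 (extNorm f) x ^ 4 + ENNReal.ofReal ρ ^ 4 *
            (∫⁻ s in Ioc (0 : ℝ) 1, ballInt ρ s (extSum g) x) ^ 4) := by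
          refine lintegral_mono fun x => ?_
          have := ENNReal.rpow_add_le_mul_rpow_add_rpow (ballInt ρ 1 (extNorm f) x)
            (ENNReal.ofReal ρ * ∫⁻ s in Ioc (0 : ℝ) 1, ballInt ρ s (extSum g) x)
            (p := 4) (by norm_num)
          norm_num [mul_pow] at this
          norm_num [coneBound]
          exact this
      _ = 2 ^ 3 * ((∫⁻ x, ballInt ρ 1 (extNorm f) x ^ 4) + ENNReal.ofReal ρ ^ 4 *
            ∫⁻ x, (∫⁻ s in Ioc (0 : ℝ) 1, ballInt ρ s (extSum g) x) ^ 4) := by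
          have m1 : Measurable fun x => ballInt ρ 1 (extNorm f) x ^ 4 :=
            (measurable_ballInt_fixed hf').pow_const 4
          have m2 : Measurable fun x =>
              (∫⁻ s in Ioc (0 : ℝ) 1, ballInt ρ s (extSum g) x) ^ 4 :=
            (measurable_lintegral_ballInt hg').pow_const 4
          rw [lintegral_const_mul' _ _ (by norm_num), lintegral_add_left m1,
            lintegral_const_mul _ m2]
      _ ≤ 2 ^ 3 * (b ^ 3 * (N ^ 2) ^ 2 + ENNReal.ofReal ρ ^ 4 *
            (C₀ * (d * (d * N ^ 2)) ^ 2)) := by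
          have e2 : ∫⁻ z, extNorm f z ^ 2 ≤ N ^ 2 := by
            rw [lintegral_extNorm_pow hΩ f two_ne_zero]
            exact pow_le_pow_left₀ zero_le hf 2
          have e3 : ∫⁻ z, extSum g z ^ 2 ≤ d * (d * N ^ 2) := by
            simpa using lintegral_extSum_pow_le hΩ g two_ne_zero hgN
          have e1 := lintegral_ballInt_pow_four_le ρ hf' one_pos
          simp only [one_pow, inv_one, ENNReal.ofReal_one, one_mul] at e1
          gcongr
          · exact e1.trans (by gcongr)
          · exact (hL _ hg').trans (by gcongr)
      _ = D * N ^ 4 := by simp only [D]; ring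
  have := ENNReal.rpow_le_rpow key (by norm_num : (0 : ℝ) ≤ 1 / 4)
  rw [rpow_quarter_pow_four, ENNReal.mul_rpow_of_nonneg _ _ (by norm_num),
    rpow_quarter_pow_four] at this
  rw [ENNReal.div_eq_inv_mul, mul_assoc, ← ENNReal.div_eq_inv_mul,
    ENNReal.le_div_iff_mul_le (Or.inl hκ0) (Or.inl hκ), mul_comm]
  exact this

/-- Functions in `L⁴` with weak gradient in `L⁴` are bounded, as `4 > 3 ≥ d`. -/
theorem ConeCondition.exists_eLpNorm_top_le [CompleteSpace F] (hd : d ≤ 3) (hΩ : IsOpen Ω)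
    (hΩb : Bornology.IsBounded Ω) (hcone : ConeCondition Ω) :
    ∃ C : ℝ≥0∞, C < ⊤ ∧ ∀ (f : L2 Ω F) (g : Fin d → L2 Ω F) (N : ℝ≥0∞),
      (∀ j, HasWeakDeriv Ω (fun _ : Fin 1 => j) f (g j)) →
      eLpNorm f 4 (volume.restrict Ω) ≤ N → (∀ j, eLpNorm (g j) 4 (volume.restrict Ω) ≤ N) →
      eLpNorm f ⊤ (volume.restrict Ω) ≤ C * N := by
  obtain ⟨r, ρ, hr, hpt⟩ := ConeCondition.exists_ae_le_coneBound (F := F) hΩ hΩb hcone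
  obtain ⟨C₀, hC₀, hL⟩ := exists_lintegral_ballInt_le hd ρ
  set κ := volume (Metric.closedBall (0 : EuclideanSpace ℝ (Fin d)) r)
  have hκ : κ ≠ ⊤ := measure_closedBall_lt_top.ne
  have hκ0 : κ ≠ 0 := (Metric.measure_closedBall_pos volume _ hr).ne'
  set b := volume (Metric.ball (0 : EuclideanSpace ℝ (Fin d)) ρ)
  have hb : b < ⊤ := measure_ball_lt_top
  set D : ℝ≥0∞ := (b ^ 3) ^ (1 / 4 : ℝ) +
    ENNReal.ofReal ρ * (C₀ * ((d : ℝ≥0∞) ^ 3 * d) ^ (1 / 4 : ℝ))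
  have hD : D < ⊤ := by
    refine ENNReal.add_lt_top.2
      ⟨ENNReal.rpow_lt_top_of_nonneg (by norm_num) (ENNReal.pow_lt_top hb).ne, ?_⟩
    exact ENNReal.mul_lt_top ENNReal.ofReal_lt_top (ENNReal.mul_lt_top hC₀
      (ENNReal.rpow_lt_top_of_nonneg (by norm_num)
        (ENNReal.mul_lt_top (ENNReal.pow_lt_top (by simp)) (by simp)).ne))
  refine ⟨D / κ, ENNReal.div_lt_top hD.ne hκ0, fun f g N hg hf hgN => ?_⟩
  have hf' := measurable_extNorm hΩ f
  have hg' := measurable_extSum hΩ g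
  rw [eLpNorm_exponent_top]
  refine eLpNormEssSup_le_of_ae_enorm_bound ((hpt f g hg).mono fun x hx => ?_)
  rw [ENNReal.div_eq_inv_mul, mul_assoc, ← ENNReal.div_eq_inv_mul,
    ENNReal.le_div_iff_mul_le (Or.inl hκ0) (Or.inl hκ), mul_comm]
  refine hx.trans ?_
  have e1 : ballInt ρ 1 (extNorm f) x ≤ (b ^ 3) ^ (1 / 4 : ℝ) * N := by
    have h := ballInt_pow_four_le ρ hf' x one_pos
    simp only [one_pow, inv_one, ENNReal.ofReal_one, one_mul] at h
    have h4 : ∫⁻ z, extNorm f z ^ 4 ≤ N ^ 4 := by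
      rw [lintegral_extNorm_pow hΩ f (by norm_num : 4 ≠ 0)]
      exact pow_le_pow_left₀ zero_le (by exact_mod_cast hf) 4
    have h' := ENNReal.rpow_le_rpow (h.trans (by gcongr : _ ≤ b ^ 3 * N ^ 4))
      (by norm_num : (0 : ℝ) ≤ 1 / 4)
    rwa [rpow_quarter_pow_four, ENNReal.mul_rpow_of_nonneg _ _ (by norm_num),
      rpow_quarter_pow_four] at h'
  have e2 : (∫⁻ z, extSum g z ^ 4) ^ (1 / 4 : ℝ) ≤ ((d : ℝ≥0∞) ^ 3 * d) ^ (1 / 4 : ℝ) * N := by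
    have h := lintegral_extSum_pow_le hΩ g (n := 4) (by norm_num)
      (fun j => by exact_mod_cast hgN j)
    have h' := ENNReal.rpow_le_rpow h (by norm_num : (0 : ℝ) ≤ 1 / 4)
    rw [← mul_assoc, ENNReal.mul_rpow_of_nonneg _ _ (by norm_num), rpow_quarter_pow_four] at h'
    exact h'
  calc coneBound ρ f g x ≤ (b ^ 3) ^ (1 / 4 : ℝ) * N +
        ENNReal.ofReal ρ * (C₀ * (((d : ℝ≥0∞) ^ 3 * d) ^ (1 / 4 : ℝ) * N)) := by
        unfold coneBound
        gcongr
        exact (hL _ hg' x).trans (by gcongr)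
    _ = D * N := by simp only [D]; ring

/-- **Sobolev embedding** `H¹(Ω) ⊆ L⁴(Ω)` for a bounded domain with the cone condition in dimension
at most three. -/
theorem ConeCondition.exists_sobolev_one [CompleteSpace F] (hd : d ≤ 3) (hΩ : IsOpen Ω)
    (hΩb : Bornology.IsBounded Ω) (hcone : ConeCondition Ω) :
    ∃ C : ℝ, 0 ≤ C ∧ ∀ w : Hs Ω F 1,
      eLpNorm (Hs.toL2 w) 4 (volume.restrict Ω) ≤ ENNReal.ofReal (C * ‖w‖) := by
  obtain ⟨C, hC, h⟩ := ConeCondition.exists_eLpNorm_four_le (F := F) hd hΩ hΩb hcone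
  refine ⟨C.toReal, ENNReal.toReal_nonneg, fun w => ?_⟩
  rw [ENNReal.ofReal_mul ENNReal.toReal_nonneg, ENNReal.ofReal_toReal hC.ne, ofReal_norm]
  have hn : ∀ i, eLpNorm (w.1 i) 2 (volume.restrict Ω) ≤ ‖w‖ₑ := fun i => by
    rw [← Lp.enorm_def]
    exact enorm_le_iff_norm_le.2 (Hs.norm_apply_le w i)
  exact h (Hs.toL2 w) (fun j => w.1 ⟨⟨1, by norm_num⟩, fun _ => j⟩) _
    (fun j => w.2 ⟨⟨1, by norm_num⟩, fun _ => j⟩) (hn _) (fun j => hn _)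

/-- **Sobolev embedding** `H²(Ω) ⊆ W^{1,4}(Ω) ∩ L^∞(Ω)` for a bounded domain with the cone condition
in dimension at most three. -/
theorem ConeCondition.exists_sobolev_two [CompleteSpace F] (hd : d ≤ 3) (hΩ : IsOpen Ω)
    (hΩb : Bornology.IsBounded Ω) (hcone : ConeCondition Ω) :
    ∃ C : ℝ, 0 ≤ C ∧ ∀ U : Hs Ω F 2,
      (∀ i, eLpNorm (U.1 ⟨⟨1, by norm_num⟩, fun _ => i⟩) 4 (volume.restrict Ω)
        ≤ ENNReal.ofReal (C * ‖U‖)) ∧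
      eLpNorm (Hs.toL2 U) ⊤ (volume.restrict Ω) ≤ ENNReal.ofReal (C * ‖U‖) := by
  obtain ⟨C, hC, h⟩ := ConeCondition.exists_eLpNorm_four_le (F := F) hd hΩ hΩb hcone
  obtain ⟨C', hC', h'⟩ := ConeCondition.exists_eLpNorm_top_le (F := F) hd hΩ hΩb hcone
  have hCC : C + C' * C < ⊤ := ENNReal.add_lt_top.2 ⟨hC, ENNReal.mul_lt_top hC' hC⟩
  refine ⟨(C + C' * C).toReal, ENNReal.toReal_nonneg, fun U => ?_⟩
  rw [ENNReal.ofReal_mul ENNReal.toReal_nonneg, ENNReal.ofReal_toReal hCC.ne, ofReal_norm]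
  have hn : ∀ i, eLpNorm (U.1 i) 2 (volume.restrict Ω) ≤ ‖U‖ₑ := fun i => by
    rw [← Lp.enorm_def]
    exact enorm_le_iff_norm_le.2 (Hs.norm_apply_le U i)
  have h0 : eLpNorm (Hs.toL2 U) 4 (volume.restrict Ω) ≤ C * ‖U‖ₑ :=
    h (Hs.toL2 U) (fun j => U.1 ⟨⟨1, by norm_num⟩, fun _ => j⟩) _
      (fun j => U.2 ⟨⟨1, by norm_num⟩, fun _ => j⟩) (hn _) (fun j => hn _)
  have h1 : ∀ i, eLpNorm (U.1 ⟨⟨1, by norm_num⟩, fun _ => i⟩) 4 (volume.restrict Ω)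
      ≤ C * ‖U‖ₑ := fun i =>
    h _ (fun j => U.1 ⟨⟨2, by norm_num⟩, ![i, j]⟩) _ (fun j => Hs.hasWeakDeriv_deriv U i j)
      (hn _) (fun j => hn _)
  refine ⟨fun i => (h1 i).trans ?_, ?_⟩
  · gcongr
    exact le_self_add
  · refine (h' (Hs.toL2 U) (fun j => U.1 ⟨⟨1, by norm_num⟩, fun _ => j⟩) _
      (fun j => U.2 ⟨⟨1, by norm_num⟩, fun _ => j⟩) h0 h1).trans ?_
    rw [← mul_assoc]
    gcongr
    exact le_add_self

end

/-! ### The velocity space -/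

section

variable {d : ℕ} {Ω : Set (EuclideanSpace ℝ (Fin d))}

/-- `φ` is a smooth vector field with compact support in `Ω`. -/
def IsTestField (Ω : Set (EuclideanSpace ℝ (Fin d)))
    (φ : EuclideanSpace ℝ (Fin d) → EuclideanSpace ℝ (Fin d)) : Prop :=
  ContDiff ℝ ∞ φ ∧ HasCompactSupport φ ∧ tsupport φ ⊆ Ω

/-- The span that defines `H¹₀` consists of test fields already. -/
theorem IsTestField.exists_of_mem_span {w : Hs Ω (EuclideanSpace ℝ (Fin d)) 1}
    (hw : w ∈ Submodule.span ℝ {w : Hs Ω (EuclideanSpace ℝ (Fin d)) 1 |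
      ∃ φ : EuclideanSpace ℝ (Fin d) → EuclideanSpace ℝ (Fin d), ContDiff ℝ ∞ φ ∧
        HasCompactSupport φ ∧ tsupport φ ⊆ Ω ∧ Hs.toL2 w =ᵐ[volume.restrict Ω] φ}) :
    ∃ φ, IsTestField Ω φ ∧ Hs.toL2 w =ᵐ[volume.restrict Ω] φ := by
  induction hw using Submodule.span_induction with
  | mem w hw =>
    obtain ⟨φ, h1, h2, h3, h4⟩ := hw
    exact ⟨φ, ⟨h1, h2, h3⟩, h4⟩
  | zero =>
    refine ⟨fun _ => 0, ⟨contDiff_const, HasCompactSupport.zero, ?_⟩, ?_⟩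
    · simp [tsupport, Function.support]
    · rw [map_zero]
      exact Lp.coeFn_zero _ _ _
  | add v w _ _ hv hw =>
    obtain ⟨φ, h, hφ⟩ := hv
    obtain ⟨ψ, k, hψ⟩ := hw
    refine ⟨fun x => φ x + ψ x, ⟨h.1.add k.1, h.2.1.add k.2.1, ?_⟩, ?_⟩
    · exact (tsupport_add φ ψ).trans (union_subset h.2.2 k.2.2)
    · rw [map_add]
      filter_upwards [Lp.coeFn_add (Hs.toL2 v) (Hs.toL2 w), hφ, hψ] with x h1 h2 h3
      rw [h1, Pi.add_apply, h2, h3]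
  | smul c v _ hv =>
    obtain ⟨φ, h, hφ⟩ := hv
    refine ⟨fun x => c • φ x, ⟨h.1.const_smul c, h.2.1.smul_left (f := fun _ => c), ?_⟩, ?_⟩
    · exact (tsupport_smul_subset_right (fun _ => c) φ).trans h.2.2
    · rw [map_smul]
      filter_upwards [Lp.coeFn_smul c (Hs.toL2 v), hφ] with x h1 h2
      rw [h1, Pi.smul_apply, h2]

/-- A closed property of elements of `X` holds for all of them as soon as it holds for test
fields. -/
theorem X.induction {P : X Ω → Prop} (hP : IsClosed {v | P v})
    (h : ∀ (v : X Ω) (φ : EuclideanSpace ℝ (Fin d) → EuclideanSpace ℝ (Fin d)),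
      IsTestField Ω φ → fld v =ᵐ[volume.restrict Ω] φ → P v) (v : X Ω) : P v := by
  set S : Submodule ℝ (Hs Ω (EuclideanSpace ℝ (Fin d)) 1) :=
    Submodule.span ℝ {w : Hs Ω (EuclideanSpace ℝ (Fin d)) 1 |
      ∃ φ : EuclideanSpace ℝ (Fin d) → EuclideanSpace ℝ (Fin d), ContDiff ℝ ∞ φ ∧
        HasCompactSupport φ ∧ tsupport φ ⊆ Ω ∧ Hs.toL2 w =ᵐ[volume.restrict Ω] φ} with hS
  have hcl : v ∈ closure {u : X Ω | u.1 ∈ S} := by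
    rw [closure_subtype]
    have : v.1 ∈ closure (S : Set (Hs Ω (EuclideanSpace ℝ (Fin d)) 1)) := v.2
    refine closure_mono ?_ this
    intro w hw
    exact ⟨⟨w, S.le_topologicalClosure hw⟩, hw, rfl⟩
  refine closure_minimal (t := {v | P v}) ?_ hP hcl
  intro u hu
  obtain ⟨φ, h1, h2⟩ := IsTestField.exists_of_mem_span hu
  exact h u φ h1 h2

/-- `v ↦ ∂_i v` as a continuous linear map. -/
def pdL (i : Fin d) : X Ω →L[ℝ] L2 Ω (EuclideanSpace ℝ (Fin d)) :=
  ((PiLp.proj 2 (fun _ : DerivIdx d 1 => L2 Ω (EuclideanSpace ℝ (Fin d)))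
    ⟨⟨1, Nat.lt_succ_self 1⟩, fun _ => i⟩).comp
      (Hs Ω (EuclideanSpace ℝ (Fin d)) 1).subtypeL).comp (X Ω).subtypeL

theorem pd_eq (v : X Ω) (i : Fin d) : pd v i = pdL i v := rfl

theorem continuous_pd (i : Fin d) : Continuous fun v : X Ω => pd v i := (pdL i).continuous

theorem norm_X_sq (v : X Ω) : ‖v‖ ^ 2 = ‖fld v‖ ^ 2 + gradNorm v ^ 2 := by
  rw [gradNorm, Real.sq_sqrt (by positivity)]
  exact Hs.norm_sq_one v.1

theorem gradNorm_nonneg (v : X Ω) : 0 ≤ gradNorm v := Real.sqrt_nonneg _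

theorem continuous_gradNorm : Continuous (gradNorm : X Ω → ℝ) :=
  (continuous_finsetSum _ fun i _ => ((continuous_pd i).norm.pow 2)).sqrt

theorem gradNorm_le_norm (v : X Ω) : gradNorm v ≤ ‖v‖ :=
  le_of_sq_le_sq (by rw [norm_X_sq]; nlinarith [sq_nonneg ‖fld v‖]) (norm_nonneg v)

theorem norm_fld_le_norm (v : X Ω) : ‖fld v‖ ≤ ‖v‖ :=
  le_of_sq_le_sq (by rw [norm_X_sq]; nlinarith [sq_nonneg (gradNorm v)]) (norm_nonneg v)

theorem norm_pd_le_gradNorm (v : X Ω) (i : Fin d) : ‖pd v i‖ ≤ gradNorm v :=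
  Real.le_sqrt_of_sq_le
    (Finset.single_le_sum (f := fun i => ‖pd v i‖ ^ 2) (fun _ _ => by positivity)
      (Finset.mem_univ i))

/-- The gradient of `v`, as an element of a Hilbert space. -/
def gradVec (v : X Ω) : PiLp 2 fun _ : Fin d => L2 Ω (EuclideanSpace ℝ (Fin d)) :=
  WithLp.toLp 2 fun i => pd v i

theorem gradVec_sub (u v : X Ω) : gradVec (u - v) = gradVec u - gradVec v := rfl

theorem gradVec_add (u v : X Ω) : gradVec (u + v) = gradVec u + gradVec v := rfl

theorem gradNorm_eq_norm (v : X Ω) : gradNorm v = ‖gradVec v‖ := by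
  rw [PiLp.norm_eq_of_L2]; rfl

theorem gradInner_eq_inner (u v : X Ω) : gradInner u v = ⟪gradVec u, gradVec v⟫ := by
  rw [PiLp.inner_apply]; rfl

theorem gradNorm_add_le (u v : X Ω) : gradNorm (u + v) ≤ gradNorm u + gradNorm v := by
  simp only [gradNorm_eq_norm, gradVec_add]
  exact norm_add_le _ _

theorem abs_gradInner_le (u v : X Ω) : |gradInner u v| ≤ gradNorm u * gradNorm v := by
  rw [gradInner_eq_inner, gradNorm_eq_norm, gradNorm_eq_norm]
  exact abs_real_inner_le_norm _ _

theorem gradInner_self (u : X Ω) : gradInner u u = gradNorm u ^ 2 := by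
  rw [gradInner_eq_inner, gradNorm_eq_norm, real_inner_self_eq_norm_sq]

theorem gradInner_sub_left (u v w : X Ω) :
    gradInner (u - v) w = gradInner u w - gradInner v w := by
  simp only [gradInner_eq_inner, gradVec_sub, inner_sub_left]

/-- The weak derivatives of a test field are its classical derivatives. -/
theorem pd_ae_eq_fderiv (hΩ : IsOpen Ω) {v : X Ω}
    {φ : EuclideanSpace ℝ (Fin d) → EuclideanSpace ℝ (Fin d)} (hφ : IsTestField Ω φ)
    (hv : fld v =ᵐ[volume.restrict Ω] φ) (i : Fin d) :
    pd v i =ᵐ[volume.restrict Ω] fun x => fderiv ℝ φ x (EuclideanSpace.single i 1) := by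
  obtain ⟨h1, h2, h3⟩ := hφ
  have hDc : Continuous fun x => fderiv ℝ φ x (EuclideanSpace.single i 1) :=
    (h1.continuous_fderiv (by simp)).clm_apply continuous_const
  have hDs : HasCompactSupport fun x => fderiv ℝ φ x (EuclideanSpace.single i (1 : ℝ)) :=
    h2.fderiv_apply (𝕜 := ℝ) _
  have hm : MemLp (fun x => fderiv ℝ φ x (EuclideanSpace.single i (1 : ℝ))) 2
      (volume.restrict Ω) := hDc.memLp_of_hasCompactSupport hDs
  obtain ⟨G, hG⟩ : ∃ G : L2 Ω (EuclideanSpace ℝ (Fin d)), G =ᵐ[volume.restrict Ω]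
      fun x => fderiv ℝ φ x (EuclideanSpace.single i (1 : ℝ)) := ⟨hm.toLp, hm.coeFn_toLp⟩
  have hw : HasWeakDeriv Ω (fun _ : Fin 1 => i) (fld v) G := by
    intro ψ k1 k2 k3
    have e1 : ∫ x in Ω, partialDeriv (fun _ : Fin 1 => i) ψ x • fld v x
        = ∫ x, fderiv ℝ ψ x (EuclideanSpace.single i 1) • φ x := by
      rw [← setIntegral_eq_integral_of_forall_compl_eq_zero (μ := volume) (s := Ω)
        (f := fun x => fderiv ℝ ψ x (EuclideanSpace.single i 1) • φ x)]
      · refine integral_congr_ae ?_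
        filter_upwards [hv] with x hx
        rw [partialDeriv_one, hx]
      · intro x hx
        rw [image_eq_zero_of_notMem_tsupport fun h => hx (h3 h), smul_zero]
    have e2 : ∫ x in Ω, ψ x • G x
        = ∫ x, ψ x • fderiv ℝ φ x (EuclideanSpace.single i 1) := by
      rw [← setIntegral_eq_integral_of_forall_compl_eq_zero (μ := volume) (s := Ω)
        (f := fun x => ψ x • fderiv ℝ φ x (EuclideanSpace.single i 1))]
      · refine integral_congr_ae ?_
        filter_upwards [hG] with x hx
        rw [hx]
      · intro x hx
        rw [image_eq_zero_of_notMem_tsupport fun h => hx (k3 h), zero_smul]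
    have hDψ : Continuous fun x => fderiv ℝ ψ x (EuclideanSpace.single i 1) :=
      (k1.continuous_fderiv (by simp)).clm_apply continuous_const
    have key := integral_smul_fderiv_eq_neg_fderiv_smul_of_integrable (μ := volume) (f := ψ)
      (g := φ) (v := EuclideanSpace.single i 1)
      ((hDψ.smul h1.continuous).integrable_of_hasCompactSupport h2.smul_left)
      ((k1.continuous.smul hDc).integrable_of_hasCompactSupport hDs.smul_left)
      ((k1.continuous.smul h1.continuous).integrable_of_hasCompactSupport h2.smul_left)
      (fun x _ => (k1.differentiable (by simp)).differentiableAt)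
      (fun x _ => (h1.differentiable (by simp)).differentiableAt)
    rw [e1, e2, key]
    simp
  have : pd v i = G := HasWeakDeriv.unique hΩ (v.1.2 ⟨⟨1, Nat.lt_succ_self 1⟩, fun _ => i⟩) hw
  rw [this]
  exact hG

/-- Bounds of `Lᵖ` norms pass to `L²` limits, by Fatou's lemma along an almost everywhere convergent
subsequence. -/
theorem eLpNorm_le_of_tendsto {G : Type} [NormedAddCommGroup G] {p : ℝ≥0∞}
    {f : ℕ → L2 Ω G} {g : L2 Ω G} (hfg : Filter.Tendsto f Filter.atTop (nhds g)) {c : ℕ → ℝ}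
    {c₀ : ℝ} (hc : Filter.Tendsto c Filter.atTop (nhds c₀))
    (h : ∀ n, eLpNorm (f n) p (volume.restrict Ω) ≤ ENNReal.ofReal (c n)) :
    eLpNorm g p (volume.restrict Ω) ≤ ENNReal.ofReal c₀ := by
  obtain ⟨ns, hns, hae⟩ := (tendstoInMeasure_of_tendsto_Lp hfg).exists_seq_tendsto_ae
  have h1 := Lp.eLpNorm_lim_le_liminf_eLpNorm (p := p)
    (f := fun n => (f (ns n) : EuclideanSpace ℝ (Fin d) → G))
    (fun n => Lp.aestronglyMeasurable (f (ns n))) g hae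
  refine h1.trans ?_
  have h2 : Filter.Tendsto (fun n => ENNReal.ofReal (c (ns n))) Filter.atTop
      (nhds (ENNReal.ofReal c₀)) :=
    ENNReal.tendsto_ofReal (hc.comp hns.tendsto_atTop)
  rw [← h2.liminf_eq]
  exact Filter.liminf_le_liminf (Filter.Eventually.of_forall fun n => h (ns n))

/-- The Gagliardo-Nirenberg-Sobolev inequality for test fields, in dimensions two and three. -/
theorem exists_eLpNorm_six_le_of_isTestField (hd : d = 2 ∨ d = 3)
    (hΩb : Bornology.IsBounded Ω) :
    ∃ C : ℝ≥0∞, C < ⊤ ∧ ∀ φ : EuclideanSpace ℝ (Fin d) → EuclideanSpace ℝ (Fin d),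
      IsTestField Ω φ → eLpNorm φ 6 (volume.restrict Ω)
        ≤ C * eLpNorm (fderiv ℝ φ) 2 (volume.restrict Ω) := by
  have hsupp : ∀ φ : EuclideanSpace ℝ (Fin d) → EuclideanSpace ℝ (Fin d),
      IsTestField Ω φ → φ.support ⊆ Ω := fun φ h => (subset_tsupport φ).trans h.2.2
  have hsupp' : ∀ (p : ℝ≥0∞) (φ : EuclideanSpace ℝ (Fin d) → EuclideanSpace ℝ (Fin d)),
      IsTestField Ω φ → eLpNorm (fderiv ℝ φ) p (volume.restrict Ω) = eLpNorm (fderiv ℝ φ) p :=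
    fun p φ h => eLpNorm_restrict_eq_of_support_subset
      (ε := EuclideanSpace ℝ (Fin d) →L[ℝ] EuclideanSpace ℝ (Fin d))
      ((support_fderiv_subset ℝ).trans h.2.2)
  rcases hd with rfl | rfl
  -- in dimension two, `6` is the Sobolev exponent of `3/2`
  · set C₁ := eLpNormLESNormFDerivOfLeConst (EuclideanSpace ℝ (Fin 2))
      (volume : Measure (EuclideanSpace ℝ (Fin 2))) Ω (3 / 2) 6
    refine ⟨C₁ * volume Ω ^ (1 / 6 : ℝ), ENNReal.mul_lt_top (by simp)
      (ENNReal.rpow_lt_top_of_nonneg (by norm_num) hΩb.measure_lt_top.ne), fun φ h => ?_⟩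
    have h1 := eLpNorm_le_eLpNorm_fderiv_of_le (volume : Measure (EuclideanSpace ℝ (Fin 2)))
      (h.1.of_le (by simp)) (hsupp φ h) (p := 3 / 2) (q := 6)
      (by rw [← NNReal.coe_le_coe]; norm_num) (by rw [← NNReal.coe_lt_coe]; simp; norm_num)
      (by simp; norm_num) hΩb
    have h2 := eLpNorm_le_eLpNorm_mul_rpow_measure_univ (μ := volume.restrict Ω)
      (f := fderiv ℝ φ) (p := (3 / 2 : NNReal)) (q := 2)
      (by rw [← ENNReal.coe_ofNat, ENNReal.coe_le_coe, ← NNReal.coe_le_coe]; norm_num)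
      (h.1.continuous_fderiv (by simp)).aestronglyMeasurable
    rw [Measure.restrict_apply_univ] at h2
    rw [eLpNorm_restrict_eq_of_support_subset (hsupp φ h)]
    simp only [hsupp' _ φ h] at h2 ⊢
    refine (by exact_mod_cast h1 : _ ≤ _).trans ?_
    rw [mul_assoc]
    refine mul_le_mul_right (h2.trans_eq ?_) _
    rw [mul_comm]
    congr 2
    norm_num
  · set C₁ := eLpNormLESNormFDerivOfLeConst (EuclideanSpace ℝ (Fin 3))
      (volume : Measure (EuclideanSpace ℝ (Fin 3))) Ω 2 6
    refine ⟨C₁, by simp, fun φ h => ?_⟩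
    have h1 := eLpNorm_le_eLpNorm_fderiv_of_le (volume : Measure (EuclideanSpace ℝ (Fin 3)))
      (h.1.of_le (by simp)) (hsupp φ h) (p := 2) (q := 6)
      (by rw [← NNReal.coe_le_coe]; norm_num) (by rw [← NNReal.coe_lt_coe]; simp; norm_num)
      (by simp; norm_num) hΩb
    rw [eLpNorm_restrict_eq_of_support_subset (hsupp φ h),
      hsupp' _ φ h]
    exact_mod_cast h1

theorem norm_clm_le_sum (L : EuclideanSpace ℝ (Fin d) →L[ℝ] EuclideanSpace ℝ (Fin d)) :
    ‖L‖ ≤ ∑ i, ‖L (EuclideanSpace.single i 1)‖ := by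
  refine L.opNorm_le_bound (Finset.sum_nonneg fun _ _ => norm_nonneg _) fun x => ?_
  have : L x = ∑ i, x i • L (EuclideanSpace.single i 1) := by
    conv_lhs => rw [← (EuclideanSpace.basisFun (Fin d) ℝ).sum_repr x]
    simp
  rw [this, Finset.sum_mul]
  refine (norm_sum_le _ _).trans (Finset.sum_le_sum fun i _ => ?_)
  rw [norm_smul, mul_comm]
  gcongr
  exact PiLp.norm_apply_le x i

/-- The embedding `H¹₀ ⊆ L⁶` with the gradient norm. -/
theorem exists_eLpNorm_six_le (hd : d = 2 ∨ d = 3) (hΩ : IsOpen Ω)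
    (hΩb : Bornology.IsBounded Ω) :
    ∃ C : ℝ, 0 ≤ C ∧ ∀ v : X Ω,
      eLpNorm (fld v) 6 (volume.restrict Ω) ≤ ENNReal.ofReal (C * gradNorm v) := by
  obtain ⟨C, hC, h⟩ := exists_eLpNorm_six_le_of_isTestField hd hΩb
  refine ⟨C.toReal * d, by positivity, fun v => ?_⟩
  refine X.induction (P := fun v => eLpNorm (fld v) 6 (volume.restrict Ω)
    ≤ ENNReal.ofReal (C.toReal * d * gradNorm v)) ?_ ?_ v
  · refine IsSeqClosed.isClosed fun f g hf hfg => ?_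
    exact eLpNorm_le_of_tendsto ((fld.continuous.tendsto g).comp hfg)
      (((continuous_gradNorm.tendsto g).comp hfg).const_mul (C.toReal * d)) hf
  · intro v φ hφ hv
    have h1 : eLpNorm (fderiv ℝ φ) 2 (volume.restrict Ω) ≤ d * ENNReal.ofReal (gradNorm v) := by
      calc eLpNorm (fderiv ℝ φ) 2 (volume.restrict Ω)
          ≤ eLpNorm (∑ i, fun x => ‖fderiv ℝ φ x (EuclideanSpace.single i 1)‖) 2
              (volume.restrict Ω) := by
            refine eLpNorm_mono_real fun x => ?_
            rw [Finset.sum_apply]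
            exact norm_clm_le_sum _
        _ ≤ ∑ i, eLpNorm (fun x => ‖fderiv ℝ φ x (EuclideanSpace.single i 1)‖) 2
              (volume.restrict Ω) := by
            refine eLpNorm_sum_le (fun i _ => ?_) (by norm_num)
            exact ((hφ.1.continuous_fderiv (by simp)).clm_apply
              continuous_const).norm.aestronglyMeasurable
        _ = ∑ i, ‖pd v i‖ₑ := by
            refine Finset.sum_congr rfl fun i _ => ?_
            rw [eLpNorm_norm, Lp.enorm_def]
            exact (eLpNorm_congr_ae (pd_ae_eq_fderiv hΩ hφ hv i)).symm
        _ ≤ ∑ _i : Fin d, ENNReal.ofReal (gradNorm v) := by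
            refine Finset.sum_le_sum fun i _ => ?_
            rw [← ofReal_norm]
            exact ENNReal.ofReal_le_ofReal (norm_pd_le_gradNorm v i)
        _ = _ := by simp
    rw [eLpNorm_congr_ae hv, mul_assoc, ENNReal.ofReal_mul ENNReal.toReal_nonneg,
      ENNReal.ofReal_toReal hC.ne, ENNReal.ofReal_mul (by positivity), ENNReal.ofReal_natCast]
    exact (h φ hφ).trans (mul_le_mul_right h1 _)

/-- The Poincaré inequality, from the embedding into `L⁶` and the finite measure of `Ω`. -/
theorem exists_norm_fld_le (hd : d = 2 ∨ d = 3) (hΩ : IsOpen Ω)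
    (hΩb : Bornology.IsBounded Ω) :
    ∃ C : ℝ, 0 ≤ C ∧ ∀ v : X Ω, ‖fld v‖ ≤ C * gradNorm v := by
  obtain ⟨C, hC, h⟩ := exists_eLpNorm_six_le hd hΩ hΩb
  refine ⟨C * (volume Ω ^ (1 / 3 : ℝ)).toReal, by positivity, fun v => ?_⟩
  have h2 := eLpNorm_le_eLpNorm_mul_rpow_measure_univ (μ := volume.restrict Ω)
      (f := fld v) (p := 2) (q := 6) (by norm_num) (Lp.aestronglyMeasurable _)
  rw [Measure.restrict_apply_univ] at h2
  have e : (1 / (2 : ℝ≥0∞).toReal - 1 / (6 : ℝ≥0∞).toReal) = (1 / 3 : ℝ) := by norm_num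
  rw [e] at h2
  have hvol : volume Ω ^ (1 / 3 : ℝ) ≠ ⊤ :=
    (ENNReal.rpow_lt_top_of_nonneg (by norm_num) hΩb.measure_lt_top.ne).ne
  have h3 := h2.trans (mul_le_mul_left (h v) _)
  rw [Lp.norm_def]
  refine (ENNReal.toReal_mono (ENNReal.mul_ne_top ENNReal.ofReal_ne_top hvol) h3).trans_eq ?_
  rw [ENNReal.toReal_mul, ENNReal.toReal_ofReal (mul_nonneg hC (gradNorm_nonneg v))]
  ring

/-- The divergence, as a continuous linear map. -/
def divL : X Ω →L[ℝ] L2 Ω ℝ :=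
  ∑ i, ((EuclideanSpace.proj i : EuclideanSpace ℝ (Fin d) →L[ℝ] ℝ).compLpL 2
    (volume.restrict Ω)).comp (pdL i)

theorem coeFn_divL (v : X Ω) :
    divL v =ᵐ[volume.restrict Ω] fun x => ∑ i, (pd v i x) i := by
  have h1 : divL v = ∑ i, (EuclideanSpace.proj i :
      EuclideanSpace ℝ (Fin d) →L[ℝ] ℝ).compLpL 2 (volume.restrict Ω) (pd v i) := by
    simp [divL, pd_eq]
  rw [h1]
  refine (Lp.coeFn_finsetSum _ _).trans ?_
  have h2 : ∀ i, ∀ᵐ x ∂(volume.restrict Ω), (EuclideanSpace.proj i :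
      EuclideanSpace ℝ (Fin d) →L[ℝ] ℝ).compLpL 2 (volume.restrict Ω) (pd v i) x = (pd v i x) i :=
    fun i => ContinuousLinearMap.coeFn_compLpL _ _
  filter_upwards [ae_all_iff.2 h2] with x hx
  simp [hx]

theorem divPair_eq_inner (q : L2 Ω ℝ) (v : X Ω) : divPair q v = ⟪q, divL v⟫ := by
  rw [L2.inner_def, divPair]
  refine integral_congr_ae ?_
  filter_upwards [coeFn_divL v] with x hx
  rw [hx]
  simp [mul_comm]

theorem norm_divL_le (v : X Ω) : ‖divL v‖ ≤ d * gradNorm v := by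
  have h1 : divL v = ∑ i, (EuclideanSpace.proj i :
      EuclideanSpace ℝ (Fin d) →L[ℝ] ℝ).compLp (pd v i) := by
    simp [divL, pd_eq]
    rfl
  rw [h1]
  refine (norm_sum_le _ _).trans ?_
  have : ∀ i, ‖(EuclideanSpace.proj i :
      EuclideanSpace ℝ (Fin d) →L[ℝ] ℝ).compLp (pd v i)‖ ≤ gradNorm v := fun i => by
    refine (ContinuousLinearMap.norm_compLp_le _ _).trans ?_
    refine (mul_le_of_le_one_left (norm_nonneg _) ?_).trans (norm_pd_le_gradNorm v i)
    refine ContinuousLinearMap.opNorm_le_bound _ zero_le_one fun x => ?_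
    rw [one_mul]
    exact PiLp.norm_apply_le x i
  refine (Finset.sum_le_sum fun i _ => this i).trans_eq ?_
  simp

theorem abs_divPair_le (q : L2 Ω ℝ) (v : X Ω) : |divPair q v| ≤ d * ‖q‖ * gradNorm v := by
  rw [divPair_eq_inner]
  refine (abs_real_inner_le_norm _ _).trans ?_
  calc ‖q‖ * ‖divL v‖ ≤ ‖q‖ * (d * gradNorm v) := by gcongr; exact norm_divL_le v
    _ = _ := by ring

end

/-! ### The trilinear form -/

section

variable {d : ℕ} {Ω : Set (EuclideanSpace ℝ (Fin d))}

/-- Hölder's inequality with exponents `2`, `p` and `q`. -/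
theorem lintegral_mul_mul_le {α E₁ E₂ E₃ : Type*} [MeasurableSpace α] {μ : Measure α}
    [NormedAddCommGroup E₁] [NormedAddCommGroup E₂] [NormedAddCommGroup E₃]
    {f : α → E₁} {g : α → E₂} {h : α → E₃} (hf : AEStronglyMeasurable f μ)
    (hg : AEStronglyMeasurable g μ) (hh : AEStronglyMeasurable h μ) {p q : ℝ≥0∞}
    (hpq : ENNReal.HolderTriple p q 2) :
    ∫⁻ x, ‖f x‖ₑ * (‖g x‖ₑ * ‖h x‖ₑ) ∂μ ≤ eLpNorm f 2 μ * (eLpNorm g p μ * eLpNorm h q μ) := by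
  have h1 := eLpNorm_smul_le_mul_eLpNorm (p := p) (q := q) (r := 2) (μ := μ)
    (f := fun x => ‖h x‖) (φ := fun x => ‖g x‖) hh.norm hg.norm
  have h2 := eLpNorm_smul_le_mul_eLpNorm (p := 2) (q := 2) (r := 1) (μ := μ)
    (f := (fun x => ‖g x‖) • fun x => ‖h x‖) (φ := fun x => ‖f x‖) (hg.norm.smul hh.norm) hf.norm
  rw [eLpNorm_one_eq_lintegral_enorm] at h2
  simp only [eLpNorm_norm] at h1 h2
  refine le_trans (le_of_eq ?_) (h2.trans (mul_le_mul_right h1 _))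
  refine lintegral_congr fun x => ?_
  simp [enorm_mul]

/-- The integrand of `∫ ∑ᵢ aᵢ (gᵢ · c)`. -/
def triInt (a : L2 Ω (EuclideanSpace ℝ (Fin d))) (g : Fin d → L2 Ω (EuclideanSpace ℝ (Fin d)))
    (c : L2 Ω (EuclideanSpace ℝ (Fin d))) (x : EuclideanSpace ℝ (Fin d)) : ℝ :=
  ∑ i, (a x) i * ⟪g i x, c x⟫

theorem conv_eq_integral_triInt (u v w : X Ω) :
    conv u v w = ∫ x in Ω, triInt (fld u) (pd v) (fld w) x := rfl

theorem aestronglyMeasurable_triInt (a : L2 Ω (EuclideanSpace ℝ (Fin d)))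
    (g : Fin d → L2 Ω (EuclideanSpace ℝ (Fin d))) (c : L2 Ω (EuclideanSpace ℝ (Fin d))) :
    AEStronglyMeasurable (triInt a g c) (volume.restrict Ω) := by
  have : triInt a g c = ∑ i, fun x => (a x) i * ⟪g i x, c x⟫ := by
    funext x; simp [triInt]
  rw [this]
  refine Finset.aestronglyMeasurable_sum _ fun i _ => ?_
  have h1 : AEStronglyMeasurable (fun x => (a x) i) (volume.restrict Ω) :=
    (EuclideanSpace.proj (𝕜 := ℝ) i).continuous.comp_aestronglyMeasurable
      (Lp.aestronglyMeasurable a)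
  exact h1.mul ((Lp.aestronglyMeasurable (g i)).inner (Lp.aestronglyMeasurable c))

theorem enorm_triInt_le (a : L2 Ω (EuclideanSpace ℝ (Fin d)))
    (g : Fin d → L2 Ω (EuclideanSpace ℝ (Fin d))) (c : L2 Ω (EuclideanSpace ℝ (Fin d)))
    (x : EuclideanSpace ℝ (Fin d)) :
    ‖triInt a g c x‖ₑ ≤ ∑ i, ‖a x‖ₑ * (‖g i x‖ₑ * ‖c x‖ₑ) := by
  refine (enorm_sum_le _ _).trans (Finset.sum_le_sum fun i _ => ?_)
  rw [enorm_mul]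
  gcongr
  · exact enorm_le_iff_norm_le.2 (PiLp.norm_apply_le (a x) i)
  · rw [← enorm_norm (g i x), ← enorm_norm (c x), ← enorm_mul]
    refine enorm_le_iff_norm_le.2 ?_
    rw [norm_mul, norm_norm, norm_norm]
    exact norm_inner_le_norm _ _

/-- Hölder's inequality for the trilinear integrand, from a bound of each summand. -/
theorem triInt_bound {a : L2 Ω (EuclideanSpace ℝ (Fin d))}
    {g : Fin d → L2 Ω (EuclideanSpace ℝ (Fin d))} {c : L2 Ω (EuclideanSpace ℝ (Fin d))} {B : ℝ}
    (hB : 0 ≤ B)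
    (h : ∀ i, ∫⁻ x in Ω, ‖a x‖ₑ * (‖g i x‖ₑ * ‖c x‖ₑ) ≤ ENNReal.ofReal B) :
    Integrable (triInt a g c) (volume.restrict Ω) ∧ |∫ x in Ω, triInt a g c x| ≤ d * B := by
  have h1 : ∫⁻ x in Ω, ‖triInt a g c x‖ₑ ≤ ENNReal.ofReal (d * B) := by
    calc ∫⁻ x in Ω, ‖triInt a g c x‖ₑ
        ≤ ∫⁻ x in Ω, ∑ i, ‖a x‖ₑ * (‖g i x‖ₑ * ‖c x‖ₑ) := lintegral_mono (enorm_triInt_le a g c)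
      _ = ∑ i, ∫⁻ x in Ω, ‖a x‖ₑ * (‖g i x‖ₑ * ‖c x‖ₑ) := by
          refine lintegral_finsetSum _ fun i _ => ?_
          exact (Lp.stronglyMeasurable a).enorm.mul
            ((Lp.stronglyMeasurable (g i)).enorm.mul (Lp.stronglyMeasurable c).enorm)
      _ ≤ ∑ _i : Fin d, ENNReal.ofReal B := Finset.sum_le_sum fun i _ => h i
      _ = ENNReal.ofReal (d * B) := by
          rw [ENNReal.ofReal_mul (by positivity)]; simp
  refine ⟨⟨aestronglyMeasurable_triInt a g c, h1.trans_lt ENNReal.ofReal_lt_top⟩, ?_⟩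
  have h2 := (enorm_integral_le_lintegral_enorm (μ := volume.restrict Ω) (triInt a g c)).trans h1
  rw [← Real.norm_eq_abs, ← ENNReal.ofReal_le_ofReal_iff (by positivity), ofReal_norm]
  exact h2

theorem ofReal_mul_mul {a b c : ℝ} (ha : 0 ≤ a) (hb : 0 ≤ b) :
    ENNReal.ofReal a * (ENNReal.ofReal b * ENNReal.ofReal c) = ENNReal.ofReal (a * b * c) := by
  rw [← ENNReal.ofReal_mul hb, ← ENNReal.ofReal_mul ha, mul_assoc]

/-- The trilinear integral with the middle factor in `L²`. -/
theorem triInt_bound_mid {p q : ℝ≥0∞} (hpq : ENNReal.HolderTriple p q 2)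
    {a : L2 Ω (EuclideanSpace ℝ (Fin d))} {g : Fin d → L2 Ω (EuclideanSpace ℝ (Fin d))}
    {c : L2 Ω (EuclideanSpace ℝ (Fin d))} {A G B : ℝ} (hA : 0 ≤ A) (hG : 0 ≤ G) (hB : 0 ≤ B)
    (ha : eLpNorm a p (volume.restrict Ω) ≤ ENNReal.ofReal A) (hg : ∀ i, ‖g i‖ ≤ G)
    (hc : eLpNorm c q (volume.restrict Ω) ≤ ENNReal.ofReal B) :
    Integrable (triInt a g c) (volume.restrict Ω) ∧
      |∫ x in Ω, triInt a g c x| ≤ d * (A * G * B) := by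
  refine triInt_bound (by positivity) fun i => ?_
  have h1 := lintegral_mul_mul_le (Lp.aestronglyMeasurable (g i)) (Lp.aestronglyMeasurable a)
    (Lp.aestronglyMeasurable c) hpq
  have h2 : eLpNorm (g i) 2 (volume.restrict Ω) ≤ ENNReal.ofReal G := by
    rw [← Lp.enorm_def, ← ofReal_norm]
    exact ENNReal.ofReal_le_ofReal (hg i)
  calc ∫⁻ x in Ω, ‖a x‖ₑ * (‖g i x‖ₑ * ‖c x‖ₑ)
      = ∫⁻ x in Ω, ‖g i x‖ₑ * (‖a x‖ₑ * ‖c x‖ₑ) := by simp_rw [mul_left_comm]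
    _ ≤ _ := h1
    _ ≤ ENNReal.ofReal G * (ENNReal.ofReal A * ENNReal.ofReal B) := by gcongr
    _ = _ := by rw [ofReal_mul_mul hG hA]; ring_nf

/-- The trilinear integral with the first factor in `L²`. -/
theorem triInt_bound_left {p q : ℝ≥0∞} (hpq : ENNReal.HolderTriple p q 2)
    {a : L2 Ω (EuclideanSpace ℝ (Fin d))} {g : Fin d → L2 Ω (EuclideanSpace ℝ (Fin d))}
    {c : L2 Ω (EuclideanSpace ℝ (Fin d))} {G B : ℝ} (hG : 0 ≤ G) (hB : 0 ≤ B)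
    (hg : ∀ i, eLpNorm (g i) p (volume.restrict Ω) ≤ ENNReal.ofReal G)
    (hc : eLpNorm c q (volume.restrict Ω) ≤ ENNReal.ofReal B) :
    |∫ x in Ω, triInt a g c x| ≤ d * (‖a‖ * G * B) := by
  refine (triInt_bound (by positivity) fun i => ?_).2
  refine (lintegral_mul_mul_le (Lp.aestronglyMeasurable a) (Lp.aestronglyMeasurable (g i))
    (Lp.aestronglyMeasurable c) hpq).trans ?_
  rw [← ofReal_mul_mul (norm_nonneg _) hG, ofReal_norm, Lp.enorm_def]
  gcongr
  exact hg i

theorem holderTriple_four : ENNReal.HolderTriple 4 4 2 := ⟨by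
  rw [← ENNReal.toReal_eq_toReal_iff' (by finiteness) (by finiteness),
    ENNReal.toReal_add (by finiteness) (by finiteness)]
  norm_num [ENNReal.toReal_inv]⟩

theorem holderTriple_six_three : ENNReal.HolderTriple 6 3 2 := ⟨by
  rw [← ENNReal.toReal_eq_toReal_iff' (by finiteness) (by finiteness),
    ENNReal.toReal_add (by finiteness) (by finiteness)]
  norm_num [ENNReal.toReal_inv]⟩

/-- The `L³` norm is controlled by the geometric mean of the `L²` and `L⁶` norms. -/
theorem eLpNorm_three_le {f : L2 Ω (EuclideanSpace ℝ (Fin d))} {B : ℝ} (hB : 0 ≤ B)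
    (h : eLpNorm f 6 (volume.restrict Ω) ≤ ENNReal.ofReal B) :
    eLpNorm f 3 (volume.restrict Ω) ≤ ENNReal.ofReal √(‖f‖ * B) := by
  have hm : Measurable fun x => ‖f x‖ₑ ^ (3 / 2 : ℝ) :=
    (Lp.stronglyMeasurable f).enorm.pow_const _
  have h1 := ENNReal.lintegral_mul_le_Lp_mul_Lq (volume.restrict Ω) (p := 4 / 3) (q := 4)
    (by norm_num [Real.holderConjugate_iff]) hm.aemeasurable hm.aemeasurable
  have e1 : ∀ t : ℝ≥0∞, t ^ (3 / 2 : ℝ) * t ^ (3 / 2 : ℝ) = t ^ 3 := fun t => by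
    rw [← ENNReal.rpow_add_of_nonneg _ _ (by norm_num) (by norm_num), ← ENNReal.rpow_ofNat]
    norm_num
  have e2 : ∀ t : ℝ≥0∞, (t ^ (3 / 2 : ℝ)) ^ (4 / 3 : ℝ) = t ^ 2 := fun t => by
    rw [← ENNReal.rpow_mul, ← ENNReal.rpow_ofNat]; norm_num
  have e3 : ∀ t : ℝ≥0∞, (t ^ (3 / 2 : ℝ)) ^ (4 : ℝ) = t ^ 6 := fun t => by
    rw [← ENNReal.rpow_mul, ← ENNReal.rpow_ofNat]; norm_num
  simp only [Pi.mul_apply, e1, e2, e3] at h1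
  have n2 := eLpNorm_natCast_pow (μ := volume.restrict Ω) f (n := 2) (by norm_num)
  have n3 := eLpNorm_natCast_pow (μ := volume.restrict Ω) f (n := 3) (by norm_num)
  have n6 := eLpNorm_natCast_pow (μ := volume.restrict Ω) f (n := 6) (by norm_num)
  rw [← n2, ← n3, ← n6] at h1
  norm_num at h1
  have h2 := ENNReal.rpow_le_rpow h1 (by norm_num : (0 : ℝ) ≤ 1 / 3)
  have e4 : ∀ t : ℝ≥0∞, (t ^ 3) ^ (1 / 3 : ℝ) = t := fun t => by
    rw [← ENNReal.rpow_ofNat, ← ENNReal.rpow_mul]; norm_num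
  have e5 : ∀ t : ℝ≥0∞, ((t ^ 2) ^ (3 / 4 : ℝ)) ^ (1 / 3 : ℝ) = t ^ (1 / 2 : ℝ) := fun t => by
    rw [← ENNReal.rpow_ofNat, ← ENNReal.rpow_mul, ← ENNReal.rpow_mul]; norm_num
  have e6 : ∀ t : ℝ≥0∞, ((t ^ 6) ^ (1 / 4 : ℝ)) ^ (1 / 3 : ℝ) = t ^ (1 / 2 : ℝ) := fun t => by
    rw [← ENNReal.rpow_ofNat, ← ENNReal.rpow_mul, ← ENNReal.rpow_mul]; norm_num
  rw [e4, ENNReal.mul_rpow_of_nonneg _ _ (by norm_num), e5, e6,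
    ← ENNReal.mul_rpow_of_nonneg _ _ (by norm_num)] at h2
  refine h2.trans ?_
  rw [Real.sqrt_eq_rpow, ← ENNReal.ofReal_rpow_of_nonneg (by positivity) (by norm_num)]
  refine ENNReal.rpow_le_rpow ?_ (by norm_num)
  rw [ENNReal.ofReal_mul (norm_nonneg _), ofReal_norm, Lp.enorm_def]
  gcongr

end

/-! ### Bounds of the trilinear form -/

section

variable {d : ℕ} {Ω : Set (EuclideanSpace ℝ (Fin d))}

theorem triInt_sub_left (a a' : L2 Ω (EuclideanSpace ℝ (Fin d)))
    (g : Fin d → L2 Ω (EuclideanSpace ℝ (Fin d))) (c : L2 Ω (EuclideanSpace ℝ (Fin d))) :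
    triInt (a - a') g c =ᵐ[volume.restrict Ω] fun x => triInt a g c x - triInt a' g c x := by
  filter_upwards [Lp.coeFn_sub a a'] with x hx
  simp only [triInt, hx, Pi.sub_apply, PiLp.sub_apply, sub_mul, Finset.sum_sub_distrib]

theorem triInt_sub_mid (a : L2 Ω (EuclideanSpace ℝ (Fin d)))
    (g g' : Fin d → L2 Ω (EuclideanSpace ℝ (Fin d))) (c : L2 Ω (EuclideanSpace ℝ (Fin d))) :
    triInt a (g - g') c =ᵐ[volume.restrict Ω] fun x => triInt a g c x - triInt a g' c x := by
  filter_upwards [ae_all_iff.2 fun i => Lp.coeFn_sub (g i) (g' i)] with x hx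
  simp only [triInt, hx, Pi.sub_apply, inner_sub_left, mul_sub, Finset.sum_sub_distrib]

theorem triInt_sub_right (a : L2 Ω (EuclideanSpace ℝ (Fin d)))
    (g : Fin d → L2 Ω (EuclideanSpace ℝ (Fin d))) (c c' : L2 Ω (EuclideanSpace ℝ (Fin d))) :
    triInt a g (c - c') =ᵐ[volume.restrict Ω] fun x => triInt a g c x - triInt a g c' x := by
  filter_upwards [Lp.coeFn_sub c c'] with x hx
  simp only [triInt, hx, Pi.sub_apply, inner_sub_right, mul_sub, Finset.sum_sub_distrib]

/-- The embedding `H¹₀ ⊆ L⁶`, the Poincaré inequality and the Sobolev embeddings of `H¹(Ω)` and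
`H²(Ω)`, with one constant. -/
structure SobolevBounds (Ω : Set (EuclideanSpace ℝ (Fin d))) (S : ℝ) : Prop where
  nonneg : 0 ≤ S
  six : ∀ v : X Ω, eLpNorm (fld v) 6 (volume.restrict Ω) ≤ ENNReal.ofReal (S * gradNorm v)
  norm_le : ∀ v : X Ω, ‖v‖ ≤ S * gradNorm v
  four : ∀ w : Hs Ω (EuclideanSpace ℝ (Fin d)) 1,
    eLpNorm (Hs.toL2 w) 4 (volume.restrict Ω) ≤ ENNReal.ofReal (S * ‖w‖)
  deriv_four : ∀ (U : Hs Ω (EuclideanSpace ℝ (Fin d)) 2) (i : Fin d),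
    eLpNorm (U.1 ⟨⟨1, by norm_num⟩, fun _ => i⟩) 4 (volume.restrict Ω) ≤ ENNReal.ofReal (S * ‖U‖)
  top : ∀ U : Hs Ω (EuclideanSpace ℝ (Fin d)) 2,
    eLpNorm (Hs.toL2 U) ⊤ (volume.restrict Ω) ≤ ENNReal.ofReal (S * ‖U‖)

theorem exists_sobolevBounds (hd : d = 2 ∨ d = 3) (hΩ : IsOpen Ω)
    (hΩb : Bornology.IsBounded Ω) (hcone : ConeCondition Ω) : ∃ S, SobolevBounds Ω S := by
  have hd3 : d ≤ 3 := by omega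
  obtain ⟨A, hA, h6⟩ := exists_eLpNorm_six_le hd hΩ hΩb
  obtain ⟨B, hB, hP⟩ := exists_norm_fld_le hd hΩ hΩb
  obtain ⟨C, hC, h4⟩ := ConeCondition.exists_sobolev_one (F := EuclideanSpace ℝ (Fin d)) hd3 hΩ
    hΩb hcone
  obtain ⟨D, hD, h2⟩ := ConeCondition.exists_sobolev_two (F := EuclideanSpace ℝ (Fin d)) hd3 hΩ
    hΩb hcone
  refine ⟨A + (B + 1) + C + D, by positivity, fun v => (h6 v).trans ?_, fun v => ?_,
    fun w => (h4 w).trans ?_, fun U i => ((h2 U).1 i).trans ?_, fun U => (h2 U).2.trans ?_⟩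
  · have := gradNorm_nonneg v
    gcongr
    linarith
  · have hg := gradNorm_nonneg v
    have h1 : ‖v‖ ≤ (B + 1) * gradNorm v := by
      refine le_of_sq_le_sq ?_ (by positivity)
      rw [norm_X_sq]
      have := pow_le_pow_left₀ (norm_nonneg _) (hP v) 2
      nlinarith [mul_nonneg hB (sq_nonneg (gradNorm v))]
    exact h1.trans (mul_le_mul_of_nonneg_right (by linarith) hg)
  · gcongr
    linarith
  · gcongr
    linarith
  · gcongr
    linarith

namespace SobolevBounds

theorem norm_fld_le {S : ℝ} (hS : SobolevBounds Ω S) (v : X Ω) : ‖fld v‖ ≤ S * gradNorm v :=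
  (norm_fld_le_norm v).trans (hS.norm_le v)

theorem conv_bound {S : ℝ} (hS : SobolevBounds Ω S) (u v w : X Ω) :
    Integrable (triInt (fld u) (pd v) (fld w)) (volume.restrict Ω) ∧
      |conv u v w| ≤ d * (S * ‖u‖ * ‖v‖ * (S * ‖w‖)) :=
  triInt_bound_mid holderTriple_four (mul_nonneg hS.nonneg (norm_nonneg _)) (norm_nonneg _)
    (mul_nonneg hS.nonneg (norm_nonneg _)) (hS.four u.1)
    (fun i => (norm_pd_le_gradNorm v i).trans (gradNorm_le_norm v)) (hS.four w.1)

theorem conv_sub_left {S : ℝ} (hS : SobolevBounds Ω S) (u u' v w : X Ω) :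
    conv (u - u') v w = conv u v w - conv u' v w := by
  rw [conv_eq_integral_triInt, conv_eq_integral_triInt, conv_eq_integral_triInt,
    ← integral_sub (hS.conv_bound u v w).1 (hS.conv_bound u' v w).1, map_sub]
  exact integral_congr_ae (triInt_sub_left _ _ _ _)

theorem conv_sub_mid {S : ℝ} (hS : SobolevBounds Ω S) (u v v' w : X Ω) :
    conv u (v - v') w = conv u v w - conv u v' w := by
  rw [conv_eq_integral_triInt, conv_eq_integral_triInt, conv_eq_integral_triInt,
    ← integral_sub (hS.conv_bound u v w).1 (hS.conv_bound u v' w).1]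
  exact integral_congr_ae (triInt_sub_mid _ _ _ _)

theorem conv_sub_right {S : ℝ} (hS : SobolevBounds Ω S) (u v w w' : X Ω) :
    conv u v (w - w') = conv u v w - conv u v w' := by
  rw [conv_eq_integral_triInt, conv_eq_integral_triInt, conv_eq_integral_triInt,
    ← integral_sub (hS.conv_bound u v w).1 (hS.conv_bound u v w').1, map_sub]
  exact integral_congr_ae (triInt_sub_right _ _ _ _)

theorem b_sub_left {S : ℝ} (hS : SobolevBounds Ω S) (u u' v w : X Ω) :
    b (u - u') v w = b u v w - b u' v w := by
  simp only [b, hS.conv_sub_left]; ring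

theorem b_sub_mid {S : ℝ} (hS : SobolevBounds Ω S) (u v v' w : X Ω) :
    b u (v - v') w = b u v w - b u v' w := by
  simp only [b, hS.conv_sub_mid, hS.conv_sub_right]; ring

theorem continuous_conv_mid {S : ℝ} (hS : SobolevBounds Ω S) (u w : X Ω) :
    Continuous fun v => conv u v w := by
  refine (LipschitzWith.of_dist_le_mul (K := (d * (S * ‖u‖ * (S * ‖w‖))).toNNReal)
    fun v v' => ?_).continuous
  have h0 : 0 ≤ d * (S * ‖u‖ * (S * ‖w‖)) := by have := hS.nonneg; positivity
  have hd : dist v v' = ‖v - v'‖ := dist_eq_norm v v'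
  rw [Real.dist_eq, ← hS.conv_sub_mid, Real.coe_toNNReal _ h0, hd]
  refine (hS.conv_bound u (v - v') w).2.trans_eq (by ring)

theorem continuous_conv_right {S : ℝ} (hS : SobolevBounds Ω S) (u v : X Ω) :
    Continuous fun w => conv u v w := by
  refine (LipschitzWith.of_dist_le_mul (K := (d * (S * ‖u‖ * ‖v‖ * S)).toNNReal)
    fun w w' => ?_).continuous
  have h0 : 0 ≤ d * (S * ‖u‖ * ‖v‖ * S) := by have := hS.nonneg; positivity
  have hd : dist w w' = ‖w - w'‖ := dist_eq_norm w w'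
  rw [Real.dist_eq, ← hS.conv_sub_right, Real.coe_toNNReal _ h0, hd]
  refine (hS.conv_bound u v (w - w')).2.trans_eq (by ring)

theorem continuous_b_mid {S : ℝ} (hS : SobolevBounds Ω S) (u w : X Ω) :
    Continuous fun v => b u v w :=
  ((hS.continuous_conv_mid u w).const_mul _).sub ((hS.continuous_conv_right u w).const_mul _)

theorem continuous_b_right {S : ℝ} (hS : SobolevBounds Ω S) (u v : X Ω) :
    Continuous fun w => b u v w :=
  ((hS.continuous_conv_right u v).const_mul _).sub ((hS.continuous_conv_mid u v).const_mul _)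

/-- The basic bound `|b(u, v, w)| ≲ ‖u‖₁ ‖v‖₁ ‖∇w‖`. -/
theorem abs_b_le {S : ℝ} (hS : SobolevBounds Ω S) (u v w : X Ω) :
    |b u v w| ≤ d * S ^ 2 * ‖u‖ * ‖v‖ * (S * gradNorm w) := by
  have h1 := (hS.conv_bound u v w).2
  have h2 := (hS.conv_bound u w v).2
  have h3 := hS.norm_le w
  have h4 : |b u v w| ≤ d * S ^ 2 * ‖u‖ * ‖v‖ * ‖w‖ := by
    rw [b, abs_le]
    rw [abs_le] at h1 h2
    constructor <;> nlinarith
  refine h4.trans ?_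
  have := hS.nonneg
  gcongr

/-- The bound `|b(u, v, w)| ≲ ‖u‖ ‖v‖₂ ‖∇w‖`, which puts no derivative on `u`. -/
theorem abs_b_le_of_two {S : ℝ} (hS : SobolevBounds Ω S) (hΩ : IsOpen Ω)
    (u v w : X Ω) (U : Hs Ω (EuclideanSpace ℝ (Fin d)) 2)
    (hU : Hs.toL2 U = fld v) :
    |b u v w| ≤ (d * S * (S ^ 2 + 1)) * ‖fld u‖ * ‖U‖ * gradNorm w := by
  have hS0 := hS.nonneg
  have hg := gradNorm_nonneg w
  have hv : Hs.incl (by norm_num) U = v.1 := Hs.toL2_injective hΩ 1 hU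
  have hpd : ∀ i, pd v i = U.1 ⟨⟨1, by norm_num⟩, fun _ => i⟩ := fun i => by
    rw [pd, ← hv]; rfl
  have h1 : |conv u v w| ≤ d * (‖fld u‖ * (S * ‖U‖) * (S * ‖w‖)) :=
    triInt_bound_left holderTriple_four (by positivity) (by positivity)
      (fun i => by rw [hpd]; exact hS.deriv_four U i) (hS.four w.1)
  have h2 : |conv u w v| ≤ d * (‖fld u‖ * gradNorm w * (S * ‖U‖)) := by
    refine triInt_bound_left (p := 2) (q := ⊤) inferInstance hg (by positivity) (fun i => ?_) ?_
    · rw [← Lp.enorm_def, ← ofReal_norm]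
      exact ENNReal.ofReal_le_ofReal (norm_pd_le_gradNorm w i)
    · rw [← hU]
      exact hS.top U
  have h3 : d * (‖fld u‖ * (S * ‖U‖) * (S * ‖w‖)) ≤
      d * (‖fld u‖ * (S * ‖U‖) * (S * (S * gradNorm w))) := by
    gcongr
    exact hS.norm_le w
  have h0 : 0 ≤ d * S * (S ^ 2 + 1) * ‖fld u‖ * ‖U‖ * gradNorm w := by positivity
  rw [b, abs_le]
  rw [abs_le] at h1 h2
  constructor <;> nlinarith

end SobolevBounds

/-- Integration by parts in the convective term, for test fields. -/
theorem conv_add_conv_of_isTestField {S : ℝ} (hS : SobolevBounds Ω S) (hΩ : IsOpen Ω) (u v w : X Ω)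
    {φ ψ : EuclideanSpace ℝ (Fin d) → EuclideanSpace ℝ (Fin d)} (hφ : IsTestField Ω φ)
    (hv : fld v =ᵐ[volume.restrict Ω] φ) (hψ : IsTestField Ω ψ)
    (hw : fld w =ᵐ[volume.restrict Ω] ψ) :
    conv u v w + conv u w v = -∫ x in Ω, ⟪φ x, ψ x⟫ * divL u x := by
  set χ : EuclideanSpace ℝ (Fin d) → ℝ := fun x => ⟪φ x, ψ x⟫ with hχ
  have hχs : ContDiff ℝ ∞ χ := hφ.1.inner ℝ hψ.1
  have hsub : Function.support χ ⊆ Function.support φ := by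
    intro x hx h
    exact hx (by simp [hχ, h])
  have hχc : HasCompactSupport χ := hφ.2.1.mono hsub
  have hχt : tsupport χ ⊆ Ω := (closure_mono hsub).trans hφ.2.2
  have hi : ∀ i : Fin d, ∫ x in Ω, partialDeriv (fun _ : Fin 1 => i) χ x * (fld u x) i
      = -∫ x in Ω, χ x * (pd u i x) i := by
    intro i
    have h : ∫ x in Ω, partialDeriv (fun _ : Fin 1 => i) χ x • fld u x
        = (-1 : ℝ) ^ 1 • ∫ x in Ω, χ x • pd u i x :=
      u.1.2 ⟨⟨1, Nat.lt_succ_self 1⟩, fun _ => i⟩ χ hχs hχc hχt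
    have h' := congrArg (EuclideanSpace.proj (𝕜 := ℝ) i) h
    simp only [map_smul] at h'
    rw [← ContinuousLinearMap.integral_comp_comm _ (integrable_smul_test Ω _
        (continuous_partialDeriv _ hχs) (hasCompactSupport_partialDeriv _ hχc) _),
      ← ContinuousLinearMap.integral_comp_comm _ (integrable_smul_test Ω _
        hχs.continuous hχc _)] at h'
    simpa using h'
  have e1 : conv u v w + conv u w v
      = ∫ x in Ω, ∑ i, partialDeriv (fun _ : Fin 1 => i) χ x * (fld u x) i := by
    rw [conv_eq_integral_triInt, conv_eq_integral_triInt,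
      ← integral_add (hS.conv_bound u v w).1 (hS.conv_bound u w v).1]
    refine integral_congr_ae ?_
    filter_upwards [hv, hw, ae_all_iff.2 fun i => pd_ae_eq_fderiv hΩ hφ hv i,
      ae_all_iff.2 fun i => pd_ae_eq_fderiv hΩ hψ hw i] with x h1 h2 h3 h4
    simp only [triInt, ← Finset.sum_add_distrib, h1, h2, h3, h4]
    refine Finset.sum_congr rfl fun i _ => ?_
    rw [partialDeriv_one, fderiv_inner_apply ℝ (hφ.1.differentiable (by simp)).differentiableAt
      (hψ.1.differentiable (by simp)).differentiableAt, real_inner_comm (φ x)]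
    ring
  have hint : ∀ i : Fin d, ∀ (f : L2 Ω (EuclideanSpace ℝ (Fin d)))
      (κ : EuclideanSpace ℝ (Fin d) → ℝ), Continuous κ → HasCompactSupport κ →
      Integrable (fun x => κ x * (f x) i) (volume.restrict Ω) := fun i f κ h1 h2 =>
    (EuclideanSpace.proj (𝕜 := ℝ) i).integrable_comp (integrable_smul_test Ω _ h1 h2 f)
  rw [e1, integral_finsetSum _ fun i _ => hint i _ _ (continuous_partialDeriv _ hχs)
    (hasCompactSupport_partialDeriv _ hχc)]
  simp_rw [hi]
  rw [Finset.sum_neg_distrib, ← integral_finsetSum _ fun i _ => hint i _ _ hχs.continuous hχc]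
  congr 1
  refine integral_congr_ae ?_
  filter_upwards [coeFn_divL u] with x hx
  rw [hx, Finset.mul_sum]

end

/-! ### Integration by parts in the trilinear form -/

section

variable {d : ℕ} {Ω : Set (EuclideanSpace ℝ (Fin d))}

/-- The bound `|b(u, v, w)| ≲ ‖∇u‖ ‖v‖^{1/2} ‖∇v‖^{1/2} ‖∇w‖`: integration by parts removes the
derivative from `v`, which is then measured in `L³`. -/
theorem SobolevBounds.abs_b_le_interp {S : ℝ} (hS : SobolevBounds Ω S) (hΩ : IsOpen Ω)
    (u v w : X Ω) :
    |b u v w| ≤ 2 * d * S * gradNorm u * √(‖fld v‖ * (S * gradNorm v)) * gradNorm w := by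
  have hS0 := hS.nonneg
  refine X.induction (P := fun v => |b u v w| ≤
    2 * d * S * gradNorm u * √(‖fld v‖ * (S * gradNorm v)) * gradNorm w) ?_ ?_ v
  · refine isClosed_le (hS.continuous_b_mid u w).abs ?_
    exact (continuous_const.mul (Real.continuous_sqrt.comp
      (fld.continuous.norm.mul (continuous_gradNorm.const_mul S)))).mul_const _
  intro v φ hφ hv
  refine X.induction (P := fun w => |b u v w| ≤
    2 * d * S * gradNorm u * √(‖fld v‖ * (S * gradNorm v)) * gradNorm w) ?_ ?_ w
  · exact isClosed_le (hS.continuous_b_right u v).abs (continuous_gradNorm.const_mul _)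
  intro w ψ hψ hw
  have hu0 := gradNorm_nonneg u
  have hv0 := gradNorm_nonneg v
  have hw0 := gradNorm_nonneg w
  set Z := √(‖fld v‖ * (S * gradNorm v)) with hZ
  have hZ0 : 0 ≤ Z := Real.sqrt_nonneg _
  have h3 : eLpNorm (fld v) 3 (volume.restrict Ω) ≤ ENNReal.ofReal Z :=
    eLpNorm_three_le (by positivity) (hS.six v)
  have key := conv_add_conv_of_isTestField hS hΩ u v w hφ hv hψ hw
  have h1 : |conv u w v| ≤ d * (S * gradNorm u * gradNorm w * Z) :=
    (triInt_bound_mid holderTriple_six_three (by positivity) hw0 hZ0 (hS.six u)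
      (norm_pd_le_gradNorm w) h3).2
  have h2 : |∫ x in Ω, ⟪φ x, ψ x⟫ * divL u x| ≤ d * gradNorm u * (S * gradNorm w * Z) := by
    rw [← Real.norm_eq_abs, ← ENNReal.ofReal_le_ofReal_iff (by positivity), ofReal_norm]
    refine (enorm_integral_le_lintegral_enorm _).trans ?_
    calc ∫⁻ x in Ω, ‖⟪φ x, ψ x⟫ * divL u x‖ₑ
        ≤ ∫⁻ x in Ω, ‖divL u x‖ₑ * (‖fld w x‖ₑ * ‖fld v x‖ₑ) := by
          refine lintegral_mono_ae ?_
          filter_upwards [hv, hw] with x h1 h2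
          rw [h1, h2, enorm_mul, mul_comm]
          gcongr
          rw [← enorm_norm (φ x), ← enorm_norm (ψ x), ← enorm_mul]
          refine enorm_le_iff_norm_le.2 ?_
          rw [norm_mul, norm_norm, norm_norm, mul_comm]
          exact norm_inner_le_norm _ _
      _ ≤ _ := lintegral_mul_mul_le (Lp.aestronglyMeasurable _) (Lp.aestronglyMeasurable _)
          (Lp.aestronglyMeasurable _) holderTriple_six_three
      _ ≤ ENNReal.ofReal (d * gradNorm u) * (ENNReal.ofReal (S * gradNorm w) *
            ENNReal.ofReal Z) := by
          gcongr
          · rw [← Lp.enorm_def, ← ofReal_norm]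
            exact ENNReal.ofReal_le_ofReal (norm_divL_le u)
          · exact hS.six w
      _ = _ := by rw [ofReal_mul_mul (by positivity) (by positivity), mul_assoc]
  -- only `v` without derivatives is left in the trilinear form
  have e : b u v w = -conv u w v - 1 / 2 * ∫ x in Ω, ⟪φ x, ψ x⟫ * divL u x := by
    rw [b]; linarith
  obtain ⟨Y, hY⟩ : ∃ Y, Y = d * S * gradNorm u * Z * gradNorm w := ⟨_, rfl⟩
  have hY0 : 0 ≤ Y := by rw [hY]; positivity
  have h1' : |conv u w v| ≤ Y := h1.trans_eq (by rw [hY]; ring)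
  have h2' : |∫ x in Ω, ⟪φ x, ψ x⟫ * divL u x| ≤ Y := h2.trans_eq (by rw [hY]; ring)
  have hgoal : 2 * d * S * gradNorm u * Z * gradNorm w = 2 * Y := by rw [hY]; ring
  rw [hgoal, e]
  have h3' := abs_le.1 h1'
  have h4' := abs_le.1 h2'
  exact abs_le.2 ⟨by linarith, by linarith⟩

/-- The mean value of the divergence of an element of `X` is zero. -/
theorem integral_divL (hΩ : IsOpen Ω) (hΩb : Bornology.IsBounded Ω) (v : X Ω) :
    ∫ x in Ω, divL v x = 0 := by
  have : IsFiniteMeasure (volume.restrict Ω) :=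
    ⟨by rw [Measure.restrict_apply_univ]; exact hΩb.measure_lt_top⟩
  have hcont : Continuous fun v : X Ω => ∫ x in Ω, divL v x := by
    have h1 : ∀ v : X Ω, ∫ x in Ω, divL v x
        = ⟪indicatorConstLp 2 MeasurableSet.univ (measure_ne_top (volume.restrict Ω) univ) (1 : ℝ),
          divL v⟫ := fun v => by
      rw [L2.inner_indicatorConstLp_one]
      simp
    simp_rw [h1]
    exact continuous_const.inner divL.continuous
  refine X.induction (P := fun v => ∫ x in Ω, divL v x = 0)
    (isClosed_eq hcont continuous_const) ?_ v
  intro v φ hφ hv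
  have hD : ∀ i : Fin d, Continuous fun x => fderiv ℝ φ x (EuclideanSpace.single i (1 : ℝ)) :=
    fun i => (hφ.1.continuous_fderiv (by simp)).clm_apply continuous_const
  have hDs : ∀ i : Fin d, HasCompactSupport
      fun x => fderiv ℝ φ x (EuclideanSpace.single i (1 : ℝ)) := fun i => hφ.2.1.fderiv_apply _ _
  have hDi : ∀ i : Fin d, Integrable fun x => fderiv ℝ φ x (EuclideanSpace.single i (1 : ℝ)) :=
    fun i => (hD i).integrable_of_hasCompactSupport (hDs i)
  have h0 : ∀ i : Fin d, ∫ x, fderiv ℝ φ x (EuclideanSpace.single i (1 : ℝ)) = 0 := by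
    intro i
    have := integral_smul_fderiv_eq_neg_fderiv_smul_of_integrable (μ := volume)
      (f := fun _ : EuclideanSpace ℝ (Fin d) => (1 : ℝ))
      (g := φ) (v := EuclideanSpace.single i 1) (by simp) (by simpa using hDi i)
      (by simpa using hφ.1.continuous.integrable_of_hasCompactSupport hφ.2.1)
      (fun x _ => differentiableAt_const _)
      (fun x _ => (hφ.1.differentiable (by simp)).differentiableAt)
    simpa using this
  have e1 : ∫ x in Ω, divL v x
      = ∫ x in Ω, ∑ i, (fderiv ℝ φ x (EuclideanSpace.single i (1 : ℝ))) i := by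
    refine integral_congr_ae ?_
    filter_upwards [coeFn_divL v, ae_all_iff.2 fun i => pd_ae_eq_fderiv hΩ hφ hv i] with x h1 h2
    rw [h1]
    simp only [h2]
  rw [e1, setIntegral_eq_integral_of_forall_compl_eq_zero, integral_finsetSum]
  · refine Finset.sum_eq_zero fun i _ => ?_
    have := (EuclideanSpace.proj (𝕜 := ℝ) i).integral_comp_comm (hDi i)
    rw [h0 i] at this
    simpa using this
  · exact fun i _ => (EuclideanSpace.proj (𝕜 := ℝ) i).integrable_comp (hDi i)
  · intro x hx
    have : fderiv ℝ φ x = 0 := by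
      have h2 : x ∉ tsupport φ := fun h => hx (hφ.2.2 h)
      exact image_eq_zero_of_notMem_tsupport fun h => h2 (tsupport_fderiv_subset ℝ h)
    simp [this]

/-- For an exactly divergence-free velocity the convective form is already skew-symmetric. -/
theorem SobolevBounds.conv_eq_b {S : ℝ} (hS : SobolevBounds Ω S) (hΩ : IsOpen Ω)
    (hΩb : Bornology.IsBounded Ω) {u : X Ω} (hu : u ∈ V Ω) (v w : X Ω) :
    conv u v w = b u v w := by
  have : IsFiniteMeasure (volume.restrict Ω) :=
    ⟨by rw [Measure.restrict_apply_univ]; exact hΩb.measure_lt_top⟩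
  suffices h : conv u v w + conv u w v = 0 by rw [b]; linarith
  refine X.induction (P := fun v => conv u v w + conv u w v = 0) (isClosed_eq
    ((hS.continuous_conv_mid u w).add (hS.continuous_conv_right u w)) continuous_const) ?_ v
  intro v φ hφ hv
  refine X.induction (P := fun w => conv u v w + conv u w v = 0) (isClosed_eq
    ((hS.continuous_conv_right u v).add (hS.continuous_conv_mid u v)) continuous_const) ?_ w
  intro w ψ hψ hw
  rw [conv_add_conv_of_isTestField hS hΩ u v w hφ hv hψ hw, neg_eq_zero]
  have hχc : Continuous fun x => ⟪φ x, ψ x⟫ := hφ.1.continuous.inner hψ.1.continuous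
  have hχs : HasCompactSupport fun x => ⟪φ x, ψ x⟫ := hφ.2.1.mono (by
    intro x hx h
    exact hx (by simp [h]))
  have hχi : Integrable (fun x => ⟪φ x, ψ x⟫) (volume.restrict Ω) :=
    (hχc.integrable_of_hasCompactSupport hχs).restrict
  have hdi : Integrable (divL u) (volume.restrict Ω) :=
    (Lp.memLp (divL u)).integrable (by norm_num)
  -- subtract the mean value, which does not change the pairing with the divergence
  set m : ℝ := (∫ x in Ω, ⟪φ x, ψ x⟫) / (volume.restrict Ω).real univ with hm
  have hq2 : MemLp (fun x => ⟪φ x, ψ x⟫ - m) 2 (volume.restrict Ω) :=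
    (hχc.memLp_of_hasCompactSupport hχs).sub (memLp_const m)
  obtain ⟨q, hqe⟩ : ∃ q : L2 Ω ℝ, q =ᵐ[volume.restrict Ω] fun x => ⟪φ x, ψ x⟫ - m :=
    ⟨hq2.toLp, hq2.coeFn_toLp⟩
  have hq : q ∈ Q Ω := by
    rw [Q, mem_ofPred_eq, integral_congr_ae hqe,
      integral_sub hχi (integrable_const m), integral_const, smul_eq_mul]
    by_cases h : (volume.restrict Ω).real univ = 0
    · have h' : volume.restrict Ω = 0 := by
        rw [measureReal_def, ENNReal.toReal_eq_zero_iff] at h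
        exact Measure.measure_univ_eq_zero.1 (h.resolve_right (measure_ne_top _ _))
      simp [h']
    · rw [hm]
      field_simp
      ring
  have h1 := hu _ hq
  rw [divPair_eq_inner, L2.inner_def] at h1
  have h2 : ∫ x in Ω, ⟪q x, divL u x⟫
      = ∫ x in Ω, (⟪φ x, ψ x⟫ * divL u x - m * divL u x) := by
    refine integral_congr_ae ?_
    filter_upwards [hqe] with x hx
    rw [hx]
    simp only [RCLike.inner_apply, conj_trivial]
    ring
  have hi : Integrable (fun x => ⟪φ x, ψ x⟫ * divL u x) (volume.restrict Ω) :=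
    integrable_smul_test Ω ℝ hχc hχs (divL u)
  rw [h2, integral_sub hi (hdi.const_mul m),
    integral_const_mul, integral_divL hΩ hΩb, mul_zero, sub_zero] at h1
  exact h1

end

/-! ### The discrete inf-sup condition and the projection -/

section

variable {E F : Type*} [NormedAddCommGroup E] [InnerProductSpace ℝ E]
  [NormedAddCommGroup F] [InnerProductSpace ℝ F]

/-- A discrete inf-sup condition with constant `c / S` makes `D : A → B'` surjective with a right
inverse of norm at most `S / c`. The preimages are taken in the range of the adjoint `D' : B → A`,
on which `D` is an isomorphism onto `B`. -/
theorem exists_preimage_of_infsup (D : E →L[ℝ] F) (A : Submodule ℝ E) (B : Submodule ℝ F)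
    [FiniteDimensional ℝ A] [FiniteDimensional ℝ B] {c S : ℝ} (hc : 0 < c) (hS : 0 ≤ S)
    (hbelow : ∀ q ∈ B, ∀ K, 0 ≤ K → (∀ w ∈ A, ⟪q, D w⟫ ≤ K * ‖w‖) → c * ‖q‖ ≤ S * K) (g : F) :
    ∃ w ∈ A, (∀ q ∈ B, ⟪q, D w⟫ = ⟪q, g⟫) ∧
      ∀ M, 0 ≤ M → (∀ q ∈ B, ⟪q, g⟫ ≤ ‖q‖ * M) → c * ‖w‖ ≤ S * M := by
  set T : A →L[ℝ] B := B.orthogonalProjectionOnto ∘L D ∘L A.subtypeL with hT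
  have hTi : ∀ (q : B) (w : A), ⟪q, T w⟫ = ⟪(q : F), D w⟫ := by
    intro q w
    rw [← Submodule.inner_orthogonalProjectionOnto_eq_of_mem_left]
    rfl
  set T' : B →L[ℝ] A := ContinuousLinearMap.adjoint T with hT'
  have hTi' : ∀ (q : B) (w : A), ⟪T' q, w⟫ = ⟪(q : F), D w⟫ := by
    intro q w
    rw [hT', ContinuousLinearMap.adjoint_inner_left, hTi]
  have hb : ∀ q : B, c * ‖q‖ ≤ S * ‖T' q‖ := fun q =>
    hbelow q q.2 _ (norm_nonneg _) fun w hw => by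
      rw [← hTi' q ⟨w, hw⟩]
      exact real_inner_le_norm _ _
  have hsurj : Function.Surjective (T ∘L T').toLinearMap := by
    rw [← LinearMap.injective_iff_surjective, ← LinearMap.ker_eq_bot, LinearMap.ker_eq_bot']
    intro q hq
    have h1 : ‖T' q‖ ^ 2 = 0 := by
      rw [← real_inner_self_eq_norm_sq, hTi', ← hTi]
      have : T (T' q) = 0 := hq
      rw [this, inner_zero_right]
    have h2 := hb q
    rw [pow_eq_zero_iff two_ne_zero] at h1
    rw [h1, mul_zero] at h2
    exact norm_le_zero_iff.1 (nonpos_of_mul_nonpos_right h2 hc)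
  obtain ⟨q, hq⟩ := hsurj (B.orthogonalProjectionOnto g)
  have hq' : T (T' q) = B.orthogonalProjectionOnto g := hq
  have key : ∀ p : B, ⟪(p : F), D (T' q)⟫ = ⟪(p : F), g⟫ := by
    intro p
    rw [← hTi, hq', ← Submodule.inner_orthogonalProjectionOnto_eq_of_mem_left]
  refine ⟨T' q, (T' q).2, fun p hp => key ⟨p, hp⟩, fun M hM hg => ?_⟩
  have h1 : ‖T' q‖ ^ 2 ≤ ‖q‖ * M := by
    rw [← real_inner_self_eq_norm_sq, hTi', key]
    exact hg q q.2
  rcases (norm_nonneg (T' q)).eq_or_lt with h0 | h0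
  · have h5 : ‖((T' q : A) : E)‖ = 0 := h0.symm
    rw [h5, mul_zero]
    exact mul_nonneg hS hM
  · refine le_of_mul_le_mul_right ?_ h0
    calc c * ‖T' q‖ * ‖T' q‖ = c * ‖T' q‖ ^ 2 := by ring
      _ ≤ c * (‖q‖ * M) := by gcongr
      _ = c * ‖q‖ * M := by ring
      _ ≤ S * ‖T' q‖ * M := mul_le_mul_of_nonneg_right (hb q) hM
      _ = _ := by ring

/-- The orthogonal projection as a linear map of `E`, with the best approximation property stated
elementwise. -/
theorem exists_orthogonal_projection (A : Submodule ℝ E) [FiniteDimensional ℝ A] :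
    ∃ P : E →ₗ[ℝ] E, (∀ v, P v ∈ A) ∧ (∀ v, ‖P v‖ ≤ ‖v‖) ∧
      ∀ v, ∀ w ∈ A, ‖v - P v‖ ≤ ‖v - w‖ := by
  refine ⟨A.starProjection.toLinearMap, fun v => Submodule.starProjection_apply_mem _ v,
    fun v => Submodule.norm_starProjection_apply_le _ v, fun v w hw => ?_⟩
  have h := Submodule.starProjection_minimal (U := A) v
  change ‖v - A.starProjection v‖ ≤ _
  rw [h]
  exact ciInf_le ⟨0, by rintro _ ⟨x, rfl⟩; exact norm_nonneg _⟩ (⟨w, hw⟩ : A)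

end

section

variable {d : ℕ} {Ω : Set (EuclideanSpace ℝ (Fin d))}

/-- The discretely divergence-free part of `Xh`. -/
def discreteV (Xh : Submodule ℝ (X Ω)) (Qh : Submodule ℝ (L2 Ω ℝ)) : Submodule ℝ (X Ω) :=
  Xh ⊓ (Qhᗮ).comap (divL : X Ω →L[ℝ] L2 Ω ℝ).toLinearMap

theorem mem_discreteV {Xh : Submodule ℝ (X Ω)} {Qh : Submodule ℝ (L2 Ω ℝ)} {v : X Ω} :
    v ∈ discreteV Xh Qh ↔ v ∈ Xh ∧ ∀ q ∈ Qh, divPair q v = 0 := by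
  simp only [discreteV, Submodule.mem_inf, Submodule.mem_comap, Submodule.mem_orthogonal,
    divPair_eq_inner]
  rfl

/-- The discrete inf-sup condition provides a bounded right inverse of the discrete divergence. -/
theorem IsFEPair.exists_correction {r s : ℕ} {Capp Cinv Cis h S : ℝ} {Xh : Submodule ℝ (X Ω)}
    {Qh : Submodule ℝ (L2 Ω ℝ)} (hfe : IsFEPair r s Capp Cinv Cis h Xh Qh)
    (hS : SobolevBounds Ω S) (hc : 0 < Cis) {v vh : X Ω} (hv : v ∈ V Ω) :
    ∃ w ∈ Xh, (∀ q ∈ Qh, divPair q w = divPair q vh) ∧ ‖w‖ ≤ d * S / Cis * ‖v - vh‖ := by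
  have := hfe.finX
  have := hfe.finQ
  have hbelow : ∀ q ∈ Qh, ∀ K, 0 ≤ K → (∀ w ∈ Xh, ⟪q, divL w⟫ ≤ K * ‖w‖) →
      Cis * ‖q‖ ≤ S * K := by
    intro q hq K hK hKw
    refine (hfe.infsup q hq).trans (ciSup_le fun w => ?_)
    -- for `w = 0` the quotient in the inf-sup condition is `0 / 0 = 0`
    rcases (gradNorm_nonneg (w : X Ω)).eq_or_lt with h0 | h0
    · rw [← h0, div_zero]
      exact mul_nonneg hS.nonneg hK
    · rw [div_le_iff₀ h0, divPair_eq_inner]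
      calc ⟪q, divL (w : X Ω)⟫ ≤ K * ‖(w : X Ω)‖ := hKw w w.2
        _ ≤ K * (S * gradNorm (w : X Ω)) := by
            gcongr
            exact hS.norm_le w
        _ = _ := by ring
  obtain ⟨w, hw, hwq, hwM⟩ :=
    exists_preimage_of_infsup (E := X Ω) divL Xh Qh hc hS.nonneg hbelow (divL vh)
  refine ⟨w, hw, fun q hq => ?_, ?_⟩
  · rw [divPair_eq_inner, divPair_eq_inner, hwq q hq]
  · have h1 : Cis * ‖w‖ ≤ S * (d * ‖v - vh‖) := by
      refine hwM _ (by positivity) fun q hq => ?_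
      have h4 := hv q (hfe.subQ q hq)
      rw [divPair_eq_inner] at h4
      have h3 : ⟪q, divL vh⟫ = -⟪q, divL (v - vh)⟫ := by
        rw [map_sub, inner_sub_right, h4]
        ring
      rw [h3, ← divPair_eq_inner]
      refine (neg_le_abs _).trans ((abs_divPair_le _ _).trans ?_)
      calc d * ‖q‖ * gradNorm (v - vh) ≤ d * ‖q‖ * ‖v - vh‖ := by
            gcongr
            exact gradNorm_le_norm _
        _ = _ := by ring
    rw [div_mul_eq_mul_div, le_div_iff₀ hc]
    linarith

/-- `P` is the `H¹`-orthogonal projection onto the discretely divergence-free functions. -/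
structure IsProj (Xh : Submodule ℝ (X Ω)) (Qh : Submodule ℝ (L2 Ω ℝ)) (P : X Ω →ₗ[ℝ] X Ω) :
    Prop where
  mem : ∀ v, P v ∈ discreteV Xh Qh
  norm_le : ∀ v, ‖P v‖ ≤ ‖v‖
  best : ∀ v, ∀ w ∈ discreteV Xh Qh, ‖v - P v‖ ≤ ‖v - w‖

theorem exists_isProj (Xh : Submodule ℝ (X Ω)) (Qh : Submodule ℝ (L2 Ω ℝ))
    [FiniteDimensional ℝ Xh] : ∃ P, IsProj Xh Qh P := by
  have : FiniteDimensional ℝ (discreteV Xh Qh) :=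
    Submodule.finiteDimensional_of_le (inf_le_left : discreteV Xh Qh ≤ Xh)
  obtain ⟨P, h1, h2, h3⟩ := exists_orthogonal_projection (E := X Ω) (discreteV Xh Qh)
  exact ⟨P, h1, h2, h3⟩

theorem Hs.seminorm_nonneg {F : Type} [NormedAddCommGroup F] [InnerProductSpace ℝ F] {ℓ : ℕ}
    (w : Hs Ω F ℓ) : 0 ≤ Hs.seminorm w := Real.sqrt_nonneg _

/-- On `V`, the approximation properties of the discretely divergence-free functions are as good as
those of the whole of `Xh`: an approximation in `Xh` is corrected by `IsFEPair.exists_correction`.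
The constant `Capp` is not assumed to be nonnegative, hence the absolute value. -/
theorem IsFEPair.norm_sub_proj_le {r s : ℕ} {Capp Cinv Cis h S : ℝ} {Xh : Submodule ℝ (X Ω)}
    {Qh : Submodule ℝ (L2 Ω ℝ)} (hfe : IsFEPair r s Capp Cinv Cis h Xh Qh)
    {P : X Ω →ₗ[ℝ] X Ω} (hP : IsProj Xh Qh P) (hS : SobolevBounds Ω S) (hc : 0 < Cis)
    (hh : 0 < h) {v : X Ω} (hv : v ∈ V Ω)
    (U : Hs Ω (EuclideanSpace ℝ (Fin d)) (r + 1)) (hU : Hs.toL2 U = fld v) :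
    ‖v - P v‖ ≤ (1 + d * S / Cis) * |Capp| * h ^ r * ‖U‖ := by
  have hpos : 0 < 1 + d * S / Cis := by
    have := hS.nonneg
    positivity
  have h1 : ‖v - P v‖ / (1 + d * S / Cis) ≤ ⨅ vh : Xh, ‖v - (vh : X Ω)‖ := by
    refine le_ciInf fun vh => ?_
    obtain ⟨w, hw, hwq, hwn⟩ := hfe.exists_correction hS hc (vh := vh) hv
    rw [div_le_iff₀ hpos]
    have hmem : (vh : X Ω) - w ∈ discreteV Xh Qh := by
      refine mem_discreteV.2 ⟨Xh.sub_mem vh.2 hw, fun q hq => ?_⟩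
      have := hwq q hq
      rw [divPair_eq_inner, divPair_eq_inner] at this
      rw [divPair_eq_inner, map_sub, inner_sub_right, this, sub_self]
    refine (hP.best v _ hmem).trans ?_
    calc ‖v - ((vh : X Ω) - w)‖ = ‖(v - vh) + w‖ := by congr 1; abel
      _ ≤ ‖v - vh‖ + d * S / Cis * ‖v - vh‖ := (norm_add_le _ _).trans (add_le_add le_rfl hwn)
      _ = _ := by ring
  rw [div_le_iff₀ hpos] at h1
  have h2 : (⨅ vh : Xh, ‖v - (vh : X Ω)‖) ≤ |Capp| * h ^ r * ‖U‖ := by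
    refine (hfe.approxX_one v U hU).trans ?_
    have h3 := Hs.seminorm_le_norm U
    have h4 := Hs.seminorm_nonneg U
    gcongr
    exact le_abs_self _
  calc _ ≤ _ := h1
    _ ≤ |Capp| * h ^ r * ‖U‖ * (1 + d * S / Cis) := by gcongr
    _ = _ := by ring

theorem IsFEPair.iInf_norm_sub_pressure_le {r s : ℕ} {Capp Cinv Cis h : ℝ}
    {Xh : Submodule ℝ (X Ω)} {Qh : Submodule ℝ (L2 Ω ℝ)}
    (hfe : IsFEPair r s Capp Cinv Cis h Xh Qh) (hh : 0 < h) (w : Hs Ω ℝ (s + 1))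
    (hw : Hs.toL2 w ∈ Q Ω) :
    ⨅ qh : Qh, ‖Hs.toL2 w - (qh : L2 Ω ℝ)‖ ≤ |Capp| * h ^ (s + 1) * ‖w‖ := by
  refine (hfe.approxQ w hw).trans ?_
  have h3 := Hs.seminorm_le_norm w
  have h4 := Hs.seminorm_nonneg w
  gcongr
  exact le_abs_self _

/-- A pressure acts on discretely divergence-free functions like its best-approximation error. -/
theorem IsFEPair.abs_divPair_le {r s : ℕ} {Capp Cinv Cis h : ℝ}
    {Xh : Submodule ℝ (X Ω)} {Qh : Submodule ℝ (L2 Ω ℝ)}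
    (hfe : IsFEPair r s Capp Cinv Cis h Xh Qh) (hh : 0 < h) {p : L2 Ω ℝ} (w : Hs Ω ℝ (s + 1))
    (hpw : Hs.toL2 w = p) (hp : p ∈ Q Ω) {v : X Ω} (hv : v ∈ discreteV Xh Qh) :
    |divPair p v| ≤ d * (|Capp| * h ^ (s + 1) * ‖w‖) * gradNorm v := by
  subst hpw
  have h1 : |divPair (Hs.toL2 w) v| ≤ (⨅ qh : Qh, ‖Hs.toL2 w - (qh : L2 Ω ℝ)‖)
      * (d * gradNorm v) := by
    rw [Real.iInf_mul_of_nonneg (mul_nonneg (Nat.cast_nonneg _) (gradNorm_nonneg v))]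
    refine le_ciInf fun q => ?_
    have h2 := (mem_discreteV.1 hv).2 q q.2
    have h3 : divPair (Hs.toL2 w) v = divPair (Hs.toL2 w - (q : L2 Ω ℝ)) v := by
      rw [divPair_eq_inner] at h2 ⊢
      rw [divPair_eq_inner, inner_sub_left, h2, sub_zero]
    rw [h3]
    refine (DLN.abs_divPair_le _ _).trans (le_of_eq (by ring))
  refine h1.trans ?_
  have := hfe.iInf_norm_sub_pressure_le hh w hp
  have hg := gradNorm_nonneg v
  calc _ ≤ |Capp| * h ^ (s + 1) * ‖w‖ * (d * gradNorm v) := by gcongr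
    _ = _ := by ring

end

/-! ### Algebra of the DLN coefficients -/

section

variable {θ : ℝ} {t : ℕ → ℝ} {n : ℕ}

theorem abs_eps_lt_one (hk : 0 < step t n) (hl : 0 < step t (n - 1)) : |eps t n| < 1 := by
  rw [eps, abs_div, abs_of_pos (add_pos hk hl), div_lt_one (add_pos hk hl), abs_sub_lt_iff]
  constructor <;> linarith

theorem beta_sum (θ ε : ℝ) : beta2 θ ε + beta1 θ ε + beta0 θ ε = 1 := by
  rw [beta2, beta1, beta0]
  ring

theorem one_add_mul_pos (hθ : θ ∈ Ioo (0 : ℝ) 1) {ε : ℝ} (hε : |ε| < 1) :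
    1 - θ < 1 + ε * θ ∧ 1 + ε * θ < 1 + θ := by
  rw [abs_lt] at hε
  constructor <;> nlinarith [hθ.1, hε.1, hε.2]

/-- The coefficients `β` are bounded in terms of `θ` alone. -/
theorem abs_beta_le (hθ : θ ∈ Ioo (0 : ℝ) 1) {ε : ℝ} (hε : |ε| < 1) :
    0 ≤ beta2 θ ε ∧ |beta2 θ ε| ≤ 2 / (1 - θ) ∧ |beta1 θ ε| ≤ 2 / (1 - θ) ∧
      |beta0 θ ε| ≤ 2 / (1 - θ) := by
  have h1 : 0 < 1 - θ := by linarith [hθ.2]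
  have h2 := (one_add_mul_pos hθ hε).1
  set x := (1 - θ ^ 2) / (1 + ε * θ) ^ 2 with hx
  have hx0 : 0 ≤ x := div_nonneg (by nlinarith [hθ.1]) (sq_nonneg _)
  have hx1 : x ≤ 2 / (1 - θ) := by
    have h3 : 0 < 1 + ε * θ := h1.trans h2
    rw [hx, div_le_div_iff₀ (by positivity) h1]
    nlinarith [hθ.1, mul_pos h1 h1, mul_pos h1 (sub_pos.2 h2)]
  have hb : 2 ≤ 2 / (1 - θ) := by
    rw [le_div_iff₀ h1]
    linarith [hθ.1]
  have e2 : beta2 θ ε = 1 / 4 * (1 + x + ε ^ 2 * θ * x + θ) := by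
    rw [beta2, hx]
    ring
  have e1 : beta1 θ ε = 1 / 2 * (1 - x) := by rw [beta1, hx]
  have e0 : beta0 θ ε = 1 / 4 * (1 + x - ε ^ 2 * θ * x - θ) := by
    rw [beta0, hx]
    ring
  have hε2 : ε ^ 2 ≤ 1 := by
    rw [← sq_abs]
    exact pow_le_one₀ (abs_nonneg _) hε.le
  have hy0 : 0 ≤ ε ^ 2 * θ * x := mul_nonneg (mul_nonneg (sq_nonneg _) hθ.1.le) hx0
  have hy1 : ε ^ 2 * θ * x ≤ 1 * x :=
    mul_le_mul_of_nonneg_right (mul_le_one₀ hε2 hθ.1.le hθ.2.le) hx0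
  have h0 := hθ.1
  rw [e2, e1, e0, abs_le, abs_le, abs_le]
  refine ⟨by linarith, ⟨by linarith, by linarith⟩, ⟨by linarith, by linarith⟩,
    ⟨by linarith, by linarith⟩⟩

theorem khat_bounds (hθ : θ ∈ Ioo (0 : ℝ) 1) (hk : 0 < step t n) (hl : 0 < step t (n - 1)) :
    (1 - θ) / 2 * (step t n + step t (n - 1)) ≤ khat θ t n ∧
      khat θ t n ≤ step t n + step t (n - 1) ∧ 0 < khat θ t n := by
  have h0 := hθ.1
  have h1 := hθ.2
  rw [khat, alpha2, alpha0]
  refine ⟨by nlinarith, by nlinarith, by nlinarith⟩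

/-- The step ratios in terms of the step variability. -/
theorem eps_eq (hk : 0 < step t n) (hl : 0 < step t (n - 1)) :
    1 - eps t n = 2 * step t (n - 1) / (step t n + step t (n - 1)) ∧
      1 + step t n / step t (n - 1) = 2 / (1 - eps t n) ∧
      step t n / step t (n - 1) = (1 + eps t n) / (1 - eps t n) := by
  have h1 : 1 - eps t n = 2 * step t (n - 1) / (step t n + step t (n - 1)) := by
    rw [eps]
    field_simp
    ring
  have h2 : 1 + eps t n = 2 * step t n / (step t n + step t (n - 1)) := by
    rw [eps]
    field_simp
    ring
  refine ⟨h1, ?_, ?_⟩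
  · rw [h1]
    field_simp
    ring
  · rw [h1, h2]
    field_simp

/-- The scheme is of second order: with `τ = t_{n,β}`, the combination `α` annihilates
`(s - τ)²`. -/
theorem alpha_sq_moment (hθ : θ ∈ Ioo (0 : ℝ) 1) (hk : 0 < step t n) (hl : 0 < step t (n - 1)) :
    alpha2 θ * step t n ^ 2 + alpha0 θ * step t (n - 1) ^ 2
      = 2 * khat θ t n * (beta2 θ (eps t n) * step t n - beta0 θ (eps t n) * step t (n - 1)) := by
  have h := (one_add_mul_pos hθ (abs_eps_lt_one hk hl)).1
  have h1 := hθ.2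
  have hKne : step t n + step t (n - 1) ≠ 0 := (add_pos hk hl).ne'
  set K := step t n + step t (n - 1) with hK
  set ε := eps t n with hε
  have hk' : step t n = K / 2 * (1 + ε) := by
    rw [hε, eps, ← hK]
    field_simp
    rw [hK]
    ring
  have hl' : step t (n - 1) = K / 2 * (1 - ε) := by
    rw [hε, eps, ← hK]
    field_simp
    rw [hK]
    ring
  have hne : 1 + ε * θ ≠ 0 := by linarith
  rw [khat, hk', hl', alpha2, alpha0, beta2, beta0]
  clear_value ε K
  clear hk' hl' hk hl
  obtain ⟨m, hm⟩ : ∃ m, m = 1 + ε * θ := ⟨_, rfl⟩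
  rw [← hm] at hne ⊢
  field_simp
  rw [hm]
  ring

theorem tbeta_eq (hn : 1 ≤ n) : tbeta θ t n - t n
    = beta2 θ (eps t n) * step t n - beta0 θ (eps t n) * step t (n - 1) := by
  have h := beta_sum θ (eps t n)
  have h1 : beta1 θ (eps t n) = 1 - beta2 θ (eps t n) - beta0 θ (eps t n) := by linarith
  rw [tbeta, betaComb, step, step, Nat.sub_add_cancel hn, h1]
  simp only [smul_eq_mul]
  ring

/-- By `alpha_sq_moment`, `tbeta - tₙ` is `(α₂ k² + α₀ l²) / (2 (α₂ k - α₀ l))` with step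
sizes `k` and `l`, where `α₀ < 0 < α₂`, which lies between `-l` and `k`. -/
theorem tbeta_mem (hθ : θ ∈ Ioo (0 : ℝ) 1) (hn : 1 ≤ n) (hk : 0 < step t n)
    (hl : 0 < step t (n - 1)) : tbeta θ t n ∈ Ioo (t (n - 1)) (t (n + 1)) := by
  have h1 := alpha_sq_moment hθ hk hl
  rw [← tbeta_eq hn] at h1
  have h2 := (khat_bounds hθ hk hl).2.2
  have e1 : t (n + 1) = t n + step t n := by rw [step]; ring
  have e2 : t (n - 1) = t n - step t (n - 1) := by rw [step, Nat.sub_add_cancel hn]; ring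
  have ha2 : 0 < alpha2 θ := by rw [alpha2]; linarith [hθ.1]
  have ha0 : alpha0 θ < 0 := by rw [alpha0]; linarith [hθ.2]
  have e3 : khat θ t n = alpha2 θ * step t n - alpha0 θ * step t (n - 1) := rfl
  rw [e1, e2]
  constructor
  · have : 0 < 2 * khat θ t n * (tbeta θ t n - t n + step t (n - 1)) := by
      rw [mul_add, ← h1, e3]
      nlinarith [mul_pos ha2 (pow_pos hk 2), mul_pos (neg_pos.2 ha0) (pow_pos hl 2),
        mul_pos ha2 (mul_pos hk hl)]
    have := pos_of_mul_pos_right this (by positivity)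
    linarith
  · have : 0 < 2 * khat θ t n * (step t n - (tbeta θ t n - t n)) := by
      rw [mul_sub, ← h1, e3]
      nlinarith [mul_pos ha2 (pow_pos hk 2), mul_pos (neg_pos.2 ha0) (pow_pos hl 2),
        mul_pos (neg_pos.2 ha0) (mul_pos hk hl)]
    have := pos_of_mul_pos_right this (by positivity)
    linarith

end

section

variable {H : Type*} [NormedAddCommGroup H] [InnerProductSpace ℝ H]

/-- The `G`-stability identity of the DLN method. -/
theorem inner_alpha_beta {θ ε : ℝ} (hne : 1 + ε * θ ≠ 0) (x y z : H) :
    ⟪alpha2 θ • x + alpha1 θ • y + alpha0 θ • z,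
        beta2 θ ε • x + beta1 θ ε • y + beta0 θ ε • z⟫
      = ((1 + θ) / 4 * ‖x‖ ^ 2 + (1 - θ) / 4 * ‖y‖ ^ 2)
        - ((1 + θ) / 4 * ‖y‖ ^ 2 + (1 - θ) / 4 * ‖z‖ ^ 2)
        + θ * (1 - θ ^ 2) / (2 * (1 + ε * θ) ^ 2) *
          ‖((1 - ε) / 2) • x - y + ((1 + ε) / 2) • z‖ ^ 2 := by
  rw [← real_inner_self_eq_norm_sq, ← real_inner_self_eq_norm_sq, ← real_inner_self_eq_norm_sq,
    ← real_inner_self_eq_norm_sq]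
  simp only [inner_add_left, inner_add_right, inner_sub_left, inner_sub_right, inner_smul_left,
    inner_smul_right, conj_trivial]
  rw [real_inner_comm x y, real_inner_comm x z, real_inner_comm y z, alpha2, alpha1, alpha0, beta2,
    beta1, beta0]
  obtain ⟨m, hm⟩ : ∃ m, m = 1 + ε * θ := ⟨_, rfl⟩
  rw [← hm] at hne ⊢
  field_simp
  rw [hm]
  ring

end

section

variable {M : Type} [AddCommGroup M] [Module ℝ M] {θ : ℝ} {t : ℕ → ℝ} {n : ℕ}

/-- Interpolation and extrapolation differ by a multiple of the numerical dissipation of the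
`G`-stability identity. -/
theorem betaComb_sub_starComb (hk : 0 < step t n) (hl : 0 < step t (n - 1)) (z : ℕ → M) :
    betaComb θ t z n - starComb θ t z n = (2 * beta2 θ (eps t n) / (1 - eps t n)) •
      (((1 - eps t n) / 2) • z (n + 1) - z n + ((1 + eps t n) / 2) • z (n - 1)) := by
  have hne : 1 - eps t n ≠ 0 := by
    have := abs_lt.1 (abs_eps_lt_one hk hl)
    linarith [this.2]
  obtain ⟨-, h1, h2⟩ := eps_eq hk hl
  rw [betaComb, starComb, h1, h2]
  match_scalars <;> field_simp <;> ring

end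

section

variable {T : ℝ} {N : ℕ} {t : ℕ → ℝ}

theorem IsGrid.step_pos (hg : IsGrid T N t) {n : ℕ} (hn : n + 1 ≤ N) : 0 < step t n :=
  sub_pos.2 (hg.lt n hn)

theorem IsGrid.le (hg : IsGrid T N t) {m n : ℕ} (hmn : m ≤ n) (hn : n ≤ N) : t m ≤ t n := by
  induction n, hmn using Nat.le_induction with
  | base => exact le_rfl
  | succ n _ ih => exact (ih (by omega)).trans (hg.lt n hn).le

theorem IsGrid.mem_Icc (hg : IsGrid T N t) {n : ℕ} (hn : n ≤ N) : t n ∈ Icc 0 T :=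
  ⟨hg.start ▸ hg.le (Nat.zero_le n) hn, hg.finish ▸ hg.le hn le_rfl⟩

theorem IsGrid.step_le_stepMax {n : ℕ} (hn : n + 1 ≤ N) : step t n ≤ stepMax t N :=
  le_ciSup (f := fun n : Fin N => step t n) (finite_range _).bddAbove ⟨n, hn⟩

theorem IsGrid.tbeta_mem_Ioo (hg : IsGrid T N t) {θ : ℝ} (hθ : θ ∈ Ioo (0 : ℝ) 1) {n : ℕ}
    (hn : 1 ≤ n) (hnN : n + 1 ≤ N) : tbeta θ t n ∈ Ioo 0 T := by
  have h := tbeta_mem hθ hn (hg.step_pos hnN) (hg.step_pos (by omega : n - 1 + 1 ≤ N))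
  exact ⟨(hg.mem_Icc (by omega)).1.trans_lt h.1, h.2.trans_le (hg.mem_Icc hnN).2⟩

/-- The double steps cover the time interval at most twice. -/
theorem IsGrid.sum_step (hg : IsGrid T N t) :
    ∑ n ∈ Finset.Ico 1 N, (step t n + step t (n - 1)) ≤ 2 * T := by
  have h1 : ∑ n ∈ Finset.range N, step t n = T := by
    rw [← hg.finish, ← sub_zero (t N), ← hg.start]
    exact Finset.sum_range_sub t N
  have h2 : ∑ n ∈ Finset.Ico 1 N, step t n ≤ ∑ n ∈ Finset.range N, step t n :=
    Finset.sum_le_sum_of_subset_of_nonneg (fun n hn => by simp at hn ⊢; omega)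
      fun n hn _ => (hg.step_pos (Finset.mem_range.1 hn)).le
  have h3 : ∑ n ∈ Finset.Ico 1 N, step t (n - 1) ≤ ∑ n ∈ Finset.range N, step t n := by
    rw [Finset.sum_Ico_eq_sum_range]
    simp only [Nat.add_sub_cancel_left]
    exact Finset.sum_le_sum_of_subset_of_nonneg (fun n hn => by simp at hn ⊢; omega)
      fun n hn _ => (hg.step_pos (Finset.mem_range.1 hn)).le
  rw [Finset.sum_add_distrib]
  linarith

end

/-! ### Taylor expansions in time -/

section

variable {B : Type} [NormedAddCommGroup B] [NormedSpace ℝ B]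

/-- The Cauchy-Schwarz inequality in time. -/
theorem norm_intervalIntegral_le_sqrt {f : ℝ → B} {lo hi A a b : ℝ} (hlh : lo ≤ hi)
    (ha : a ∈ Icc lo hi) (hb : b ∈ Icc lo hi)
    (hf : AEStronglyMeasurable f (volume.restrict (Ioc lo hi)))
    (h : ∫⁻ s in Ioc lo hi, ‖f s‖ₑ ^ 2 ≤ ENNReal.ofReal A) :
    ‖∫ s in a..b, f s‖ ≤ √((hi - lo) * A) := by
  rw [intervalIntegral.norm_intervalIntegral_eq,
    ← ENNReal.ofReal_le_ofReal_iff (Real.sqrt_nonneg _), ofReal_norm]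
  have hsub : uIoc a b ⊆ Ioc lo hi := Ioc_subset_Ioc (le_min ha.1 hb.1) (max_le ha.2 hb.2)
  have h1 := ENNReal.lintegral_mul_le_Lp_mul_Lq (volume.restrict (Ioc lo hi))
    Real.HolderConjugate.two_two (f := fun s => ‖f s‖ₑ) (g := 1) hf.enorm aemeasurable_const
  simp only [Pi.mul_apply, Pi.one_apply, mul_one, lintegral_const,
    Measure.restrict_apply_univ, Real.volume_Ioc, one_pow, one_mul, ENNReal.rpow_two] at h1
  calc ‖∫ s in uIoc a b, f s‖ₑ ≤ ∫⁻ s in uIoc a b, ‖f s‖ₑ := enorm_integral_le_lintegral_enorm _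
    _ ≤ ∫⁻ s in Ioc lo hi, ‖f s‖ₑ := lintegral_mono_set hsub
    _ ≤ _ := h1
    _ ≤ ENNReal.ofReal A ^ (1 / 2 : ℝ) * ENNReal.ofReal (hi - lo) ^ (1 / 2 : ℝ) := by gcongr
    _ = ENNReal.ofReal √((hi - lo) * A) := by
        rw [mul_comm, ← ENNReal.mul_rpow_of_nonneg _ _ (by norm_num),
          ← ENNReal.ofReal_mul (sub_nonneg.2 hlh), Real.sqrt_eq_rpow]
        rcases le_total 0 ((hi - lo) * A) with hA | hA
        · rw [ENNReal.ofReal_rpow_of_nonneg hA (by norm_num)]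
        · rw [ENNReal.ofReal_of_nonpos hA, ENNReal.zero_rpow_of_pos (by norm_num),
            ← Real.sqrt_eq_rpow, Real.sqrt_eq_zero_of_nonpos hA, ENNReal.ofReal_zero]

variable {T : ℝ} {u w w' w'' : ℝ → B}

theorem IsTimeDeriv.intervalIntegrable (h : IsTimeDeriv T u w) {a b : ℝ} (ha : a ∈ Icc 0 T)
    (hb : b ∈ Icc 0 T) : IntervalIntegrable w volume a b := by
  have hT : 0 ≤ T := ha.1.trans ha.2
  refine h.1.mono_set (uIcc_subset_uIcc ?_ ?_) <;> rwa [uIcc_of_le hT]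

theorem IsTimeDeriv.sub_eq (h : IsTimeDeriv T u w) {a b : ℝ} (ha : a ∈ Icc 0 T)
    (hb : b ∈ Icc 0 T) : u b - u a = ∫ s in a..b, w s := by
  have h0 : (0 : ℝ) ∈ Icc 0 T := ⟨le_rfl, ha.1.trans ha.2⟩
  rw [h.2 b hb, h.2 a ha, add_sub_add_left_eq_sub]
  exact intervalIntegral.integral_interval_sub_left (h.intervalIntegrable h0 hb)
    (h.intervalIntegrable h0 ha)

theorem IsTimeDeriv.aestronglyMeasurable (h : IsTimeDeriv T u w) {lo hi : ℝ} (hlo : 0 ≤ lo)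
    (hhi : hi ≤ T) : AEStronglyMeasurable w (volume.restrict (Ioc lo hi)) :=
  h.1.1.aestronglyMeasurable.mono_measure
    (Measure.restrict_mono (Ioc_subset_Ioc hlo hhi) le_rfl)

theorem IsTimeDeriv.congr (h : IsTimeDeriv T u w) (hT : 0 ≤ T)
    (hw : ∀ᵐ s ∂(volume.restrict (Ioo 0 T)), w s = w' s) : IsTimeDeriv T u w' := by
  rw [restrict_Ioo_eq_restrict_Ioc] at hw
  refine ⟨h.1.congr_ae (by rwa [uIoc_of_le hT]), fun t ht => ?_⟩
  rw [h.2 t ht]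
  congr 1
  refine intervalIntegral.integral_congr_ae_restrict ?_
  rw [uIoc_of_le ht.1]
  exact ae_restrict_of_ae_restrict_of_subset (Ioc_subset_Ioc_right ht.2) hw

theorem IsTimeDeriv.map {B' : Type} [NormedAddCommGroup B'] [NormedSpace ℝ B'] [CompleteSpace B]
    [CompleteSpace B'] (L : B →L[ℝ] B') (h : IsTimeDeriv T u w) :
    IsTimeDeriv T (fun s => L (u s)) (fun s => L (w s)) := by
  refine ⟨⟨L.integrable_comp h.1.1, L.integrable_comp h.1.2⟩, fun t ht => ?_⟩
  simp only
  rw [h.2 t ht, map_add, L.intervalIntegral_comp_comm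
    (h.intervalIntegrable ⟨le_rfl, ht.1.trans ht.2⟩ ht)]

variable {lo hi A a b : ℝ}

/-- The increment of a function with time derivative in `L²`: half an order in time. -/
theorem IsTimeDeriv.norm_sub_le (hu : IsTimeDeriv T u w) (hlo : 0 ≤ lo) (hhi : hi ≤ T)
    (hA : ∫⁻ s in Ioc lo hi, ‖w s‖ₑ ^ 2 ≤ ENNReal.ofReal A) (ha : a ∈ Icc lo hi)
    (hb : b ∈ Icc lo hi) : ‖u b - u a‖ ≤ √((hi - lo) * A) := by
  rw [hu.sub_eq ⟨hlo.trans ha.1, ha.2.trans hhi⟩ ⟨hlo.trans hb.1, hb.2.trans hhi⟩]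
  exact norm_intervalIntegral_le_sqrt (ha.1.trans ha.2) ha hb (hu.aestronglyMeasurable hlo hhi) hA

theorem abs_sub_le_of_mem_uIoc {a b s : ℝ} (hs : s ∈ uIoc a b) : |s - a| ≤ |b - a| := by
  rcases le_total a b with h | h
  · rw [uIoc_of_le h] at hs
    rw [abs_of_nonneg (by linarith [hs.1]), abs_of_nonneg (by linarith)]
    linarith [hs.2]
  · rw [uIoc_of_ge h] at hs
    rw [abs_of_nonpos (by linarith [hs.2]), abs_of_nonpos (by linarith)]
    linarith [hs.1]

theorem mem_Icc_of_mem_uIoc {a b s : ℝ} (ha : a ∈ Icc lo hi) (hb : b ∈ Icc lo hi)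
    (hs : s ∈ uIoc a b) : s ∈ Icc lo hi :=
  ⟨(le_min ha.1 hb.1).trans hs.1.le, hs.2.trans (max_le ha.2 hb.2)⟩

/-- First-order Taylor expansion. -/
theorem IsTimeDeriv.taylor_one [CompleteSpace B] (hu : IsTimeDeriv T u w) (hw : IsTimeDeriv T w w')
    (hlo : 0 ≤ lo) (hhi : hi ≤ T)
    (hA : ∫⁻ s in Ioc lo hi, ‖w' s‖ₑ ^ 2 ≤ ENNReal.ofReal A) (ha : a ∈ Icc lo hi)
    (hb : b ∈ Icc lo hi) :
    ‖u b - u a - (b - a) • w a‖ ≤ √((hi - lo) * A) * |b - a| := by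
  have ha' : a ∈ Icc 0 T := ⟨hlo.trans ha.1, ha.2.trans hhi⟩
  have hb' : b ∈ Icc 0 T := ⟨hlo.trans hb.1, hb.2.trans hhi⟩
  rw [hu.sub_eq ha' hb', ← intervalIntegral.integral_const,
    ← intervalIntegral.integral_sub (hu.intervalIntegrable ha' hb') intervalIntegrable_const]
  exact intervalIntegral.norm_integral_le_of_norm_le_const fun s hs =>
    hw.norm_sub_le hlo hhi hA ha (mem_Icc_of_mem_uIoc ha hb hs)

/-- Second-order Taylor expansion. -/
theorem IsTimeDeriv.taylor_two [CompleteSpace B] (hu : IsTimeDeriv T u w) (hw : IsTimeDeriv T w w')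
    (hw' : IsTimeDeriv T w' w'') (hlo : 0 ≤ lo) (hhi : hi ≤ T)
    (hA : ∫⁻ s in Ioc lo hi, ‖w'' s‖ₑ ^ 2 ≤ ENNReal.ofReal A) (ha : a ∈ Icc lo hi)
    (hb : b ∈ Icc lo hi) :
    ‖u b - u a - (b - a) • w a - ((b - a) ^ 2 / 2) • w' a‖
      ≤ √((hi - lo) * A) * |b - a| * |b - a| := by
  have ha' : a ∈ Icc 0 T := ⟨hlo.trans ha.1, ha.2.trans hhi⟩
  have hb' : b ∈ Icc 0 T := ⟨hlo.trans hb.1, hb.2.trans hhi⟩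
  have e : ((b - a) ^ 2 / 2) • w' a = ∫ s in a..b, (s - a) • w' a := by
    rw [intervalIntegral.integral_smul_const]
    congr 1
    simp only [integral_id, intervalIntegral.integral_sub, intervalIntegral.intervalIntegrable_id,
      intervalIntegrable_const, intervalIntegral.integral_const, smul_eq_mul]
    ring
  have hc : IntervalIntegrable (fun s => (s - a) • w' a) volume a b :=
    (by fun_prop : Continuous fun s : ℝ => (s - a) • w' a).intervalIntegrable _ _
  rw [hu.sub_eq ha' hb', ← intervalIntegral.integral_const, e,
    ← intervalIntegral.integral_sub (hu.intervalIntegrable ha' hb') intervalIntegrable_const,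
    ← intervalIntegral.integral_sub
      ((hu.intervalIntegrable ha' hb').sub intervalIntegrable_const) hc]
  refine intervalIntegral.norm_integral_le_of_norm_le_const fun s hs => ?_
  refine (hw.taylor_one hw' hlo hhi hA ha (mem_Icc_of_mem_uIoc ha hb hs)).trans ?_
  exact mul_le_mul_of_nonneg_left (abs_sub_le_of_mem_uIoc hs) (Real.sqrt_nonneg _)

/-- A time derivative that takes values in a smaller space lifts the function to that space, as
soon as one of its values lies there. -/
theorem IsTimeDeriv.exists_lift {B' : Type} [NormedAddCommGroup B'] [NormedSpace ℝ B']
    [CompleteSpace B] [CompleteSpace B'] (L : B →L[ℝ] B') {f g : ℝ → B'} (h : IsTimeDeriv T f g)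
    {W : ℝ → B} (hW : IntervalIntegrable W volume 0 T)
    (hWg : ∀ᵐ s ∂(volume.restrict (Ioo 0 T)), L (W s) = g s) {t₀ : ℝ} (ht₀ : t₀ ∈ Icc 0 T)
    {F₀ : B} (hF₀ : L F₀ = f t₀) :
    ∃ F : ℝ → B, IsTimeDeriv T F W ∧ F t₀ = F₀ ∧ ∀ s ∈ Icc 0 T, L (F s) = f s := by
  have hT : 0 ≤ T := ht₀.1.trans ht₀.2
  have hi : ∀ a ∈ Icc 0 T, ∀ b ∈ Icc 0 T, IntervalIntegrable W volume a b := fun a ha b hb => by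
    refine hW.mono_set (uIcc_subset_uIcc ?_ ?_) <;> rwa [uIcc_of_le hT]
  have h0 : (0 : ℝ) ∈ Icc 0 T := ⟨le_rfl, hT⟩
  refine ⟨fun s => F₀ + ∫ x in t₀..s, W x, ⟨hW, fun s hs => ?_⟩, by simp, fun s hs => ?_⟩
  · rw [add_assoc, intervalIntegral.integral_add_adjacent_intervals (hi _ ht₀ _ h0) (hi _ h0 _ hs)]
  · rw [map_add, ← L.intervalIntegral_comp_comm (hi _ ht₀ _ hs), hF₀, eq_comm, ← sub_eq_iff_eq_add',
      h.sub_eq ht₀ hs]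
    refine intervalIntegral.integral_congr_ae_restrict ?_
    rw [restrict_Ioo_eq_restrict_Ioc] at hWg
    refine ae_restrict_of_ae_restrict_of_subset
      (Ioc_subset_Ioc (le_min ht₀.1 hs.1) (max_le ht₀.2 hs.2)) ?_
    filter_upwards [hWg] with x hx using hx.symm

end

section

variable {T : ℝ} {N : ℕ} {t : ℕ → ℝ}

/-- The intervals `(t_{n-1}, t_{n+1}]` cover `(0,T]` at most twice. -/
theorem IsGrid.sum_lintegral_le (hg : IsGrid T N t) (F : ℝ → ℝ≥0∞) :
    ∑ n ∈ Finset.Ico 1 N, ∫⁻ s in Ioc (t (n - 1)) (t (n + 1)), F s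
      ≤ 2 * ∫⁻ s in Ioo 0 T, F s := by
  have h1 : ∀ m ≤ N, ∑ n ∈ Finset.range m, ∫⁻ s in Ioc (t n) (t (n + 1)), F s
      = ∫⁻ s in Ioc 0 (t m), F s := by
    intro m hm
    induction m with
    | zero => simp [hg.start]
    | succ m ih =>
      rw [Finset.sum_range_succ, ih (by omega), ← lintegral_union measurableSet_Ioc
        (Ioc_disjoint_Ioc_of_le le_rfl), Ioc_union_Ioc_eq_Ioc (hg.mem_Icc (by omega)).1
        (hg.lt m hm).le]
  have h2 : ∀ n ∈ Finset.Ico 1 N, ∫⁻ s in Ioc (t (n - 1)) (t (n + 1)), F s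
      = (∫⁻ s in Ioc (t (n - 1)) (t (n - 1 + 1)), F s) + ∫⁻ s in Ioc (t n) (t (n + 1)), F s := by
    intro n hn
    rw [Finset.mem_Ico] at hn
    rw [Nat.sub_add_cancel hn.1, ← lintegral_union measurableSet_Ioc
      (Ioc_disjoint_Ioc_of_le le_rfl), Ioc_union_Ioc_eq_Ioc (hg.le (by omega) hn.2.le)
      (hg.lt n hn.2).le]
  rw [Finset.sum_congr rfl h2, Finset.sum_add_distrib, two_mul, restrict_Ioo_eq_restrict_Ioc]
  have h3 := h1 N le_rfl
  rw [hg.finish] at h3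
  rw [← h3]
  refine add_le_add ?_ ?_
  · rw [Finset.sum_Ico_eq_sum_range]
    simp only [Nat.add_sub_cancel_left]
    exact Finset.sum_le_sum_of_subset fun n hn => by simp at hn ⊢; omega
  · exact Finset.sum_le_sum_of_subset fun n hn => by simp at hn ⊢; omega

end

/-! ### Truncation errors -/

section

variable {B : Type} [NormedAddCommGroup B] [NormedSpace ℝ B]

/-- A combination of three values which is exact for affine functions. -/
theorem norm_comb_sub_le {c₂ c₁ c₀ s₂ s₁ s₀ τ β E : ℝ} (hsum : c₂ + c₁ + c₀ = 1)
    (hmom : c₂ * s₂ + c₁ * s₁ + c₀ * s₀ = τ) (h₂ : |c₂| ≤ β) (h₁ : |c₁| ≤ β) (h₀ : |c₀| ≤ β)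
    {x y z p q : B} (hx : ‖x - p - (s₂ - τ) • q‖ ≤ E) (hy : ‖y - p - (s₁ - τ) • q‖ ≤ E)
    (hz : ‖z - p - (s₀ - τ) • q‖ ≤ E) : ‖c₂ • x + c₁ • y + c₀ • z - p‖ ≤ 3 * β * E := by
  have e : c₂ • x + c₁ • y + c₀ • z - p = c₂ • (x - p - (s₂ - τ) • q)
      + c₁ • (y - p - (s₁ - τ) • q) + c₀ • (z - p - (s₀ - τ) • q) := by
    match_scalars
    · ring
    · ring
    · ring
    · linear_combination hsum
    · linear_combination hmom - τ * hsum
  have hβ : 0 ≤ β := (abs_nonneg _).trans h₂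
  rw [e]
  calc _ ≤ ‖c₂ • (x - p - (s₂ - τ) • q)‖ + ‖c₁ • (y - p - (s₁ - τ) • q)‖
        + ‖c₀ • (z - p - (s₀ - τ) • q)‖ := norm_add₃_le
    _ ≤ β * E + β * E + β * E := by
        rw [norm_smul, norm_smul, norm_smul]
        simp only [Real.norm_eq_abs]
        gcongr
    _ = _ := by ring

end

section

variable {d : ℕ} {Ω : Set (EuclideanSpace ℝ (Fin d))}

theorem gradNorm_neg (v : X Ω) : gradNorm (-v) = gradNorm v := by
  have : gradVec (-v) = -gradVec v := rfl
  rw [gradNorm_eq_norm, gradNorm_eq_norm, this, norm_neg]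

/-- The negative norm bounds a functional on all of `X`; by the Poincaré inequality the quotient
that defines it is never one with a vanishing denominator. -/
theorem SobolevBounds.enorm_dual_apply_le {S : ℝ} (hS : SobolevBounds Ω S)
    (g : StrongDual ℝ (X Ω)) (v : X Ω) :
    ‖g v‖ₑ ≤ dualNorm g * ENNReal.ofReal (gradNorm v) := by
  rcases eq_or_ne v 0 with rfl | hv
  · simp
  have hpos : 0 < gradNorm v := by
    by_contra hn
    have h0 : gradNorm v = 0 := le_antisymm (not_lt.1 hn) (gradNorm_nonneg v)
    have := hS.norm_le v
    rw [h0, mul_zero] at this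
    exact hv (norm_le_zero_iff.1 this)
  have key : ∀ x : X Ω, x ≠ 0 → gradNorm x = gradNorm v →
      ENNReal.ofReal (g x) ≤ dualNorm g * ENNReal.ofReal (gradNorm v) := fun x hx hxv => by
    rw [← ENNReal.div_le_iff (by simpa using hpos) ENNReal.ofReal_ne_top, ← hxv]
    exact le_iSup₂ (f := fun (v : X Ω) (_ : v ≠ 0) =>
      ENNReal.ofReal (g v) / ENNReal.ofReal (gradNorm v)) x hx
  rw [Real.enorm_eq_ofReal_abs]
  rcases abs_cases (g v) with ⟨h, -⟩ | ⟨h, -⟩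
  · rw [h]
    exact key v hv rfl
  · rw [h, ← map_neg]
    exact key (-v) (neg_ne_zero.2 hv) (gradNorm_neg v)

/-- A representative in `H^ℓ` of an element of `X` controls its `H¹` norm. -/
theorem Hs.norm_le_of_toL2_eq (hΩ : IsOpen Ω) {ℓ : ℕ} (hℓ : 1 ≤ ℓ) {v : X Ω}
    {U : Hs Ω (EuclideanSpace ℝ (Fin d)) ℓ} (h : Hs.toL2 U = fld v) : ‖v‖ ≤ ‖U‖ := by
  have : Hs.incl hℓ U = v.1 := Hs.toL2_injective hΩ 1 h
  calc ‖v‖ = ‖v.1‖ := rfl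
    _ ≤ ‖U‖ := this ▸ Hs.norm_incl_le hℓ U

end

section

variable {T : ℝ} {N : ℕ} {t : ℕ → ℝ}

/-- A bound of an integral over `(0, T)`, distributed over the double steps. -/
theorem IsGrid.exists_local_bound (hg : IsGrid T N t) {F : ℝ → ℝ≥0∞} {R : ℝ}
    (hF : ∫⁻ s in Ioo 0 T, F s ≤ ENNReal.ofReal R ^ 2) :
    ∃ A : ℕ → ℝ, (∀ n, 0 ≤ A n) ∧ (∀ n, 1 ≤ n → n + 1 ≤ N →
      ∫⁻ s in Ioc (t (n - 1)) (t (n + 1)), F s ≤ ENNReal.ofReal (A n)) ∧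
      ∑ n ∈ Finset.Ico 1 N, A n ≤ 2 * max R 0 ^ 2 := by
  have h1 : ENNReal.ofReal R ^ 2 = ENNReal.ofReal (max R 0 ^ 2) := by
    rw [ENNReal.ofReal_pow (le_max_right _ _), ENNReal.ofReal_max, ENNReal.ofReal_zero,
      max_eq_left zero_le]
  have h2 : ∑ n ∈ Finset.Ico 1 N, ∫⁻ s in Ioc (t (n - 1)) (t (n + 1)), F s
      ≤ ENNReal.ofReal (2 * max R 0 ^ 2) := by
    refine (hg.sum_lintegral_le F).trans ?_
    rw [ENNReal.ofReal_mul zero_le_two, ENNReal.ofReal_ofNat, ← h1]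
    gcongr
  have hfin : ∀ n ∈ Finset.Ico 1 N, ∫⁻ s in Ioc (t (n - 1)) (t (n + 1)), F s ≠ ⊤ := fun n hn =>
    ((Finset.single_le_sum (f := fun n => ∫⁻ s in Ioc (t (n - 1)) (t (n + 1)), F s)
      (fun _ _ => zero_le) hn).trans h2).trans_lt ENNReal.ofReal_lt_top |>.ne
  refine ⟨fun n => (∫⁻ s in Ioc (t (n - 1)) (t (n + 1)), F s).toReal,
    fun n => ENNReal.toReal_nonneg, fun n hn hnN => ?_, ?_⟩
  · rw [ENNReal.ofReal_toReal (hfin n (Finset.mem_Ico.2 ⟨hn, hnN⟩))]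
  · rw [← ENNReal.toReal_sum hfin]
    exact ENNReal.toReal_le_of_le_ofReal (by positivity) h2

/-- The combination with coefficients `α` annihilates constants, maps `s - τ` to `khat` and
annihilates `(s - τ)²`, where `τ = t_{n,β}`. Hence it reproduces `khat` times the derivative at `τ`
up to the remainder of the second-order Taylor expansion. -/
theorem abs_alpha_truncation_le {θ : ℝ} (hθ : θ ∈ Ioo (0 : ℝ) 1) {n : ℕ} (hn : 1 ≤ n)
    (hk : 0 < step t n) (hl : 0 < step t (n - 1)) {y : ℕ → ℝ} {p q r E : ℝ}
    (h : ∀ m, n - 1 ≤ m → m ≤ n + 1 → |y m - p - (t m - tbeta θ t n) * q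
      - (t m - tbeta θ t n) ^ 2 / 2 * r| ≤ E) :
    |alphaComb θ y n - khat θ t n * q| ≤ 3 * E := by
  have hm := alpha_sq_moment hθ hk hl
  rw [← tbeta_eq hn] at hm
  have e1 : t (n + 1) = t n + step t n := by rw [step]; ring
  have e2 : t (n - 1) = t n - step t (n - 1) := by rw [step, Nat.sub_add_cancel hn]; ring
  have h2 := h (n + 1) (by omega) le_rfl
  have h1 := h n (by omega) (by omega)
  have h0 := h (n - 1) le_rfl (by omega)
  rw [e1] at h2
  rw [e2] at h0
  set δ := tbeta θ t n - t n with hδ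
  have eτ : tbeta θ t n = t n + δ := by rw [hδ]; ring
  rw [eτ] at h0 h1 h2
  set x2 := y (n + 1) - p - (t n + step t n - (t n + δ)) * q
      - (t n + step t n - (t n + δ)) ^ 2 / 2 * r with hx2
  set x1 := y n - p - (t n - (t n + δ)) * q - (t n - (t n + δ)) ^ 2 / 2 * r with hx1
  set x0 := y (n - 1) - p - (t n - step t (n - 1) - (t n + δ)) * q
      - (t n - step t (n - 1) - (t n + δ)) ^ 2 / 2 * r with hx0
  have key : alphaComb θ y n - khat θ t n * q
      = alpha2 θ * x2 + alpha1 θ * x1 + alpha0 θ * x0 := by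
    rw [hx2, hx1, hx0, alphaComb]
    simp only [smul_eq_mul]
    rw [khat] at hm ⊢
    have hs : alpha1 θ = -alpha2 θ - alpha0 θ := by rw [alpha1, alpha2, alpha0]; ring
    rw [hs]
    linear_combination (r / 2) * hm
  have ha2 : |alpha2 θ| ≤ 1 := by
    rw [alpha2, abs_le]; constructor <;> linarith [hθ.1, hθ.2]
  have ha1 : |alpha1 θ| ≤ 1 := by
    rw [alpha1, abs_le]; constructor <;> linarith [hθ.1, hθ.2]
  have ha0 : |alpha0 θ| ≤ 1 := by
    rw [alpha0, abs_le]; constructor <;> linarith [hθ.1, hθ.2]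
  rw [key]
  calc _ ≤ |alpha2 θ * x2| + |alpha1 θ * x1| + |alpha0 θ * x0| := abs_add_three _ _ _
    _ ≤ 1 * E + 1 * E + 1 * E := by
        rw [abs_mul, abs_mul, abs_mul]
        gcongr
    _ = _ := by ring

end

section

variable {d : ℕ} {Ω : Set (EuclideanSpace ℝ (Fin d))}

/-- What the regularity of an exact solution `u` gives at the time levels of the `n`-th step: `U` is
`u` as a continuous function with values in `H^{r+1}`, and `a n` stands for the integral over
`(t_{n-1}, t_{n+1})` of the squared norms of the time derivatives. -/
structure TimeBounds (θ T c M A : ℝ) (N : ℕ) (t : ℕ → ℝ) {r : ℕ} (u : ℝ → X Ω)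
    (ut : ℝ → L2 Ω (EuclideanSpace ℝ (Fin d)))
    (U : ℝ → Hs Ω (EuclideanSpace ℝ (Fin d)) (r + 1)) (a : ℕ → ℝ) : Prop where
  toL2 : ∀ s ∈ Icc 0 T, Hs.toL2 (U s) = fld (u s)
  norm_le : ∀ s ∈ Icc 0 T, ‖U s‖ ≤ M
  nonneg : ∀ n, 0 ≤ a n
  sum_le : ∑ n ∈ Finset.Ico 1 N, a n ≤ A
  alpha : ∀ n, 1 ≤ n → n + 1 ≤ N → ‖alphaComb θ (fun m => U (t m)) n‖
    ≤ c * √((step t n + step t (n - 1)) * a n)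
  beta : ∀ n, 1 ≤ n → n + 1 ≤ N → ‖betaComb θ t (fun m => U (t m)) n - U (tbeta θ t n)‖
    ≤ c * (step t n + step t (n - 1)) * √((step t n + step t (n - 1)) * a n)
  star : ∀ n, 1 ≤ n → n + 1 ≤ N → ‖starComb θ t (fun m => U (t m)) n - U (tbeta θ t n)‖
    ≤ c * (step t n + step t (n - 1)) * √((step t n + step t (n - 1)) * a n)
  trunc : ∀ n, 1 ≤ n → n + 1 ≤ N → ∀ v : X Ω,
    |⟪(khat θ t n)⁻¹ • fld (alphaComb θ (fun m => u (t m)) n) - ut (tbeta θ t n), fld v⟫|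
      ≤ c * (step t n + step t (n - 1)) * √((step t n + step t (n - 1)) * a n) * gradNorm v

/-- A Bochner bound as an integrable representative with values in `H^ℓ`. -/
theorem BochnerBound.spec {T R : ℝ} {ℓ : ℕ} {w : ℝ → L2 Ω (EuclideanSpace ℝ (Fin d))}
    (h : BochnerBound T ℓ w R) (hT : 0 ≤ T) :
    ∃ W : ℝ → Hs Ω (EuclideanSpace ℝ (Fin d)) ℓ,
      (∀ᵐ t ∂(volume.restrict (Ioo 0 T)), Hs.toL2 (W t) = w t) ∧
      IntervalIntegrable W volume 0 T ∧
      ∫⁻ s in Ioo 0 T, ‖W s‖ₑ ^ 2 ≤ ENNReal.ofReal R ^ 2 := by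
  obtain ⟨W, h1, h2, h3⟩ := h
  refine ⟨W, h1, ?_, ?_⟩
  · rw [intervalIntegrable_iff_integrableOn_Ioo_of_le hT]
    exact h2.integrable (by norm_num)
  · rw [← eLpNorm_natCast_pow W two_ne_zero]
    exact pow_le_pow_left' (by exact_mod_cast h3) 2

/-- The extrapolation is exact for affine functions, with coefficients that are bounded in terms of
`θ` and the step ratio. -/
theorem star_coeff {θ CU : ℝ} {t : ℕ → ℝ} {n : ℕ} (hθ : θ ∈ Ioo (0 : ℝ) 1) (hn : 1 ≤ n)
    (hk : 0 < step t n) (hl : 0 < step t (n - 1)) (hCU : step t n / step t (n - 1) < CU) :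
    (beta2 θ (eps t n) * (1 + step t n / step t (n - 1)) + beta1 θ (eps t n))
      + (beta0 θ (eps t n) - beta2 θ (eps t n) * (step t n / step t (n - 1))) = 1 ∧
    (beta2 θ (eps t n) * (1 + step t n / step t (n - 1)) + beta1 θ (eps t n)) * t n
      + (beta0 θ (eps t n) - beta2 θ (eps t n) * (step t n / step t (n - 1))) * t (n - 1)
      = tbeta θ t n ∧
    |beta2 θ (eps t n) * (1 + step t n / step t (n - 1)) + beta1 θ (eps t n)|
      ≤ 2 / (1 - θ) * (2 + CU) ∧
    |beta0 θ (eps t n) - beta2 θ (eps t n) * (step t n / step t (n - 1))|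
      ≤ 2 / (1 - θ) * (2 + CU) := by
  have hb : 0 < 2 / (1 - θ) := div_pos two_pos (by linarith [hθ.2])
  obtain ⟨-, h2, h1, h0⟩ := abs_beta_le hθ (abs_eps_lt_one hk hl)
  have hρ : 0 < step t n / step t (n - 1) := div_pos hk hl
  have hτ := tbeta_eq (θ := θ) (t := t) hn
  have e2 : t (n - 1) = t n - step t (n - 1) := by rw [step, Nat.sub_add_cancel hn]; ring
  have hs := beta_sum θ (eps t n)
  have hρl : step t n / step t (n - 1) * step t (n - 1) = step t n := div_mul_cancel₀ _ hl.ne'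
  set ρ := step t n / step t (n - 1)
  refine ⟨by linear_combination hs, ?_, ?_, ?_⟩
  · rw [e2]
    linear_combination t n * hs - hτ + beta2 θ (eps t n) * hρl
  · calc _ ≤ |beta2 θ (eps t n)| * (1 + ρ) + |beta1 θ (eps t n)| := by
          refine (abs_add_le _ _).trans ?_
          rw [abs_mul, abs_of_pos (by linarith : 0 < 1 + ρ)]
      _ ≤ 2 / (1 - θ) * (1 + CU) + 2 / (1 - θ) := by gcongr
      _ = _ := by ring
  · calc _ ≤ |beta0 θ (eps t n)| + |beta2 θ (eps t n)| * ρ := by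
          refine (abs_sub _ _).trans ?_
          rw [abs_mul, abs_of_pos hρ]
      _ ≤ 2 / (1 - θ) + 2 / (1 - θ) * CU := by gcongr
      _ ≤ _ := by linarith

end

section

variable {B : Type} [NormedAddCommGroup B] [NormedSpace ℝ B] {T θ A : ℝ} {N n : ℕ} {t : ℕ → ℝ}
  {u w w' : ℝ → B}

/-- The geometry of one step: all time levels involved lie in `[t_{n-1}, t_{n+1}]`. -/
theorem IsGrid.mem_local (hg : IsGrid T N t) (hθ : θ ∈ Ioo (0 : ℝ) 1) (hn : 1 ≤ n)
    (hnN : n + 1 ≤ N) : 0 < step t n ∧ 0 < step t (n - 1) ∧ 0 ≤ t (n - 1) ∧ t (n + 1) ≤ T ∧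
      t (n + 1) - t (n - 1) = step t n + step t (n - 1) ∧
      tbeta θ t n ∈ Icc (t (n - 1)) (t (n + 1)) ∧
      ∀ m, n - 1 ≤ m → m ≤ n + 1 → t m ∈ Icc (t (n - 1)) (t (n + 1)) ∧
        |t m - tbeta θ t n| ≤ step t n + step t (n - 1) := by
  have hk : 0 < step t n := hg.step_pos hnN
  have hl : 0 < step t (n - 1) := hg.step_pos (by omega)
  have hτ := Ioo_subset_Icc_self (tbeta_mem hθ hn hk hl)
  have hK : t (n + 1) - t (n - 1) = step t n + step t (n - 1) := by
    rw [step, step, Nat.sub_add_cancel hn]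
    ring
  refine ⟨hk, hl, (hg.mem_Icc (by omega)).1, (hg.mem_Icc hnN).2, hK, hτ, fun m h1 h2 => ?_⟩
  have hm : t m ∈ Icc (t (n - 1)) (t (n + 1)) := ⟨hg.le h1 (by omega), hg.le h2 hnN⟩
  refine ⟨hm, ?_⟩
  rw [← hK, abs_le]
  constructor <;> linarith [hm.1, hm.2, hτ.1, hτ.2]

/-- The combination with coefficients `α` annihilates constants. -/
theorem IsTimeDeriv.norm_alphaComb_le (hu : IsTimeDeriv T u w) (hg : IsGrid T N t)
    (hθ : θ ∈ Ioo (0 : ℝ) 1) (hn : 1 ≤ n) (hnN : n + 1 ≤ N)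
    (hA : ∫⁻ s in Ioc (t (n - 1)) (t (n + 1)), ‖w s‖ₑ ^ 2 ≤ ENNReal.ofReal A) :
    ‖alphaComb θ (fun m => u (t m)) n‖ ≤ 2 * √((step t n + step t (n - 1)) * A) := by
  obtain ⟨-, -, hlo, hhi, hK, -, hm⟩ := hg.mem_local hθ hn hnN
  have h1 := (hm n (by omega) (by omega)).1
  have h2 := hu.norm_sub_le hlo hhi hA h1 (hm (n + 1) (by omega) le_rfl).1
  have h0 := hu.norm_sub_le hlo hhi hA h1 (hm (n - 1) le_rfl (by omega)).1
  rw [hK] at h0 h2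
  have e : alphaComb θ (fun m => u (t m)) n
      = alpha2 θ • (u (t (n + 1)) - u (t n)) + alpha0 θ • (u (t (n - 1)) - u (t n)) := by
    rw [alphaComb, alpha2, alpha1, alpha0]
    module
  have ha2 : |alpha2 θ| ≤ 1 := by
    rw [alpha2, abs_le]; constructor <;> linarith [hθ.1, hθ.2]
  have ha0 : |alpha0 θ| ≤ 1 := by
    rw [alpha0, abs_le]; constructor <;> linarith [hθ.1, hθ.2]
  rw [e]
  calc _ ≤ ‖alpha2 θ • (u (t (n + 1)) - u (t n))‖ + ‖alpha0 θ • (u (t (n - 1)) - u (t n))‖ :=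
        norm_add_le _ _
    _ ≤ 1 * √((step t n + step t (n - 1)) * A) + 1 * √((step t n + step t (n - 1)) * A) := by
        rw [norm_smul, norm_smul]
        simp only [Real.norm_eq_abs]
        gcongr
    _ = _ := by ring

/-- First-order Taylor expansion at `t_{n,β}` for the time levels of one step. -/
theorem IsTimeDeriv.taylor_local [CompleteSpace B] (hu : IsTimeDeriv T u w)
    (hw : IsTimeDeriv T w w') (hg : IsGrid T N t) (hθ : θ ∈ Ioo (0 : ℝ) 1) (hn : 1 ≤ n)
    (hnN : n + 1 ≤ N)
    (hA : ∫⁻ s in Ioc (t (n - 1)) (t (n + 1)), ‖w' s‖ₑ ^ 2 ≤ ENNReal.ofReal A) (m : ℕ)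
    (h1 : n - 1 ≤ m) (h2 : m ≤ n + 1) :
    ‖u (t m) - u (tbeta θ t n) - (t m - tbeta θ t n) • w (tbeta θ t n)‖
      ≤ (step t n + step t (n - 1)) * √((step t n + step t (n - 1)) * A) := by
  obtain ⟨-, -, hlo, hhi, hK, hτ, hm⟩ := hg.mem_local hθ hn hnN
  have := hu.taylor_one hw hlo hhi hA hτ (hm m h1 h2).1
  rw [hK] at this
  rw [mul_comm (step t n + step t (n - 1))]
  exact this.trans (mul_le_mul_of_nonneg_left (hm m h1 h2).2 (Real.sqrt_nonneg _))

/-- The interpolation error is of second order, up to the local `L²` norm of the second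
derivative. -/
theorem IsTimeDeriv.norm_betaComb_sub_le [CompleteSpace B] (hu : IsTimeDeriv T u w)
    (hw : IsTimeDeriv T w w') (hg : IsGrid T N t) (hθ : θ ∈ Ioo (0 : ℝ) 1) (hn : 1 ≤ n)
    (hnN : n + 1 ≤ N)
    (hA : ∫⁻ s in Ioc (t (n - 1)) (t (n + 1)), ‖w' s‖ₑ ^ 2 ≤ ENNReal.ofReal A) :
    ‖betaComb θ t (fun m => u (t m)) n - u (tbeta θ t n)‖ ≤ 3 * (2 / (1 - θ)) *
      ((step t n + step t (n - 1)) * √((step t n + step t (n - 1)) * A)) := by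
  obtain ⟨hk, hl, -⟩ := hg.mem_local hθ hn hnN
  obtain ⟨-, hb2, hb1, hb0⟩ := abs_beta_le hθ (abs_eps_lt_one hk hl)
  have hE := hu.taylor_local hw hg hθ hn hnN hA
  exact norm_comb_sub_le (beta_sum θ (eps t n)) rfl hb2 hb1 hb0 (hE (n + 1) (by omega) le_rfl)
    (hE n (by omega) (by omega)) (hE (n - 1) le_rfl (by omega))

/-- The extrapolation error is of second order, up to the local `L²` norm of the second
derivative. -/
theorem IsTimeDeriv.norm_starComb_sub_le [CompleteSpace B] (hu : IsTimeDeriv T u w)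
    (hw : IsTimeDeriv T w w') (hg : IsGrid T N t) (hθ : θ ∈ Ioo (0 : ℝ) 1) (hn : 1 ≤ n)
    (hnN : n + 1 ≤ N) {CU : ℝ} (hCU : step t n / step t (n - 1) < CU)
    (hA : ∫⁻ s in Ioc (t (n - 1)) (t (n + 1)), ‖w' s‖ₑ ^ 2 ≤ ENNReal.ofReal A) :
    ‖starComb θ t (fun m => u (t m)) n - u (tbeta θ t n)‖ ≤ 3 * (2 / (1 - θ) * (2 + CU)) *
      ((step t n + step t (n - 1)) * √((step t n + step t (n - 1)) * A)) := by
  obtain ⟨hk, hl, -⟩ := hg.mem_local hθ hn hnN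
  obtain ⟨hs1, hs2, hs3, hs4⟩ := star_coeff hθ hn hk hl hCU
  have hE := hu.taylor_local hw hg hθ hn hnN hA
  have h3 := norm_comb_sub_le (c₂ := 0) (s₂ := t (n + 1)) (by rw [zero_add]; exact hs1)
    (by rw [zero_mul, zero_add]; exact hs2) (by rw [abs_zero]; exact (abs_nonneg _).trans hs3)
    hs3 hs4 (hE (n + 1) (by omega) le_rfl) (hE n (by omega) (by omega))
    (hE (n - 1) le_rfl (by omega))
  rwa [zero_smul, zero_add] at h3

/-- The truncation error of the time derivative of a scalar function. -/
theorem abs_scalar_truncation_le {y y₁ y₂ y₃ : ℝ → ℝ} {T θ A : ℝ} {N n : ℕ} {t : ℕ → ℝ}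
    (h1 : IsTimeDeriv T y y₁) (h2 : IsTimeDeriv T y₁ y₂) (h3 : IsTimeDeriv T y₂ y₃)
    (hg : IsGrid T N t) (hθ : θ ∈ Ioo (0 : ℝ) 1) (hn : 1 ≤ n) (hnN : n + 1 ≤ N)
    (hA : ∫⁻ s in Ioc (t (n - 1)) (t (n + 1)), ‖y₃ s‖ₑ ^ 2 ≤ ENNReal.ofReal A) :
    |(khat θ t n)⁻¹ * alphaComb θ (fun m => y (t m)) n - y₁ (tbeta θ t n)|
      ≤ 3 * (2 / (1 - θ)) *
        ((step t n + step t (n - 1)) * √((step t n + step t (n - 1)) * A)) := by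
  obtain ⟨hk, hl, hlo, hhi, hK, hτ, hm⟩ := hg.mem_local hθ hn hnN
  set K := step t n + step t (n - 1) with hKdef
  have hK0 : 0 < K := add_pos hk hl
  have hE : ∀ m, n - 1 ≤ m → m ≤ n + 1 → |y (t m) - y (tbeta θ t n)
      - (t m - tbeta θ t n) * y₁ (tbeta θ t n) - (t m - tbeta θ t n) ^ 2 / 2 * y₂ (tbeta θ t n)|
        ≤ √(K * A) * K * K := by
    intro m hm1 hm2
    obtain ⟨hmm, h5⟩ := hm m hm1 hm2
    have := h1.taylor_two h2 h3 hlo hhi hA hτ hmm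
    rw [hK] at this
    refine this.trans ?_
    gcongr
  -- division by `khat`, which is comparable to the double step, gains one order
  have h4 := abs_alpha_truncation_le hθ hn hk hl hE
  obtain ⟨hk1, -, hk2⟩ := khat_bounds hθ hk hl
  have e : (khat θ t n)⁻¹ * alphaComb θ (fun m => y (t m)) n - y₁ (tbeta θ t n)
      = (khat θ t n)⁻¹ * (alphaComb θ (fun m => y (t m)) n - khat θ t n * y₁ (tbeta θ t n)) := by
    field_simp
  rw [e, abs_mul, abs_of_pos (inv_pos.2 hk2)]
  have h7 : 0 < (1 - θ) / 2 * K := mul_pos (by linarith [hθ.2]) hK0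
  have h8 : 1 - θ ≠ 0 := by linarith [hθ.2]
  calc (khat θ t n)⁻¹ * |_| ≤ ((1 - θ) / 2 * K)⁻¹ * (3 * (√(K * A) * K * K)) := by gcongr
    _ = _ := by field_simp

/-- Tested with a fixed `v`, a weak time derivative with values in the dual is the time derivative
of a scalar function. -/
theorem IsWeakTimeDeriv.apply {E : Type} [NormedAddCommGroup E] [NormedSpace ℝ E] {T : ℝ}
    (hT : 0 ≤ T) {G G' : ℝ → StrongDual ℝ E} (h : IsWeakTimeDeriv T G G') (v : E) :
    ∃ g : ℝ → ℝ, IsTimeDeriv T g (fun s => G' s v) ∧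
      ∀ᵐ s ∂(volume.restrict (Ioo 0 T)), G s v = g s := by
  obtain ⟨hi, g₀, hg₀⟩ := h
  refine ⟨fun s => g₀ v + ∫ x in (0 : ℝ)..s, G' x v, ⟨⟨?_, ?_⟩, fun s _ => ?_⟩, ?_⟩
  · exact (ContinuousLinearMap.apply ℝ ℝ v).integrable_comp hi.1
  · exact (ContinuousLinearMap.apply ℝ ℝ v).integrable_comp hi.2
  · simp
  · filter_upwards [hg₀, ae_restrict_mem measurableSet_Ioo] with x hx hxm
    have hi : IntervalIntegrable G' volume 0 x := by
      refine hi.mono_set (uIcc_subset_uIcc left_mem_uIcc ?_)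
      rw [uIcc_of_le hT]
      exact Ioo_subset_Icc_self hxm
    rw [hx, add_apply]
    congr 1
    exact ((ContinuousLinearMap.apply ℝ ℝ v).intervalIntegral_comp_comm hi).symm

end

section

variable {d : ℕ} {Ω : Set (EuclideanSpace ℝ (Fin d))}

/-- The truncation error of the time derivative in `X⁻¹`. Everything is tested with `v` first, so
that the third derivative in time is that of a scalar function. -/
theorem abs_truncation_le {S : ℝ} (hS : SobolevBounds Ω S) {θ T A : ℝ} (hθ : θ ∈ Ioo (0 : ℝ) 1)
    {N n : ℕ} {t : ℕ → ℝ} (hg : IsGrid T N t) (hn : 1 ≤ n) (hnN : n + 1 ≤ N) {u : ℝ → X Ω}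
    {ut utt : ℝ → L2 Ω (EuclideanSpace ℝ (Fin d))} {uttt : ℝ → StrongDual ℝ (X Ω)}
    (hu : IsTimeDeriv T (fun s => fld (u s)) ut) (hutt : IsTimeDeriv T ut utt)
    (huttt : IsWeakTimeDeriv T (fun τ => toDual (utt τ)) uttt)
    (hA : ∫⁻ s in Ioc (t (n - 1)) (t (n + 1)), dualNorm (uttt s) ^ 2 ≤ ENNReal.ofReal A)
    (v : X Ω) :
    |⟪(khat θ t n)⁻¹ • fld (alphaComb θ (fun m => u (t m)) n) - ut (tbeta θ t n), fld v⟫|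
      ≤ 3 * (2 / (1 - θ)) * ((step t n + step t (n - 1)) * √((step t n + step t (n - 1)) * A))
        * gradNorm v := by
  obtain ⟨-, -, hlo, hhi, -⟩ := hg.mem_local hθ hn hnN
  have hT : 0 ≤ T := hlo.trans ((hg.le (by omega) hnN).trans hhi)
  obtain ⟨g, h3, hge⟩ := @IsWeakTimeDeriv.apply (X Ω) (X Ω).normedAddCommGroup
    (X Ω).normedSpace T hT _ uttt huttt v
  have h1 := hu.map (innerSL ℝ (fld v))
  have h2 : IsTimeDeriv T (fun s => innerSL ℝ (fld v) (ut s)) g := by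
    refine (hutt.map (innerSL ℝ (fld v))).congr hT ?_
    filter_upwards [hge] with x hx
    rw [← hx]
    exact real_inner_comm (utt x) (fld v)
  have hA' : ∫⁻ x in Ioc (t (n - 1)) (t (n + 1)), ‖uttt x v‖ₑ ^ 2
      ≤ ENNReal.ofReal (gradNorm v ^ 2 * A) := by
    rw [ENNReal.ofReal_mul (sq_nonneg _), ENNReal.ofReal_pow (gradNorm_nonneg v)]
    calc _ ≤ ∫⁻ x in Ioc (t (n - 1)) (t (n + 1)),
          ENNReal.ofReal (gradNorm v) ^ 2 * dualNorm (uttt x) ^ 2 := by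
          refine lintegral_mono fun x => ?_
          rw [← mul_pow, mul_comm]
          exact pow_le_pow_left' (hS.enorm_dual_apply_le _ _) 2
      _ = ENNReal.ofReal (gradNorm v) ^ 2 *
          ∫⁻ x in Ioc (t (n - 1)) (t (n + 1)), dualNorm (uttt x) ^ 2 :=
          lintegral_const_mul' _ _ (by finiteness)
      _ ≤ _ := by gcongr
  have h4 := abs_scalar_truncation_le h1 h2 h3 hg hθ hn hnN hA'
  have e : ⟪(khat θ t n)⁻¹ • fld (alphaComb θ (fun m => u (t m)) n) - ut (tbeta θ t n), fld v⟫
      = (khat θ t n)⁻¹ * alphaComb θ (fun m => innerSL ℝ (fld v) (fld (u (t m)))) n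
        - innerSL ℝ (fld v) (ut (tbeta θ t n)) := by
    rw [inner_sub_left, real_inner_smul_left, real_inner_comm (fld v), real_inner_comm (fld v)]
    simp only [alphaComb, map_add, map_smul, inner_add_right, inner_smul_right,
      innerSL_apply_apply, smul_eq_mul]
  rw [e]
  refine h4.trans (le_of_eq ?_)
  rw [show (step t n + step t (n - 1)) * (gradNorm v ^ 2 * A)
    = gradNorm v ^ 2 * ((step t n + step t (n - 1)) * A) by ring,
    Real.sqrt_mul (sq_nonneg _), Real.sqrt_sq (gradNorm_nonneg v)]
  ring

set_option maxHeartbeats 1000000 in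
/-- The regularity assumptions provide the bounds of the truncation errors. At the first level
`t_{1,β}`, which exists as `2 ≤ N`, the solution lies in `H^{r+1}`, and as its time derivative is
square integrable with values in `H^{r+1}`, it stays there at all times. -/
theorem exists_timeBounds {S : ℝ} (hS : SobolevBounds Ω S) (hΩ : IsOpen Ω) {r s : ℕ}
    {θ ν T R CL CU : ℝ} (hθ : θ ∈ Ioo (0 : ℝ) 1) (hCU : 0 < CU) {N : ℕ} (hN : 2 ≤ N)
    {t : ℕ → ℝ} (hg : IsGrid T N t) (hr : RatioBounds CL CU N t) {u₀ : X Ω}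
    {f : ℝ → StrongDual ℝ (X Ω)} {u : ℝ → X Ω} {ut : ℝ → L2 Ω (EuclideanSpace ℝ (Fin d))}
    {p : ℝ → L2 Ω ℝ} (hsol : IsNSESolution ν T u₀ f u ut p)
    (hreg : Regularity r s θ T R N t u ut p) :
    ∃ (U : ℝ → Hs Ω (EuclideanSpace ℝ (Fin d)) (r + 1)) (a : ℕ → ℝ),
      TimeBounds θ T (3 * (2 / (1 - θ) * (2 + CU))) (max R 0 + √(T * max R 0 ^ 2))
        (6 * max R 0 ^ 2) N t u ut U a := by
  have hτ1 : tbeta θ t 1 ∈ Ioo 0 T := hg.tbeta_mem_Ioo hθ le_rfl (by omega)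
  have hT0 : 0 < T := hτ1.1.trans hτ1.2
  have hT := hT0.le
  obtain ⟨W₁, hW₁, hW₁i, hW₁b⟩ := hreg.ut_bound.spec hT
  obtain ⟨utt, uttt, hutt, huttb, huttt, hutttb⟩ := hreg.higher
  obtain ⟨W₂, hW₂, hW₂i, hW₂b⟩ := huttb.spec hT
  obtain ⟨U₁, hU₁, hU₁b⟩ := exists_of_sobNorm_le hΩ (hreg.u_beta 1 le_rfl (by omega))
  obtain ⟨U, hU, hUτ, hUL⟩ := hsol.deriv.exists_lift (Hs.toL2) hW₁i hW₁ (Ioo_subset_Icc_self hτ1)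
    hU₁
  -- the continuous representative of the derivative, which lies in `H^{r+1}` at almost every time
  -- and hence, by the integrability of the second derivative, always
  obtain ⟨t₀, ht₀, hWt₀⟩ : ∃ t₀ ∈ Ioo 0 T, Hs.toL2 (W₁ t₀) = ut t₀ := by
    have hne : (volume.restrict (Ioo 0 T)) ≠ 0 := by
      rw [Ne, Measure.restrict_eq_zero, Real.volume_Ioo]
      simpa using hT0
    have : (ae (volume.restrict (Ioo 0 T))).NeBot := ae_neBot.2 hne
    obtain ⟨x, h1, h2⟩ := (hW₁.and (ae_restrict_mem measurableSet_Ioo)).exists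
    exact ⟨x, h2, h1⟩
  obtain ⟨W, hW, -, hWL⟩ := hutt.exists_lift (Hs.toL2) hW₂i hW₂ (Ioo_subset_Icc_self ht₀) hWt₀
  have hUW : IsTimeDeriv T U W := by
    refine hU.congr hT ?_
    filter_upwards [hW₁, ae_restrict_mem measurableSet_Ioo] with x hx hxm
    exact Hs.toL2_injective hΩ _ (hx.trans (hWL x (Ioo_subset_Icc_self hxm)).symm)
  obtain ⟨A₁, hA₁0, hA₁, hA₁s⟩ := hg.exists_local_bound hW₁b
  obtain ⟨A₂, hA₂0, hA₂, hA₂s⟩ := hg.exists_local_bound hW₂b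
  obtain ⟨A₃, hA₃0, hA₃, hA₃s⟩ := hg.exists_local_bound hutttb
  have hb1 : 2 ≤ 2 / (1 - θ) := by
    rw [le_div_iff₀ (by linarith [hθ.2])]
    linarith [hθ.1]
  have hcb : 2 / (1 - θ) ≤ 2 / (1 - θ) * (2 + CU) :=
    le_mul_of_one_le_right (by linarith) (by linarith)
  set b' := 2 / (1 - θ) * (2 + CU) with hb'
  have hKpos : ∀ n, 1 ≤ n → n + 1 ≤ N → 0 < step t n + step t (n - 1) := fun n hn hnN =>
    add_pos (hg.step_pos hnN) (hg.step_pos (by omega))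
  have hsq : ∀ n, 1 ≤ n → n + 1 ≤ N → ∀ x, x ≤ A₁ n + A₂ n + A₃ n →
      √((step t n + step t (n - 1)) * x)
        ≤ √((step t n + step t (n - 1)) * (A₁ n + A₂ n + A₃ n)) := fun n hn hnN x hx => by
    have := hKpos n hn hnN
    gcongr
  refine ⟨U, fun n => A₁ n + A₂ n + A₃ n, hUL, fun x hx => ?_, fun n => ?_, ?_, fun n hn hnN => ?_,
    fun n hn hnN => ?_, fun n hn hnN => ?_, fun n hn hnN v => ?_⟩
  · have h1 : ‖U x - U (tbeta θ t 1)‖ ≤ √((T - 0) * max R 0 ^ 2) := by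
      refine hU.norm_sub_le le_rfl le_rfl ?_ (Ioo_subset_Icc_self hτ1) hx
      rw [ENNReal.ofReal_pow (le_max_right _ _), ENNReal.ofReal_max, ENNReal.ofReal_zero,
        max_eq_left zero_le, ← restrict_Ioo_eq_restrict_Ioc]
      exact hW₁b
    rw [sub_zero] at h1
    calc ‖U x‖ = ‖U (tbeta θ t 1) + (U x - U (tbeta θ t 1))‖ := by congr 1; abel
      _ ≤ max R 0 + √(T * max R 0 ^ 2) :=
        (norm_add_le _ _).trans (add_le_add (hUτ ▸ hU₁b) h1)
  · exact add_nonneg (add_nonneg (hA₁0 n) (hA₂0 n)) (hA₃0 n)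
  · rw [Finset.sum_add_distrib, Finset.sum_add_distrib]
    linarith
  · have h := hU.norm_alphaComb_le hg hθ hn hnN (hA₁ n hn hnN)
    have h' := hsq n hn hnN (A₁ n) (by linarith [hA₂0 n, hA₃0 n])
    exact h.trans (mul_le_mul (by linarith) h' (Real.sqrt_nonneg _) (by linarith))
  · have h := hUW.norm_betaComb_sub_le hW hg hθ hn hnN (hA₂ n hn hnN)
    have h' := hsq n hn hnN (A₂ n) (by linarith [hA₁0 n, hA₃0 n])
    have hK := hKpos n hn hnN
    refine h.trans ?_
    rw [mul_assoc (3 * b')]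
    gcongr
  · have h := hUW.norm_starComb_sub_le hW hg hθ hn hnN (hr n hn hnN).2 (hA₂ n hn hnN)
    have h' := hsq n hn hnN (A₂ n) (by linarith [hA₁0 n, hA₃0 n])
    have hK := hKpos n hn hnN
    refine h.trans ?_
    rw [mul_assoc (3 * b')]
    gcongr
  · have h := abs_truncation_le hS hθ hg hn hnN hsol.deriv hutt huttt (hA₃ n hn hnN) v
    have h' := hsq n hn hnN (A₃ n) (by linarith [hA₁0 n, hA₂0 n])
    have hK := hKpos n hn hnN
    have hgn := gradNorm_nonneg v
    refine h.trans ?_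
    rw [mul_assoc (3 * b')]
    gcongr

end

/-! ### The error equation -/

section

variable {d : ℕ} {Ω : Set (EuclideanSpace ℝ (Fin d))}

theorem add_mem_V {u v : X Ω} (hu : u ∈ V Ω) (hv : v ∈ V Ω) : u + v ∈ V Ω := fun q hq => by
  have h1 := hu q hq
  have h2 := hv q hq
  rw [divPair_eq_inner] at h1 h2 ⊢
  rw [map_add, inner_add_right, h1, h2, add_zero]

theorem smul_mem_V (c : ℝ) {u : X Ω} (hu : u ∈ V Ω) : c • u ∈ V Ω := fun q hq => by
  have h1 := hu q hq
  rw [divPair_eq_inner] at h1 ⊢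
  rw [map_smul, inner_smul_right, h1, mul_zero]

theorem b_self (u v : X Ω) : b u v v = 0 := by rw [b, sub_self]

theorem SobolevBounds.abs_inner_fld_le {S : ℝ} (hS : SobolevBounds Ω S) (x v : X Ω) :
    |⟪fld x, fld v⟫| ≤ ‖x‖ * (S * gradNorm v) :=
  (abs_real_inner_le_norm _ _).trans
    (mul_le_mul (norm_fld_le_norm x) (hS.norm_fld_le v) (norm_nonneg _) (norm_nonneg _))

/-- The error equation. The nonlinear terms are arranged so that every factor is a consistency
error, or multiplies the error `φs` at the old time levels, or is a fluctuation `w` times the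
difference `v - φs`, which the numerical dissipation controls. -/
theorem error_equation {S : ℝ} (hS : SobolevBounds Ω S) {κ ν F : ℝ} {pτ : L2 Ω ℝ}
    {ut : L2 Ω (EuclideanSpace ℝ (Fin d))} {uτ ua ub pua pub pus uha uhb uhs w : X Ω}
    (hnse : ⟪ut, fld (pub - uhb)⟫ + b uτ uτ (pub - uhb) + ν * gradInner uτ (pub - uhb)
      - divPair pτ (pub - uhb) = F)
    (hsch : ⟪κ⁻¹ • fld uha, fld (pub - uhb)⟫ + b (uhs - w) uhb (pub - uhb)
      + ν * gradInner uhb (pub - uhb) = F - b w uhs (pub - uhb)) :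
    ⟪κ⁻¹ • fld (pua - uha), fld (pub - uhb)⟫ + ν * gradNorm (pub - uhb) ^ 2
      = ⟪κ⁻¹ • fld ua - ut, fld (pub - uhb)⟫ - κ⁻¹ * ⟪fld (ua - pua), fld (pub - uhb)⟫
        + ν * gradInner (pub - uτ) (pub - uhb) + divPair pτ (pub - uhb)
        + b (pus - uτ) pub (pub - uhb) + b uτ (pub - uτ) (pub - uhb)
        - b (pus - uhs) ub (pub - uhb) + b (pus - uhs) (ub - pub) (pub - uhb)
        - b w (pub - pus) (pub - uhb) + b w ((pub - uhb) - (pus - uhs)) (pub - uhb) := by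
  have h0 := b_self uhs (pub - uhb)
  set v := pub - uhb with hv
  have h1 : b uhs v v = b uhs pub v - b uhs uhb v := by
    conv_lhs => rw [hv, hS.b_sub_mid]
  have h2 : b w (v - (pus - uhs)) v = b w pub v - b w uhb v - (b w pus v - b w uhs v) := by
    rw [hS.b_sub_mid, hS.b_sub_mid w pus]
    conv_lhs => rw [hv, hS.b_sub_mid]
  have h3 : gradNorm v ^ 2 = gradInner pub v - gradInner uhb v := by
    rw [← gradInner_self]
    conv_lhs => rw [hv, gradInner_sub_left]
  rw [h2, h3]
  simp only [hS.b_sub_left, hS.b_sub_mid, gradInner_sub_left, map_sub, inner_sub_left, smul_sub,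
    real_inner_smul_left] at *
  linear_combination hnse - hsch - h0 + h1

set_option maxHeartbeats 2000000 in
/-- The error equation with all terms bounded. Besides the consistency errors there remain the error
at the old time levels, which the Gronwall inequality handles, and the product of the fluctuation
`w` with the difference of interpolation and extrapolation of the error. For the latter,
`SobolevBounds.abs_b_le_interp` and the inverse inequality lose only the factor `h^{-1/2}`. -/
theorem error_estimate {S : ℝ} (hS : SobolevBounds Ω S) (hΩ : IsOpen Ω) {κ ν F : ℝ}
    (hκ : 0 < κ) (hν : 0 < ν) {pτ : L2 Ω ℝ}
    {ut : L2 Ω (EuclideanSpace ℝ (Fin d))} {uτ ua ub pua pub pus uha uhb uhs w : X Ω}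
    (hnse : ⟪ut, fld (pub - uhb)⟫ + b uτ uτ (pub - uhb) + ν * gradInner uτ (pub - uhb)
      - divPair pτ (pub - uhb) = F)
    (hsch : ⟪κ⁻¹ • fld uha, fld (pub - uhb)⟫ + b (uhs - w) uhb (pub - uhb)
      + ν * gradInner uhb (pub - uhb) = F - b w uhs (pub - uhb))
    {τ₁ Ea E Pe D M Cη Ci h : ℝ} (hh : 0 < h) (hCi : 0 ≤ Ci)
    (htr : |⟪κ⁻¹ • fld ua - ut, fld (pub - uhb)⟫| ≤ τ₁ * gradNorm (pub - uhb))
    (hEa : ‖ua - pua‖ ≤ Ea) (hb : ‖pub - uτ‖ ≤ E) (hs : ‖pus - uτ‖ ≤ E)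
    (hp : |divPair pτ (pub - uhb)| ≤ Pe * gradNorm (pub - uhb)) (hMb : ‖pub‖ ≤ M)
    (hMτ : ‖uτ‖ ≤ M) (Ub : Hs Ω (EuclideanSpace ℝ (Fin d)) 2) (hUb : Hs.toL2 Ub = fld ub)
    (hMU : ‖Ub‖ ≤ M) (hη : ‖ub - pub‖ ≤ Cη * h) (hD : ‖pub - pus‖ ≤ D)
    (hi₁ : gradNorm (pus - uhs) ≤ Ci * h⁻¹ * ‖fld (pus - uhs)‖)
    (hi₂ : gradNorm ((pub - uhb) - (pus - uhs))
      ≤ Ci * h⁻¹ * ‖fld ((pub - uhb) - (pus - uhs))‖) :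
    ⟪κ⁻¹ • fld (pua - uha), fld (pub - uhb)⟫ + ν * gradNorm (pub - uhb) ^ 2
      ≤ gradNorm (pub - uhb) *
        ((τ₁ + κ⁻¹ * (S * Ea) + ν * E + Pe + 2 * (d * S ^ 3 * M) * E
            + d * S ^ 4 * gradNorm w * D)
          + (d * S * (S ^ 2 + 1) * M + d * S ^ 4 * Ci * Cη) * ‖fld (pus - uhs)‖
          + 2 * d * S * √(S * Ci * h⁻¹) * gradNorm w
            * ‖fld ((pub - uhb) - (pus - uhs))‖) := by
  rw [error_equation hS (ua := ua) (ub := ub) (pus := pus) hnse hsch]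
  have hS0 := hS.nonneg
  clear hnse hsch
  generalize pub - uhb = v at *
  generalize pus - uhs = φ at *
  have hg := gradNorm_nonneg v
  have hgw := gradNorm_nonneg w
  have hE0 : 0 ≤ E := (norm_nonneg _).trans hb
  have hM0 : 0 ≤ M := (norm_nonneg _).trans hMb
  have t2 : |κ⁻¹ * ⟪fld (ua - pua), fld v⟫| ≤ κ⁻¹ * (S * Ea) * gradNorm v := by
    rw [abs_mul, abs_of_pos (inv_pos.2 hκ), mul_assoc]
    refine mul_le_mul_of_nonneg_left ((hS.abs_inner_fld_le _ _).trans ?_) (inv_pos.2 hκ).le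
    calc ‖ua - pua‖ * (S * gradNorm v) ≤ Ea * (S * gradNorm v) :=
          mul_le_mul_of_nonneg_right hEa (mul_nonneg hS0 hg)
      _ = _ := by ring
  have t3 : |ν * gradInner (pub - uτ) v| ≤ ν * E * gradNorm v := by
    rw [abs_mul, abs_of_pos hν, mul_assoc]
    gcongr
    refine (abs_gradInner_le _ _).trans ?_
    gcongr
    exact (gradNorm_le_norm _).trans hb
  have t5 : |b (pus - uτ) pub v| ≤ d * S ^ 3 * M * E * gradNorm v := by
    refine (hS.abs_b_le _ _ _).trans ?_
    calc _ ≤ d * S ^ 2 * E * M * (S * gradNorm v) := by gcongr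
      _ = _ := by ring
  have t6 : |b uτ (pub - uτ) v| ≤ d * S ^ 3 * M * E * gradNorm v := by
    refine (hS.abs_b_le _ _ _).trans ?_
    calc _ ≤ d * S ^ 2 * M * E * (S * gradNorm v) := by gcongr
      _ = _ := by ring
  have t7 : |b φ ub v| ≤ d * S * (S ^ 2 + 1) * M * ‖fld φ‖ * gradNorm v := by
    refine (hS.abs_b_le_of_two hΩ _ _ _ Ub hUb).trans ?_
    calc _ ≤ d * S * (S ^ 2 + 1) * ‖fld φ‖ * M * gradNorm v := by gcongr
      _ = _ := by ring
  -- the inverse inequality costs `h⁻¹`, which the projection error pays for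
  have t8 : |b φ (ub - pub) v| ≤ d * S ^ 4 * Ci * Cη * ‖fld φ‖ * gradNorm v := by
    refine (hS.abs_b_le _ _ _).trans ?_
    have h1 : ‖φ‖ ≤ S * (Ci * h⁻¹ * ‖fld φ‖) := (hS.norm_le φ).trans (by gcongr)
    calc _ ≤ d * S ^ 2 * (S * (Ci * h⁻¹ * ‖fld φ‖)) * (Cη * h) * (S * gradNorm v) := by gcongr
      _ = _ := by field_simp
  have t9 : |b w (pub - pus) v| ≤ d * S ^ 4 * gradNorm w * D * gradNorm v := by
    refine (hS.abs_b_le _ _ _).trans ?_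
    calc _ ≤ d * S ^ 2 * (S * gradNorm w) * D * (S * gradNorm v) := by
          have := hS.norm_le w
          gcongr
      _ = _ := by ring
  have t10 : |b w (v - φ) v|
      ≤ 2 * d * S * √(S * Ci * h⁻¹) * gradNorm w * ‖fld (v - φ)‖ * gradNorm v := by
    refine (hS.abs_b_le_interp hΩ _ _ _).trans ?_
    have h1 : √(‖fld (v - φ)‖ * (S * gradNorm (v - φ)))
        ≤ √(S * Ci * h⁻¹) * ‖fld (v - φ)‖ := by
      calc _ ≤ √(‖fld (v - φ)‖ * (S * (Ci * h⁻¹ * ‖fld (v - φ)‖))) := by gcongr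
        _ = √(S * Ci * h⁻¹ * ‖fld (v - φ)‖ ^ 2) := by congr 1; ring
        _ = _ := by rw [Real.sqrt_mul (by positivity), Real.sqrt_sq (norm_nonneg _)]
    calc _ ≤ 2 * d * S * gradNorm w * (√(S * Ci * h⁻¹) * ‖fld (v - φ)‖) * gradNorm v := by
          gcongr
      _ = _ := by ring
  rw [abs_le] at htr hp t2 t3 t5 t6 t7 t8 t9 t10
  linarith [htr.2, hp.2, t2.1, t3.2, t5.2, t6.2, t7.1, t8.2, t9.1, t10.2]

end

/-! ### The discrete Gronwall inequality and the time step conditions -/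

/-- The discrete Gronwall inequality. -/
theorem discrete_gronwall {G D κ δ : ℕ → ℝ} {Λ : ℝ} {N : ℕ} (hΛ : 0 ≤ Λ)
    (hG : ∀ n, 0 ≤ G n) (hD : ∀ n, 1 ≤ n → n + 1 ≤ N → 0 ≤ D n)
    (hδ : ∀ n, 1 ≤ n → n + 1 ≤ N → 0 ≤ δ n) (hκ : ∀ n, 1 ≤ n → n + 1 ≤ N → 0 ≤ κ n)
    (hstep : ∀ n, 1 ≤ n → n + 1 ≤ N → G (n + 1) + D n ≤ (1 + Λ * κ n) * G n + δ n)
    {m : ℕ} (h1 : 1 ≤ m) (hm : m ≤ N) :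
    G m + ∑ n ∈ Finset.Ico 1 m, D n
      ≤ Real.exp (Λ * ∑ n ∈ Finset.Ico 1 m, κ n) * (G 1 + ∑ n ∈ Finset.Ico 1 m, δ n) := by
  induction m, h1 using Nat.le_induction with
  | base => simp
  | succ m h1 ih =>
    have ih := ih (by omega)
    rw [Finset.sum_Ico_succ_top h1, Finset.sum_Ico_succ_top h1, Finset.sum_Ico_succ_top h1]
    have hs := hstep m h1 hm
    have hκm := hκ m h1 hm
    have hx : 0 ≤ Λ * κ m := mul_nonneg hΛ hκm
    have hsum : 0 ≤ Λ * ∑ n ∈ Finset.Ico 1 m, κ n := mul_nonneg hΛ <| Finset.sum_nonneg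
      fun n hn => by
        rw [Finset.mem_Ico] at hn
        exact hκ n hn.1 (by omega)
    have hS : 0 ≤ ∑ n ∈ Finset.Ico 1 m, D n := Finset.sum_nonneg
      fun n hn => by
        rw [Finset.mem_Ico] at hn
        exact hD n hn.1 (by omega)
    have he : 1 + Λ * κ m ≤ Real.exp (Λ * κ m) := by
      linarith [Real.add_one_le_exp (Λ * κ m)]
    have h2 : 1 ≤ Real.exp (Λ * (∑ n ∈ Finset.Ico 1 m, κ n + κ m)) :=
      Real.one_le_exp (by rw [mul_add]; positivity)
    calc G (m + 1) + (∑ n ∈ Finset.Ico 1 m, D n + D m)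
        ≤ (1 + Λ * κ m) * (G m + ∑ n ∈ Finset.Ico 1 m, D n) + δ m := by
          nlinarith [mul_nonneg hx hS]
      _ ≤ Real.exp (Λ * κ m) * (Real.exp (Λ * ∑ n ∈ Finset.Ico 1 m, κ n) *
            (G 1 + ∑ n ∈ Finset.Ico 1 m, δ n)) + δ m := by
          have := hG m
          gcongr
      _ = Real.exp (Λ * (∑ n ∈ Finset.Ico 1 m, κ n + κ m)) *
            (G 1 + ∑ n ∈ Finset.Ico 1 m, δ n) + 1 * δ m := by
          rw [← mul_assoc, ← Real.exp_add, mul_add Λ, add_comm (Λ * κ m), one_mul]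
      _ ≤ Real.exp (Λ * (∑ n ∈ Finset.Ico 1 m, κ n + κ m)) *
            (G 1 + ∑ n ∈ Finset.Ico 1 m, δ n) +
          Real.exp (Λ * (∑ n ∈ Finset.Ico 1 m, κ n + κ m)) * δ m := by
          have := hδ m h1 hm
          gcongr
      _ = _ := by ring

section

variable {r s : ℕ} {h k : ℝ}

/-- The rate dominates each of its summands. -/
theorem rate_bounds (hh : 0 < h) (hk : 0 ≤ k) :
    0 ≤ rate r s h k ∧ h ^ r ≤ rate r s h k ∧ (h ^ r) ^ 2 ≤ rate r s h k ^ 2 ∧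
      (h ^ (s + 1)) ^ 2 ≤ rate r s h k ^ 2 ∧ k ^ 4 ≤ rate r s h k ^ 2 ∧
      h * k ^ 3 ≤ rate r s h k ^ 2 := by
  have h1 : 0 ≤ h ^ r := by positivity
  have h2 : 0 ≤ h ^ (s + 1) := by positivity
  have h3 : 0 ≤ k ^ 2 := by positivity
  have h4 : 0 ≤ h ^ (1 / 2 : ℝ) * k ^ (3 / 2 : ℝ) := by positivity
  have h5 : (h ^ (1 / 2 : ℝ) * k ^ (3 / 2 : ℝ)) ^ 2 = h * k ^ 3 := by
    rw [mul_pow, ← Real.rpow_mul_natCast hh.le, ← Real.rpow_mul_natCast hk]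
    norm_num
  have h6 : k ^ 4 = (k ^ 2) ^ 2 := by ring
  rw [← h5, h6, rate]
  refine ⟨by positivity, by linarith, ?_, ?_, ?_, ?_⟩ <;>
    exact pow_le_pow_left₀ (by assumption) (by linarith) 2

/-- The consistency errors of one step, summed in quadrature. The product of the fluctuation `g`
with the extrapolation error is bounded by means of `κ g² ≤ c₆ h`: this is the source of the
contribution `h^{1/2} k^{3/2}` to the rate. -/
theorem consistency_sq_le {κ K a e g b c₁ c₂ c₃ c₄ c₅ c₆ : ℝ} (hh : 0 < h) (hκ : 0 < κ)
    (hκK : κ ≤ K) (hKb : K ≤ b * κ) (hKk : K ≤ 2 * k) (ha : 0 ≤ a) (hg : κ * g ^ 2 ≤ c₆ * h)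
    (hc₆ : 0 ≤ c₆) :
    κ * (c₁ * (κ⁻¹ * (h ^ r * √(K * a))) + c₂ * (K * √(K * a)) + c₃ * h ^ r
        + c₄ * (h ^ (s + 1) * e) + c₅ * (g * (K * √(K * a)))) ^ 2
      ≤ 5 * (b * c₁ ^ 2 + 16 * c₂ ^ 2 + c₃ ^ 2 + c₄ ^ 2 + 8 * c₅ ^ 2 * c₆)
        * rate r s h k ^ 2 * (a + K + K * e ^ 2) := by
  have hK : 0 < K := hκ.trans_le hκK
  have hk : 0 ≤ k := by linarith
  have hb : 0 < b := pos_of_mul_pos_left (hK.trans_le hKb) hκ.le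
  obtain ⟨-, -, r1, r2, r3, r4⟩ := rate_bounds (r := r) (s := s) hh hk
  set ρ := rate r s h k ^ 2
  have hq : √(K * a) ^ 2 = K * a := Real.sq_sqrt (by positivity)
  have hρ : 0 ≤ ρ := sq_nonneg _
  have hK3 : K ^ 3 ≤ 8 * k ^ 3 := by
    calc K ^ 3 ≤ (2 * k) ^ 3 := by gcongr
      _ = _ := by ring
  have hK4 : K ^ 4 ≤ 16 * k ^ 4 := by
    calc K ^ 4 ≤ (2 * k) ^ 4 := by gcongr
      _ = _ := by ring
  have s1 : κ * (c₁ * (κ⁻¹ * (h ^ r * √(K * a)))) ^ 2 ≤ b * c₁ ^ 2 * ρ * a := by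
    calc _ = c₁ ^ 2 * (h ^ r) ^ 2 * (κ⁻¹ * √(K * a) ^ 2) := by field_simp
      _ = c₁ ^ 2 * (h ^ r) ^ 2 * (κ⁻¹ * K * a) := by rw [hq]; ring
      _ ≤ c₁ ^ 2 * ρ * (b * a) := by
          have : κ⁻¹ * K ≤ b := by
            rw [inv_mul_le_iff₀ hκ]
            linarith
          gcongr
      _ = _ := by ring
  have s2 : κ * (c₂ * (K * √(K * a))) ^ 2 ≤ 16 * c₂ ^ 2 * ρ * a := by
    calc _ = c₂ ^ 2 * (κ * K ^ 2 * √(K * a) ^ 2) := by ring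
      _ = c₂ ^ 2 * (κ * K ^ 3 * a) := by rw [hq]; ring
      _ ≤ c₂ ^ 2 * (K * K ^ 3 * a) := by gcongr
      _ = c₂ ^ 2 * (K ^ 4 * a) := by ring
      _ ≤ c₂ ^ 2 * (16 * ρ * a) := by
          have : K ^ 4 ≤ 16 * ρ := by linarith
          gcongr
      _ = _ := by ring
  have s3 : κ * (c₃ * h ^ r) ^ 2 ≤ c₃ ^ 2 * ρ * K := by
    calc _ = c₃ ^ 2 * (h ^ r) ^ 2 * κ := by ring
      _ ≤ _ := by gcongr
  have s4 : κ * (c₄ * (h ^ (s + 1) * e)) ^ 2 ≤ c₄ ^ 2 * ρ * (K * e ^ 2) := by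
    calc _ = c₄ ^ 2 * (h ^ (s + 1)) ^ 2 * (κ * e ^ 2) := by ring
      _ ≤ _ := by gcongr
  have s5 : κ * (c₅ * (g * (K * √(K * a)))) ^ 2 ≤ 8 * c₅ ^ 2 * c₆ * ρ * a := by
    calc _ = c₅ ^ 2 * (κ * g ^ 2) * K ^ 2 * √(K * a) ^ 2 := by ring
      _ = c₅ ^ 2 * (κ * g ^ 2) * (K ^ 3 * a) := by rw [hq]; ring
      _ ≤ c₅ ^ 2 * (c₆ * h) * (8 * k ^ 3 * a) := by gcongr
      _ = 8 * c₅ ^ 2 * c₆ * (h * k ^ 3) * a := by ring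
      _ ≤ _ := by gcongr
  have five : ∀ x y z w v : ℝ, (x + y + z + w + v) ^ 2
      ≤ 5 * (x ^ 2 + y ^ 2 + z ^ 2 + w ^ 2 + v ^ 2) := fun x y z w v => by
    linarith [sq_nonneg (x - y), sq_nonneg (x - z), sq_nonneg (x - w), sq_nonneg (x - v),
      sq_nonneg (y - z), sq_nonneg (y - w), sq_nonneg (y - v), sq_nonneg (z - w),
      sq_nonneg (z - v), sq_nonneg (w - v)]
  have e0 : 0 ≤ e ^ 2 := sq_nonneg e
  have p1 : 0 ≤ b * c₁ ^ 2 * ρ := by positivity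
  have p2 : 0 ≤ 16 * c₂ ^ 2 * ρ := by positivity
  have p3 : 0 ≤ c₃ ^ 2 * ρ := by positivity
  have p4 : 0 ≤ c₄ ^ 2 * ρ := by positivity
  have p5 : 0 ≤ 8 * c₅ ^ 2 * c₆ * ρ := by positivity
  have hKe : 0 ≤ K * e ^ 2 := by positivity
  have hW : 0 ≤ (b * c₁ ^ 2 * ρ) * (K + K * e ^ 2) + (16 * c₂ ^ 2 * ρ) * (K + K * e ^ 2)
      + c₃ ^ 2 * ρ * (a + K * e ^ 2) + c₄ ^ 2 * ρ * (a + K)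
      + 8 * c₅ ^ 2 * c₆ * ρ * (K + K * e ^ 2) := by positivity
  refine (mul_le_mul_of_nonneg_left (five _ _ _ _ _) hκ.le).trans ?_
  linarith

end

/-- Young's inequality for the three parts of the right-hand side of the error estimate. -/
theorem young_step {κ ν g I x y z : ℝ} (hκ : 0 < κ) (hν : 0 < ν)
    (h : κ⁻¹ * I + ν * g ^ 2 ≤ g * (x + y + z)) :
    I + κ * ν * g ^ 2 / 2 ≤ 3 / 2 * (κ / ν) * (x ^ 2 + y ^ 2 + z ^ 2) := by
  have h1 : I + κ * ν * g ^ 2 ≤ κ * (g * (x + y + z)) := by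
    have := mul_le_mul_of_nonneg_left h hκ.le
    rw [mul_add, mul_inv_cancel_left₀ hκ.ne'] at this
    linarith
  have key : ∀ x : ℝ, κ * (g * x) ≤ κ * ν * g ^ 2 / 6 + 3 / 2 * (κ / ν) * x ^ 2 := fun x => by
    have e : κ * ν * g ^ 2 / 6 + 3 / 2 * (κ / ν) * x ^ 2 - κ * (g * x)
        = κ / (6 * ν) * (ν * g - 3 * x) ^ 2 := by
      field_simp
      ring
    have : 0 ≤ κ / (6 * ν) * (ν * g - 3 * x) ^ 2 := by positivity
    linarith
  linarith [key x, key y, key z]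

/-- The constant of the time step conditions. The first summand makes the numerical dissipation
absorb the fluctuations, the second one bounds their gradients; see `cfl_bounds`. -/
def cflConst (d : ℕ) (S θ Ci : ℝ) : ℝ :=
  48 * d ^ 2 * S ^ 3 * Ci * (2 / (1 - θ)) ^ 2 / (θ * (1 - θ ^ 2)) + 1

theorem cflConst_pos {d : ℕ} {S θ Ci : ℝ} (hS : 0 ≤ S) (hθ : θ ∈ Ioo (0 : ℝ) 1) (hCi : 0 ≤ Ci) :
    0 < cflConst d S θ Ci := by
  have h0 := hθ.1
  have h1 : 0 < 1 - θ ^ 2 := by nlinarith [hθ.2]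
  rw [cflConst]
  positivity

/-- Under the time step conditions the numerical dissipation absorbs the fluctuations, and the
gradients of the fluctuations are `O((h/k)^{1/2})`. -/
theorem cfl_bounds {d : ℕ} {S θ Ci ε κ h ν g β : ℝ} (hS : 0 ≤ S) (hCi : 0 ≤ Ci)
    (hθ : θ ∈ Ioo (0 : ℝ) 1) (hε : |ε| < 1) (hκ : 0 < κ) (hh : 0 < h) (hν : 0 < ν)
    (hβ : |β| ≤ 2 / (1 - θ))
    (hcfl : 0 ≤ 1 - cflConst d S θ Ci * ((1 + ε * θ) / (1 - ε)) ^ 2 * (κ / (h * ν)) * g ^ 2) :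
    κ * g ^ 2 ≤ ν * (2 / (1 - θ)) ^ 2 * h ∧
    3 / 2 * (κ / ν) * (2 * d * S * √(S * Ci * h⁻¹) * g * (2 * β / (1 - ε))) ^ 2
      ≤ θ * (1 - θ ^ 2) / (2 * (1 + ε * θ) ^ 2) := by
  have h1 : 0 < 1 - θ := by linarith [hθ.2]
  have h2 := (one_add_mul_pos hθ hε).1
  have hm : 0 < 1 + ε * θ := h1.trans h2
  have he : 0 < 1 - ε := by linarith [(abs_lt.1 hε).2]
  have he2 : 1 - ε ≤ 2 := by linarith [(abs_lt.1 hε).1]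
  have hθ2 : 0 < θ * (1 - θ ^ 2) := mul_pos hθ.1 (by nlinarith [hθ.1, hθ.2])
  have hβ2 : β ^ 2 ≤ (2 / (1 - θ)) ^ 2 := sq_le_sq' (by linarith [(abs_le.1 hβ).1]) (abs_le.1 hβ).2
  set m := 1 + ε * θ
  set e := 1 - ε
  obtain ⟨q, hq⟩ : ∃ q, q = κ * g ^ 2 / (h * ν) := ⟨_, rfl⟩
  have hq0 : 0 ≤ q := by rw [hq]; positivity
  have hqe : κ * g ^ 2 = q * (h * ν) := by rw [hq]; field_simp
  set Γ := 48 * d ^ 2 * S ^ 3 * Ci * (2 / (1 - θ)) ^ 2 / (θ * (1 - θ ^ 2)) with hΓ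
  have hΓ0 : 0 ≤ Γ := by positivity
  have key : (Γ + 1) * (m ^ 2 * q) ≤ e ^ 2 := by
    have h3 : (Γ + 1) * (m / e) ^ 2 * (κ / (h * ν)) * g ^ 2 = (Γ + 1) * (m ^ 2 * q) / e ^ 2 := by
      rw [hq]
      field_simp
    rw [cflConst, ← hΓ, h3] at hcfl
    exact (div_le_one (by positivity)).1 (by linarith)
  have hmq : 0 ≤ m ^ 2 * q := by positivity
  constructor
  · have h4 : m ^ 2 * q ≤ e ^ 2 := by nlinarith
    have h5 : (1 - θ) ^ 2 * q ≤ 4 := by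
      calc (1 - θ) ^ 2 * q ≤ m ^ 2 * q := by gcongr
        _ ≤ e ^ 2 := h4
        _ ≤ 2 ^ 2 := by gcongr
        _ = 4 := by norm_num
    have h6 : q ≤ (2 / (1 - θ)) ^ 2 := by
      rw [div_pow, le_div_iff₀ (by positivity)]
      linarith
    rw [hqe]
    calc q * (h * ν) ≤ (2 / (1 - θ)) ^ 2 * (h * ν) := by gcongr
      _ = _ := by ring
  · have h7 : Γ * (m ^ 2 * q) ≤ e ^ 2 := by linarith
    have h8 : (2 * d * S * √(S * Ci * h⁻¹) * g * (2 * β / e)) ^ 2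
        = 16 * d ^ 2 * S ^ 3 * Ci * β ^ 2 * g ^ 2 / (h * e ^ 2) := by
      rw [mul_pow, mul_pow, mul_pow, Real.sq_sqrt (by positivity)]
      field_simp
      ring
    have h9 : 3 / 2 * (κ / ν) * (16 * d ^ 2 * S ^ 3 * Ci * β ^ 2 * g ^ 2 / (h * e ^ 2))
        = 24 * d ^ 2 * S ^ 3 * Ci * β ^ 2 * q / e ^ 2 := by
      rw [hq]
      field_simp
      ring
    rw [h8, h9, div_le_div_iff₀ (by positivity) (by positivity)]
    have h10 : Γ * (θ * (1 - θ ^ 2)) = 48 * d ^ 2 * S ^ 3 * Ci * (2 / (1 - θ)) ^ 2 := by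
      rw [hΓ, div_mul_cancel₀ _ hθ2.ne']
    calc 24 * d ^ 2 * S ^ 3 * Ci * β ^ 2 * q * (2 * m ^ 2)
        ≤ 24 * d ^ 2 * S ^ 3 * Ci * (2 / (1 - θ)) ^ 2 * q * (2 * m ^ 2) := by gcongr
      _ = Γ * (θ * (1 - θ ^ 2)) * (m ^ 2 * q) := by rw [h10]; ring
      _ = θ * (1 - θ ^ 2) * (Γ * (m ^ 2 * q)) := by ring
      _ ≤ _ := by gcongr

/-! ### The energy recursion -/

section

variable {B : Type} [NormedAddCommGroup B] [NormedSpace ℝ B] {θ : ℝ} {t : ℕ → ℝ} {n : ℕ}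

theorem norm_betaComb_le (hθ : θ ∈ Ioo (0 : ℝ) 1) (hk : 0 < step t n) (hl : 0 < step t (n - 1))
    {z : ℕ → B} {M : ℝ} (hz : ∀ m, n - 1 ≤ m → m ≤ n + 1 → ‖z m‖ ≤ M) :
    ‖betaComb θ t z n‖ ≤ 3 * (2 / (1 - θ)) * M := by
  obtain ⟨-, h2, h1, h0⟩ := abs_beta_le hθ (abs_eps_lt_one hk hl)
  have hb := (abs_nonneg _).trans h2
  calc _ ≤ ‖beta2 θ (eps t n) • z (n + 1)‖ + ‖beta1 θ (eps t n) • z n‖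
        + ‖beta0 θ (eps t n) • z (n - 1)‖ := norm_add₃_le
    _ ≤ 2 / (1 - θ) * M + 2 / (1 - θ) * M + 2 / (1 - θ) * M := by
        rw [norm_smul, norm_smul, norm_smul]
        simp only [Real.norm_eq_abs]
        gcongr
        · exact hz _ (by omega) le_rfl
        · exact hz _ (by omega) (by omega)
        · exact hz _ le_rfl (by omega)
    _ = _ := by ring

theorem norm_starComb_le {CU : ℝ} (hθ : θ ∈ Ioo (0 : ℝ) 1) (hn : 1 ≤ n) (hk : 0 < step t n)
    (hl : 0 < step t (n - 1)) (hCU : step t n / step t (n - 1) < CU) (z : ℕ → B) :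
    ‖starComb θ t z n‖ ≤ 2 / (1 - θ) * (2 + CU) * (‖z n‖ + ‖z (n - 1)‖) := by
  obtain ⟨-, -, h1, h0⟩ := star_coeff hθ hn hk hl hCU
  calc _ ≤ ‖_ • z n‖ + ‖_ • z (n - 1)‖ := norm_add_le _ _
    _ ≤ 2 / (1 - θ) * (2 + CU) * ‖z n‖ + 2 / (1 - θ) * (2 + CU) * ‖z (n - 1)‖ := by
        rw [norm_smul, norm_smul]
        simp only [Real.norm_eq_abs]
        gcongr
    _ = _ := by ring

end

section

variable {d : ℕ} {Ω : Set (EuclideanSpace ℝ (Fin d))}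

/-- The discrete energy of the `G`-stability identity. -/
def energy (θ : ℝ) (φ : ℕ → X Ω) (n : ℕ) : ℝ :=
  (1 + θ) / 4 * ‖fld (φ n)‖ ^ 2 + (1 - θ) / 4 * ‖fld (φ (n - 1))‖ ^ 2

/-- The numerical dissipation of the `G`-stability identity, up to its coefficient. -/
def dissip (t : ℕ → ℝ) (φ : ℕ → X Ω) (n : ℕ) : ℝ :=
  ‖((1 - eps t n) / 2) • fld (φ (n + 1)) - fld (φ n) + ((1 + eps t n) / 2) • fld (φ (n - 1))‖

variable {θ : ℝ} {t : ℕ → ℝ} {n : ℕ}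

theorem energy_nonneg (hθ : θ ∈ Ioo (0 : ℝ) 1) (φ : ℕ → X Ω) (n : ℕ) : 0 ≤ energy θ φ n := by
  have h1 : 0 ≤ 1 + θ := by linarith [hθ.1]
  have h2 : 0 ≤ 1 - θ := by linarith [hθ.2]
  rw [energy]
  positivity

/-- The `G`-stability identity for the energies of a sequence. -/
theorem inner_alphaComb_betaComb (hθ : θ ∈ Ioo (0 : ℝ) 1) (hk : 0 < step t n)
    (hl : 0 < step t (n - 1)) (φ : ℕ → X Ω) :
    ⟪fld (alphaComb θ φ n), fld (betaComb θ t φ n)⟫ = energy θ φ (n + 1) - energy θ φ n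
      + θ * (1 - θ ^ 2) / (2 * (1 + eps t n * θ) ^ 2) * dissip t φ n ^ 2 := by
  have h := one_add_mul_pos hθ (abs_eps_lt_one hk hl)
  have hne : 1 + eps t n * θ ≠ 0 := by linarith [h.1, hθ.2]
  simp only [alphaComb, betaComb, map_add, map_smul]
  rw [inner_alpha_beta hne, energy, energy, dissip, Nat.add_sub_cancel]

theorem norm_fld_betaComb_sub_starComb (hk : 0 < step t n) (hl : 0 < step t (n - 1))
    (φ : ℕ → X Ω) :
    ‖fld (betaComb θ t φ n - starComb θ t φ n)‖
      = |2 * beta2 θ (eps t n) / (1 - eps t n)| * dissip t φ n := by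
  rw [betaComb_sub_starComb hk hl, map_smul, norm_smul, Real.norm_eq_abs, map_add, map_sub,
    map_smul, map_smul, dissip]

/-- The extrapolation uses old time levels only, so that the energy before the step controls it. -/
theorem norm_fld_starComb_sq_le {CU : ℝ} (hθ : θ ∈ Ioo (0 : ℝ) 1) (hn : 1 ≤ n)
    (hk : 0 < step t n) (hl : 0 < step t (n - 1)) (hCU : step t n / step t (n - 1) < CU)
    (φ : ℕ → X Ω) :
    ‖fld (starComb θ t φ n)‖ ^ 2
      ≤ 8 * (2 / (1 - θ) * (2 + CU)) ^ 2 / (1 - θ) * energy θ φ n := by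
  have h := norm_starComb_le hθ hn hk hl hCU (fun m => fld (φ m))
  have e : fld (starComb θ t φ n) = starComb θ t (fun m => fld (φ m)) n := by
    simp only [starComb, map_add, map_smul]
  rw [← e] at h
  have h1 : 0 < 1 - θ := by linarith [hθ.2]
  set γ := 2 / (1 - θ) * (2 + CU)
  have h2 : ‖fld (φ n)‖ ^ 2 + ‖fld (φ (n - 1))‖ ^ 2 ≤ 4 / (1 - θ) * energy θ φ n := by
    have e2 : 4 / (1 - θ) * energy θ φ n
        = (1 + θ) / (1 - θ) * ‖fld (φ n)‖ ^ 2 + ‖fld (φ (n - 1))‖ ^ 2 := by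
      rw [energy]
      field_simp
    have h3 : 1 ≤ (1 + θ) / (1 - θ) := by
      rw [le_div_iff₀ h1]
      linarith [hθ.1]
    rw [e2]
    have := mul_le_mul_of_nonneg_right h3 (sq_nonneg ‖fld (φ n)‖)
    linarith
  calc _ ≤ (γ * (‖fld (φ n)‖ + ‖fld (φ (n - 1))‖)) ^ 2 :=
        pow_le_pow_left₀ (norm_nonneg _) h 2
    _ ≤ 2 * γ ^ 2 * (‖fld (φ n)‖ ^ 2 + ‖fld (φ (n - 1))‖ ^ 2) := by
        have := mul_nonneg (sq_nonneg γ) (sq_nonneg (‖fld (φ n)‖ - ‖fld (φ (n - 1))‖))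
        linarith
    _ ≤ 2 * γ ^ 2 * (4 / (1 - θ) * energy θ φ n) := by gcongr
    _ = _ := by ring

/-- From the error estimate to the recursion for the discrete energy. The numerical dissipation of
the `G`-stability identity absorbs the term with the difference of interpolation and
extrapolation. -/
theorem energy_recursion {S Ci CU ν h g A Bφ : ℝ} (hS : 0 ≤ S) (hCi : 0 ≤ Ci)
    (hθ : θ ∈ Ioo (0 : ℝ) 1) (hn : 1 ≤ n) (hk : 0 < step t n) (hl : 0 < step t (n - 1))
    (hCU : step t n / step t (n - 1) < CU) (hh : 0 < h) (hν : 0 < ν) (φ : ℕ → X Ω)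
    (hcfl : 0 ≤ 1 - cflConst d S θ Ci * ((1 + eps t n * θ) / (1 - eps t n)) ^ 2
      * (khat θ t n / (h * ν)) * g ^ 2)
    (hest : ⟪(khat θ t n)⁻¹ • fld (alphaComb θ φ n), fld (betaComb θ t φ n)⟫
        + ν * gradNorm (betaComb θ t φ n) ^ 2
      ≤ gradNorm (betaComb θ t φ n) * (A + Bφ * ‖fld (starComb θ t φ n)‖
        + 2 * d * S * √(S * Ci * h⁻¹) * g * ‖fld (betaComb θ t φ n - starComb θ t φ n)‖)) :
    energy θ φ (n + 1) + khat θ t n * ν * gradNorm (betaComb θ t φ n) ^ 2 / 2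
      ≤ (1 + 3 / 2 * ν⁻¹ * Bφ ^ 2 * (8 * (2 / (1 - θ) * (2 + CU)) ^ 2 / (1 - θ)) * khat θ t n)
          * energy θ φ n + 3 / 2 * ν⁻¹ * (khat θ t n * A ^ 2) := by
  have hε := abs_eps_lt_one hk hl
  obtain ⟨-, -, hκ⟩ := khat_bounds hθ hk hl
  have h1 := (cfl_bounds hS hCi hθ hε hκ hh hν (abs_beta_le hθ hε).2.1 hcfl).2
  rw [real_inner_smul_left] at hest
  have h2 := young_step hκ hν hest
  rw [inner_alphaComb_betaComb hθ hk hl] at h2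
  have h3 : 3 / 2 * (khat θ t n / ν) * (2 * d * S * √(S * Ci * h⁻¹) * g *
      ‖fld (betaComb θ t φ n - starComb θ t φ n)‖) ^ 2
      ≤ θ * (1 - θ ^ 2) / (2 * (1 + eps t n * θ) ^ 2) * dissip t φ n ^ 2 := by
    rw [norm_fld_betaComb_sub_starComb hk hl]
    calc _ = 3 / 2 * (khat θ t n / ν) * (2 * d * S * √(S * Ci * h⁻¹) * g *
          (2 * beta2 θ (eps t n) / (1 - eps t n))) ^ 2 * dissip t φ n ^ 2 := by
          rw [mul_pow _ (|_| * _), mul_pow (|_|), sq_abs]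
          ring
      _ ≤ _ := mul_le_mul_of_nonneg_right h1 (sq_nonneg _)
  have h4 : 3 / 2 * (khat θ t n / ν) * (Bφ * ‖fld (starComb θ t φ n)‖) ^ 2
      ≤ 3 / 2 * ν⁻¹ * Bφ ^ 2 * (8 * (2 / (1 - θ) * (2 + CU)) ^ 2 / (1 - θ)) * khat θ t n
        * energy θ φ n := by
    calc _ = 3 / 2 * ν⁻¹ * Bφ ^ 2 * khat θ t n * ‖fld (starComb θ t φ n)‖ ^ 2 := by
          rw [mul_pow, div_eq_mul_inv]
          ring
      _ ≤ 3 / 2 * ν⁻¹ * Bφ ^ 2 * khat θ t n *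
          (8 * (2 / (1 - θ) * (2 + CU)) ^ 2 / (1 - θ) * energy θ φ n) :=
          mul_le_mul_of_nonneg_left (norm_fld_starComb_sq_le hθ hn hk hl hCU φ) (by positivity)
      _ = _ := by ring
  have h5 : 3 / 2 * (khat θ t n / ν) * A ^ 2 = 3 / 2 * ν⁻¹ * (khat θ t n * A ^ 2) := by
    rw [div_eq_mul_inv]
    ring
  rw [mul_add, mul_add, h5] at h2
  linarith

end

/-! ### One step of the scheme -/

section

variable {d : ℕ} {Ω : Set (EuclideanSpace ℝ (Fin d))}

theorem alphaComb_mem_V {θ : ℝ} {z : ℕ → X Ω} {n : ℕ} (h₂ : z (n + 1) ∈ V Ω) (h₁ : z n ∈ V Ω)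
    (h₀ : z (n - 1) ∈ V Ω) : alphaComb θ z n ∈ V Ω :=
  add_mem_V (add_mem_V (smul_mem_V _ h₂) (smul_mem_V _ h₁)) (smul_mem_V _ h₀)

theorem betaComb_mem_V {θ : ℝ} {t : ℕ → ℝ} {z : ℕ → X Ω} {n : ℕ} (h₂ : z (n + 1) ∈ V Ω)
    (h₁ : z n ∈ V Ω) (h₀ : z (n - 1) ∈ V Ω) : betaComb θ t z n ∈ V Ω :=
  add_mem_V (add_mem_V (smul_mem_V _ h₂) (smul_mem_V _ h₁)) (smul_mem_V _ h₀)

theorem starComb_mem_V {θ : ℝ} {t : ℕ → ℝ} {z : ℕ → X Ω} {n : ℕ} (h₁ : z n ∈ V Ω)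
    (h₀ : z (n - 1) ∈ V Ω) : starComb θ t z n ∈ V Ω :=
  add_mem_V (smul_mem_V _ h₁) (smul_mem_V _ h₀)

/-- Two sequences with the same underlying functions have combinations with the same underlying
functions. -/
theorem toL2_comb_eq {r n : ℕ} {θ : ℝ} {t : ℕ → ℝ}
    {y : ℕ → Hs Ω (EuclideanSpace ℝ (Fin d)) r} {z : ℕ → X Ω}
    (h₂ : Hs.toL2 (y (n + 1)) = fld (z (n + 1))) (h₁ : Hs.toL2 (y n) = fld (z n))
    (h₀ : Hs.toL2 (y (n - 1)) = fld (z (n - 1))) :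
    Hs.toL2 (alphaComb θ y n) = fld (alphaComb θ z n) ∧
      Hs.toL2 (betaComb θ t y n) = fld (betaComb θ t z n) ∧
      Hs.toL2 (starComb θ t y n) = fld (starComb θ t z n) := by
  simp only [alphaComb, betaComb, starComb, map_add, map_smul, h₂, h₁, h₀, and_self]

theorem toL2_sub_eq {r : ℕ} {Y Z : Hs Ω (EuclideanSpace ℝ (Fin d)) r} {y z : X Ω}
    (h₁ : Hs.toL2 Y = fld y) (h₂ : Hs.toL2 Z = fld z) : Hs.toL2 (Y - Z) = fld (y - z) :=
  (map_sub Hs.toL2 Y Z).trans ((congrArg₂ (· - ·) h₁ h₂).trans (map_sub fld y z).symm)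

/-- Bounding `y - z` by its representative of higher regularity. -/
theorem norm_sub_le_of_toL2_eq (hΩ : IsOpen Ω) {r : ℕ}
    {Y Z : Hs Ω (EuclideanSpace ℝ (Fin d)) (r + 1)} {y z : X Ω} {B : ℝ}
    (h₁ : Hs.toL2 Y = fld y) (h₂ : Hs.toL2 Z = fld z) (h : ‖Y - Z‖ ≤ B) :
    ‖y - z‖ ≤ B :=
  (Hs.norm_le_of_toL2_eq hΩ (Nat.le_add_left 1 r) (toL2_sub_eq h₁ h₂)).trans h

set_option maxHeartbeats 4000000 in
/-- Projection and interpolation errors of an exact solution in one step. The hypothesis `hproj` is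
the approximation property of the projection `P` on `V`, with `η` of order `h^r`. -/
theorem TimeBounds.proj_errors {θ T CU CL M A : ℝ} {N n : ℕ} {t : ℕ → ℝ} {r : ℕ} {u : ℝ → X Ω}
    {ut : ℝ → L2 Ω (EuclideanSpace ℝ (Fin d))}
    {U : ℝ → Hs Ω (EuclideanSpace ℝ (Fin d)) (r + 1)} {a : ℕ → ℝ}
    (tb : TimeBounds θ T (3 * (2 / (1 - θ) * (2 + CU))) M A N t u ut U a) (hΩ : IsOpen Ω)
    (hθ : θ ∈ Ioo (0 : ℝ) 1) (hCU : 0 < CU) (hM : 0 ≤ M) (hg : IsGrid T N t)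
    (hr : RatioBounds CL CU N t) (hn : 1 ≤ n) (hnN : n + 1 ≤ N)
    (hV : ∀ x ∈ Icc 0 T, u x ∈ V Ω) {P : X Ω →ₗ[ℝ] X Ω} {η : ℝ} (hη : 0 ≤ η)
    (hproj : ∀ v ∈ V Ω, ∀ W : Hs Ω (EuclideanSpace ℝ (Fin d)) (r + 1), Hs.toL2 W = fld v →
      ‖v - P v‖ ≤ η * ‖W‖) :
    ‖alphaComb θ (fun m => u (t m)) n - P (alphaComb θ (fun m => u (t m)) n)‖
        ≤ η * (3 * (2 / (1 - θ) * (2 + CU)) * √((step t n + step t (n - 1)) * a n)) ∧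
      ‖betaComb θ t (fun m => u (t m)) n - P (betaComb θ t (fun m => u (t m)) n)‖
        ≤ η * (3 * (2 / (1 - θ) * (2 + CU)) * M) ∧
      ‖starComb θ t (fun m => u (t m)) n - P (starComb θ t (fun m => u (t m)) n)‖
        ≤ η * (3 * (2 / (1 - θ) * (2 + CU)) * M) ∧
      ‖betaComb θ t (fun m => u (t m)) n - u (tbeta θ t n)‖
        ≤ 3 * (2 / (1 - θ) * (2 + CU)) * (step t n + step t (n - 1))
          * √((step t n + step t (n - 1)) * a n) ∧
      ‖starComb θ t (fun m => u (t m)) n - u (tbeta θ t n)‖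
        ≤ 3 * (2 / (1 - θ) * (2 + CU)) * (step t n + step t (n - 1))
          * √((step t n + step t (n - 1)) * a n) ∧
      ∃ Ub : Hs Ω (EuclideanSpace ℝ (Fin d)) (r + 1),
        Hs.toL2 Ub = fld (betaComb θ t (fun m => u (t m)) n) ∧
        ‖Ub‖ ≤ 3 * (2 / (1 - θ) * (2 + CU)) * M := by
  have hmem : ∀ m, n - 1 ≤ m → m ≤ n + 1 → t m ∈ Icc 0 T := fun m _ h2 =>
    hg.mem_Icc (by omega)
  have m2 := hmem (n + 1) (by omega) le_rfl
  have m1 := hmem n (by omega) (by omega)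
  have m0 := hmem (n - 1) le_rfl (by omega)
  have e2 := tb.toL2 _ m2
  have e1 := tb.toL2 _ m1
  have e0 := tb.toL2 _ m0
  have hk : 0 < step t n := hg.step_pos hnN
  have hl : 0 < step t (n - 1) := hg.step_pos (by omega)
  obtain ⟨eUa, eUb, eUs⟩ := toL2_comb_eq (θ := θ) (t := t) (y := fun m => U (t m))
    (z := fun m => u (t m)) e2 e1 e0
  have hb : 0 ≤ 2 / (1 - θ) := div_nonneg zero_le_two (by linarith [hθ.2])
  have hUbM : ‖betaComb θ t (fun m => U (t m)) n‖ ≤ 3 * (2 / (1 - θ) * (2 + CU)) * M := by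
    refine (norm_betaComb_le hθ hk hl fun m h1 h2 => tb.norm_le _ (hmem m h1 h2)).trans ?_
    have := le_mul_of_one_le_right hb (by linarith : 1 ≤ 2 + CU)
    gcongr
  have hUsM : ‖starComb θ t (fun m => U (t m)) n‖ ≤ 3 * (2 / (1 - θ) * (2 + CU)) * M := by
    refine (norm_starComb_le hθ hn hk hl (hr n hn hnN).2 _).trans ?_
    have h1 := tb.norm_le _ m1
    have h0 := tb.norm_le _ m0
    have h3 : 0 ≤ 2 / (1 - θ) * (2 + CU) := by positivity
    calc _ ≤ 2 / (1 - θ) * (2 + CU) * (M + M) := by gcongr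
      _ ≤ _ := by linarith [mul_nonneg h3 hM]
  have hτ := Ioo_subset_Icc_self (hg.tbeta_mem_Ioo hθ hn hnN)
  have eτ := tb.toL2 _ hτ
  have v2 := hV _ m2
  have v1 := hV _ m1
  have v0 := hV _ m0
  refine ⟨?_, ?_, ?_, ?_, ?_, _, eUb, hUbM⟩
  · exact (hproj _ (alphaComb_mem_V v2 v1 v0) _ eUa).trans
      (mul_le_mul_of_nonneg_left (tb.alpha n hn hnN) hη)
  · exact (hproj _ (betaComb_mem_V v2 v1 v0) _ eUb).trans (mul_le_mul_of_nonneg_left hUbM hη)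
  · exact (hproj _ (starComb_mem_V v1 v0) _ eUs).trans (mul_le_mul_of_nonneg_left hUsM hη)
  · exact norm_sub_le_of_toL2_eq hΩ eUb eτ (tb.beta n hn hnN)
  · exact norm_sub_le_of_toL2_eq hΩ eUs eτ (tb.star n hn hnN)

/-- Membership of the discrete combinations. -/
theorem IsDLNEnsemble.mem {θ ν : ℝ} {N n : ℕ} {t : ℕ → ℝ} {Xh : Submodule ℝ (X Ω)}
    {Qh : Submodule ℝ (L2 Ω ℝ)} {J : ℕ} {f : Fin J → ℝ → StrongDual ℝ (X Ω)}
    {uh : Fin J → ℕ → X Ω} {ph : Fin J → ℕ → L2 Ω ℝ}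
    (hdln : IsDLNEnsemble θ ν N t Xh Qh f uh ph) (j : Fin J) (hn : 1 ≤ n) (hnN : n + 1 ≤ N) :
    betaComb θ t (uh j) n ∈ discreteV Xh Qh ∧ starComb θ t (uh j) n ∈ Xh ∧
      betaComb θ t (ph j) n ∈ Qh := by
  have x2 := hdln.mem_X j (n + 1) hnN
  have x1 := hdln.mem_X j n (by omega)
  have x0 := hdln.mem_X j (n - 1) (by omega)
  refine ⟨mem_discreteV.2 ⟨?_, hdln.incompressible j n hn hnN⟩, ?_, ?_⟩
  · exact Xh.add_mem (Xh.add_mem (Xh.smul_mem _ x2) (Xh.smul_mem _ x1)) (Xh.smul_mem _ x0)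
  · exact Xh.add_mem (Xh.smul_mem _ x1) (Xh.smul_mem _ x0)
  · exact Qh.add_mem (Qh.add_mem (Qh.smul_mem _ (hdln.mem_Q j (n + 1) hnN))
      (Qh.smul_mem _ (hdln.mem_Q j n (by omega))))
      (Qh.smul_mem _ (hdln.mem_Q j (n - 1) (by omega)))

/-- The weak equations of an exact solution and of the scheme, tested with a discretely
divergence-free function. -/
theorem weak_equations {S : ℝ} (hS : SobolevBounds Ω S) (hΩ : IsOpen Ω)
    (hΩb : Bornology.IsBounded Ω) {θ ν T : ℝ} (hθ : θ ∈ Ioo (0 : ℝ) 1) {N n : ℕ} {t : ℕ → ℝ}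
    (hg : IsGrid T N t) {Xh : Submodule ℝ (X Ω)} {Qh : Submodule ℝ (L2 Ω ℝ)} {J : ℕ} {u₀ : X Ω}
    {f : Fin J → ℝ → StrongDual ℝ (X Ω)} {u : ℝ → X Ω}
    {ut : ℝ → L2 Ω (EuclideanSpace ℝ (Fin d))} {p : ℝ → L2 Ω ℝ} {uh : Fin J → ℕ → X Ω}
    {ph : Fin J → ℕ → L2 Ω ℝ} (j : Fin J) (hsol : IsNSESolution ν T u₀ (f j) u ut p)
    (hdln : IsDLNEnsemble θ ν N t Xh Qh f uh ph) (hn : 1 ≤ n) (hnN : n + 1 ≤ N) {v : X Ω}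
    (hv : v ∈ discreteV Xh Qh) :
    ⟪ut (tbeta θ t n), fld v⟫ + b (u (tbeta θ t n)) (u (tbeta θ t n)) v
        + ν * gradInner (u (tbeta θ t n)) v - divPair (p (tbeta θ t n)) v
      = f j (tbeta θ t n) v ∧
    ⟪(khat θ t n)⁻¹ • fld (alphaComb θ (uh j) n), fld v⟫
        + b (starComb θ t (uh j) n - (starComb θ t (uh j) n - starComb θ t (ensMean uh) n))
          (betaComb θ t (uh j) n) v
        + ν * gradInner (betaComb θ t (uh j) n) v
      = f j (tbeta θ t n) v
        - b (starComb θ t (uh j) n - starComb θ t (ensMean uh) n) (starComb θ t (uh j) n) v := by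
  have hτ := hg.tbeta_mem_Ioo hθ hn hnN
  obtain ⟨hvX, hvQ⟩ := mem_discreteV.1 hv
  constructor
  · rw [← hS.conv_eq_b hΩ hΩb (hsol.div_free _ (Ioo_subset_Icc_self hτ))]
    exact hsol.momentum _ hτ v
  · have h1 := hdln.momentum j n hn hnN v hvX
    rw [hvQ _ (hdln.mem j hn hnN).2.2, sub_zero] at h1
    rw [sub_sub_cancel]
    exact h1

end

section

variable {d : ℕ} {Ω : Set (EuclideanSpace ℝ (Fin d))}

theorem norm_sub_le_of_norm_sub_le {E : Type*} [SeminormedAddCommGroup E] {x y z : E} {α β : ℝ}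
    (h₁ : ‖x - y‖ ≤ α) (h₂ : ‖x - z‖ ≤ β) : ‖y - z‖ ≤ α + β :=
  (norm_sub_le_norm_sub_add_norm_sub y x z).trans (add_le_add (norm_sub_rev x y ▸ h₁) h₂)

set_option maxHeartbeats 1000000 in
/-- The tested error equation of one step in terms of the projection and interpolation errors. -/
theorem IsFEPair.tested_error_le {r s : ℕ} {Capp Cinv Cis h S : ℝ} {Xh : Submodule ℝ (X Ω)}
    {Qh : Submodule ℝ (L2 Ω ℝ)} (hfe : IsFEPair r s Capp Cinv Cis h Xh Qh)
    {P : X Ω →ₗ[ℝ] X Ω} (hP : IsProj Xh Qh P) (hS : SobolevBounds Ω S) (hΩ : IsOpen Ω)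
    (hr : 1 ≤ r) (hh : h ∈ Ioc (0 : ℝ) 1) {κ ν F Cp c q K B : ℝ} (hκ : 0 < κ) (hν : 0 < ν)
    (hCp : 0 ≤ Cp) (hB : 0 ≤ B)
    {ut : L2 Ω (EuclideanSpace ℝ (Fin d))} {uτ ua ub us uha uhb uhs w : X Ω} {wp : Hs Ω ℝ (s + 1)}
    (hwp : Hs.toL2 wp ∈ Q Ω) (huhb : uhb ∈ discreteV Xh Qh) (huhs : uhs ∈ Xh)
    (hnse : ⟪ut, fld (P ub - uhb)⟫ + b uτ uτ (P ub - uhb) + ν * gradInner uτ (P ub - uhb)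
      - divPair (Hs.toL2 wp) (P ub - uhb) = F)
    (hsch : ⟪κ⁻¹ • fld uha, fld (P ub - uhb)⟫ + b (uhs - w) uhb (P ub - uhb)
      + ν * gradInner uhb (P ub - uhb) = F - b w uhs (P ub - uhb))
    (htr : ∀ v : X Ω, |⟪κ⁻¹ • fld ua - ut, fld v⟫| ≤ c * K * q * gradNorm v)
    (ha : ‖ua - P ua‖ ≤ Cp * h ^ r * (c * q)) (hb : ‖ub - P ub‖ ≤ Cp * h ^ r * B)
    (hs : ‖us - P us‖ ≤ Cp * h ^ r * B) (hbτ : ‖ub - uτ‖ ≤ c * K * q)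
    (hsτ : ‖us - uτ‖ ≤ c * K * q) (Ub : Hs Ω (EuclideanSpace ℝ (Fin d)) (r + 1))
    (hUb : Hs.toL2 Ub = fld ub) (hUbB : ‖Ub‖ ≤ B) (hτB : ‖uτ‖ ≤ B) :
    ⟪κ⁻¹ • fld (P ua - uha), fld (P ub - uhb)⟫ + ν * gradNorm (P ub - uhb) ^ 2
      ≤ gradNorm (P ub - uhb) *
        ((S * Cp * c * (κ⁻¹ * (h ^ r * q))
            + (c + (ν + 2 * (d * S ^ 3 * B)) * c) * (K * q)
            + (ν + 2 * (d * S ^ 3 * B)) * (Cp * B) * h ^ r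
            + d * |Capp| * (h ^ (s + 1) * ‖wp‖)
            + 2 * c * (d * S ^ 4) * (gradNorm w * (K * q)))
          + (d * S * (S ^ 2 + 1) * B + d * S ^ 4 * |Cinv| * (Cp * B)) * ‖fld (P us - uhs)‖
          + 2 * d * S * √(S * |Cinv| * h⁻¹) * gradNorm w
            * ‖fld ((P ub - uhb) - (P us - uhs))‖) := by
  have hvV : P ub - uhb ∈ discreteV Xh Qh := Submodule.sub_mem _ (hP.mem ub) huhb
  have hsX : P us - uhs ∈ Xh := Submodule.sub_mem _ (mem_discreteV.1 (hP.mem us)).1 huhs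
  have hinv : ∀ x ∈ Xh, gradNorm x ≤ |Cinv| * h⁻¹ * ‖fld x‖ := fun x hx => by
    refine (hfe.inverse x hx).trans ?_
    have := inv_pos.2 hh.1
    gcongr
    exact le_abs_self _
  have hub : ‖ub‖ ≤ B := (Hs.norm_le_of_toL2_eq hΩ (Nat.le_add_left 1 r) hUb).trans hUbB
  have hbd : ‖ub - us‖ ≤ 2 * (c * K * q) := by
    have h1 := norm_sub_rev ub uτ ▸ hbτ
    have h2 := norm_sub_rev us uτ ▸ hsτ
    exact (norm_sub_le_of_norm_sub_le h1 h2).trans_eq (two_mul _).symm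
  have hh' : h ^ r ≤ h := by
    simpa using pow_le_pow_of_le_one hh.1.le hh.2 hr
  refine (error_estimate hS hΩ hκ hν hnse hsch hh.1 (abs_nonneg Cinv) (htr _) ha
    (norm_sub_le_of_norm_sub_le hb hbτ) (norm_sub_le_of_norm_sub_le hs hsτ)
    (hfe.abs_divPair_le hh.1 wp rfl hwp hvV) ((hP.norm_le ub).trans hub) hτB
    (Hs.incl (by omega) Ub) hUb ((Hs.norm_incl_le _ _).trans hUbB)
    (Cη := Cp * B) (hb.trans ?_) (D := 2 * (c * K * q)) ?_ (hinv _ hsX)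
    (hinv _ (Submodule.sub_mem _ (mem_discreteV.1 hvV).1 hsX))).trans_eq ?_
  · calc Cp * h ^ r * B ≤ Cp * h * B := by gcongr
      _ = _ := by ring
  · rw [← map_sub P ub us]
    exact (hP.norm_le _).trans hbd
  · ring

theorem comb_map_sub (P : X Ω →ₗ[ℝ] X Ω) (z y : ℕ → X Ω) (θ : ℝ) (t : ℕ → ℝ) (n : ℕ) :
    alphaComb θ (fun m => P (z m) - y m) n = P (alphaComb θ z n) - alphaComb θ y n ∧
      betaComb θ t (fun m => P (z m) - y m) n = P (betaComb θ t z n) - betaComb θ t y n ∧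
      starComb θ t (fun m => P (z m) - y m) n = P (starComb θ t z n) - starComb θ t y n := by
  refine ⟨?_, ?_, ?_⟩
  · simp only [alphaComb, map_add, map_smul]
    module
  · simp only [betaComb, map_add, map_smul]
    module
  · simp only [starComb, map_add, map_smul]
    module

end

section

variable {d : ℕ} {Ω : Set (EuclideanSpace ℝ (Fin d))}

set_option maxHeartbeats 1000000 in
/-- The tested error equation of one step for the error `φ = P u - u^h` of one member of the
ensemble. -/
theorem tested_error_step {S : ℝ} (hS : SobolevBounds Ω S) (hΩ : IsOpen Ω)
    (hΩb : Bornology.IsBounded Ω) {θ : ℝ} (hθ : θ ∈ Ioo (0 : ℝ) 1) {r s : ℕ} (hr1 : 1 ≤ r)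
    {Capp Cinv Cis CL CU ν T M A h : ℝ} (hCis : 0 < Cis) (hCU : 0 < CU) (hν : 0 < ν)
    (hM : 0 ≤ M) (hh : h ∈ Ioc (0 : ℝ) 1) {Xh : Submodule ℝ (X Ω)} {Qh : Submodule ℝ (L2 Ω ℝ)}
    {P : X Ω →ₗ[ℝ] X Ω} (hfe : IsFEPair r s Capp Cinv Cis h Xh Qh) (hP : IsProj Xh Qh P) {N : ℕ}
    {t : ℕ → ℝ} (hg : IsGrid T N t) (hr : RatioBounds CL CU N t) {J : ℕ} {u₀ : X Ω}
    {f : Fin J → ℝ → StrongDual ℝ (X Ω)} {u : ℝ → X Ω}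
    {ut : ℝ → L2 Ω (EuclideanSpace ℝ (Fin d))} {p : ℝ → L2 Ω ℝ}
    {U : ℝ → Hs Ω (EuclideanSpace ℝ (Fin d)) (r + 1)} {a : ℕ → ℝ}
    {uh : Fin J → ℕ → X Ω} {ph : Fin J → ℕ → L2 Ω ℝ} (j : Fin J)
    (hsol : IsNSESolution ν T u₀ (f j) u ut p) {Cp c : ℝ}
    (hCp : Cp = (1 + d * S / Cis) * |Capp|) (hc : c = 3 * (2 / (1 - θ) * (2 + CU)))
    (tb : TimeBounds θ T (3 * (2 / (1 - θ) * (2 + CU))) M A N t u ut U a)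
    (hdln : IsDLNEnsemble θ ν N t Xh Qh f uh ph) {n : ℕ} (hn : 1 ≤ n) (hnN : n + 1 ≤ N)
    (w : Hs Ω ℝ (s + 1)) (hw : Hs.toL2 w = p (tbeta θ t n)) {K q g : ℝ}
    (hK : K = step t n + step t (n - 1)) (hq : q = √(K * a n))
    (hgw : g = gradNorm (starComb θ t (uh j) n - starComb θ t (ensMean uh) n))
    {φ : ℕ → X Ω} (hφ : φ = fun m => P (u (t m)) - uh j m) :
    ⟪(khat θ t n)⁻¹ • fld (alphaComb θ φ n), fld (betaComb θ t φ n)⟫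
        + ν * gradNorm (betaComb θ t φ n) ^ 2
      ≤ gradNorm (betaComb θ t φ n) *
        ((S * Cp * c * ((khat θ t n)⁻¹ * (h ^ r * q))
            + (c + (ν + 2 * (d * S ^ 3 * (c * M))) * c) * (K * q)
            + (ν + 2 * (d * S ^ 3 * (c * M))) * (Cp * (c * M)) * h ^ r
            + d * |Capp| * (h ^ (s + 1) * ‖w‖)
            + 2 * c * (d * S ^ 4) * (g * (K * q)))
          + (d * S * (S ^ 2 + 1) * (c * M) + d * S ^ 4 * |Cinv| * (Cp * (c * M)))
            * ‖fld (starComb θ t φ n)‖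
          + 2 * d * S * √(S * |Cinv| * h⁻¹) * g
            * ‖fld (betaComb θ t φ n - starComb θ t φ n)‖) := by
  have hS0 := hS.nonneg
  have h1θ : 0 < 1 - θ := by linarith [hθ.2]
  have hCp0 : 0 ≤ Cp := by rw [hCp]; positivity
  have hc1 : 1 ≤ c := by
    have : 2 ≤ 2 / (1 - θ) := by
      rw [le_div_iff₀ h1θ]
      linarith [hθ.1]
    rw [hc]
    nlinarith
  have hk : 0 < step t n := hg.step_pos hnN
  have hl : 0 < step t (n - 1) := hg.step_pos (by omega)
  obtain ⟨-, -, hκ⟩ := khat_bounds hθ hk hl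
  have hτ := hg.tbeta_mem_Ioo hθ hn hnN
  have hτ' := Ioo_subset_Icc_self hτ
  obtain ⟨ha, hb, hs, hbτ, hsτ, Ub, hUb, hUbB⟩ := tb.proj_errors hΩ hθ hCU hM hg hr hn hnN
    hsol.div_free (P := P) (η := Cp * h ^ r) (mul_nonneg hCp0 (pow_nonneg hh.1.le r))
    (fun v hv W hW => by rw [hCp]; exact hfe.norm_sub_proj_le hP hS hCis hh.1 hv W hW)
  obtain ⟨m1, m2, -⟩ := hdln.mem j hn hnN
  obtain ⟨w1, w2⟩ := weak_equations hS hΩ hΩb hθ hg j hsol hdln hn hnN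
    (Submodule.sub_mem _ (hP.mem (betaComb θ t (fun m => u (t m)) n)) m1)
  have htr := tb.trunc n hn hnN
  have hτB : ‖u (tbeta θ t n)‖ ≤ c * M :=
    (Hs.norm_le_of_toL2_eq hΩ (Nat.le_add_left 1 r) (tb.toL2 _ hτ')).trans
      ((tb.norm_le _ hτ').trans (le_mul_of_one_le_left hM hc1))
  have hpQ := hsol.pressure _ hτ
  rw [← hw] at hpQ w1
  rw [← hc] at ha hb hs hbτ hsτ hUbB htr
  rw [← hK] at ha hbτ hsτ htr
  rw [← hq] at ha hbτ hsτ htr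
  obtain ⟨e1, e2, e3⟩ := comb_map_sub P (fun m => u (t m)) (uh j) θ t n
  rw [hφ, e1, e2, e3, hgw]
  exact hfe.tested_error_le hP hS hΩ hr1 hh hκ hν hCp0 (mul_nonneg (by linarith) hM) hpQ m1 m2 w1
    w2 htr ha hb hs hbτ hsτ Ub hUb hUbB hτB

/-- The one-step estimate for the error `φ = P u - u^h` of one member of the ensemble, with
constants that depend on the data only. -/
theorem exists_energy_step {S : ℝ} (hS : SobolevBounds Ω S) (hΩ : IsOpen Ω)
    (hΩb : Bornology.IsBounded Ω) {θ : ℝ} (hθ : θ ∈ Ioo (0 : ℝ) 1) {r : ℕ} (hr1 : 1 ≤ r) (s : ℕ)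
    (Capp Cinv : ℝ) {Cis CU ν T M : ℝ} (CL : ℝ) (hCis : 0 < Cis) (hCU : 0 < CU) (hν : 0 < ν)
    (A : ℝ) (hM : 0 ≤ M) :
    ∃ Λ C : ℝ, 0 ≤ Λ ∧ 0 ≤ C ∧ ∀ {h : ℝ}, h ∈ Ioc (0 : ℝ) 1 →
      ∀ {Xh : Submodule ℝ (X Ω)} {Qh : Submodule ℝ (L2 Ω ℝ)} {P : X Ω →ₗ[ℝ] X Ω},
      IsFEPair r s Capp Cinv Cis h Xh Qh → IsProj Xh Qh P →
      ∀ {N : ℕ} {t : ℕ → ℝ}, IsGrid T N t → RatioBounds CL CU N t →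
      ∀ {J : ℕ} {u₀ : X Ω} {f : Fin J → ℝ → StrongDual ℝ (X Ω)} {u : ℝ → X Ω}
        {ut : ℝ → L2 Ω (EuclideanSpace ℝ (Fin d))} {p : ℝ → L2 Ω ℝ}
        {U : ℝ → Hs Ω (EuclideanSpace ℝ (Fin d)) (r + 1)} {a : ℕ → ℝ}
        {uh : Fin J → ℕ → X Ω} {ph : Fin J → ℕ → L2 Ω ℝ} (j : Fin J),
      IsNSESolution ν T u₀ (f j) u ut p →
      TimeBounds θ T (3 * (2 / (1 - θ) * (2 + CU))) M A N t u ut U a →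
      IsDLNEnsemble θ ν N t Xh Qh f uh ph →
      CFLLike (cflConst d S θ |Cinv|) θ ν h N t uh →
      ∀ n, 1 ≤ n → n + 1 ≤ N → ∀ w : Hs Ω ℝ (s + 1), Hs.toL2 w = p (tbeta θ t n) →
      energy θ (fun m => P (u (t m)) - uh j m) (n + 1)
        + khat θ t n * ν * gradNorm (betaComb θ t (fun m => P (u (t m)) - uh j m) n) ^ 2 / 2
      ≤ (1 + Λ * khat θ t n) * energy θ (fun m => P (u (t m)) - uh j m) n
        + C * rate r s h (stepMax t N) ^ 2 * (a n + (step t n + step t (n - 1))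
          + (step t n + step t (n - 1)) * ‖w‖ ^ 2) := by
  have hS0 := hS.nonneg
  have h1θ : 0 < 1 - θ := by linarith [hθ.2]
  obtain ⟨b', hb'⟩ : ∃ x, x = 2 / (1 - θ) := ⟨_, rfl⟩
  have hb0 : 0 < b' := by rw [hb']; positivity
  obtain ⟨c, hc⟩ : ∃ x, x = 3 * (2 / (1 - θ) * (2 + CU)) := ⟨_, rfl⟩
  have hc0 : 0 < c := by rw [hc]; positivity
  obtain ⟨Cp, hCp⟩ : ∃ x, x = (1 + d * S / Cis) * |Capp| := ⟨_, rfl⟩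
  have hCp0 : 0 ≤ Cp := by rw [hCp]; positivity
  refine ⟨3 / 2 * ν⁻¹ * (d * S * (S ^ 2 + 1) * (c * M) + d * S ^ 4 * |Cinv| * (Cp * (c * M))) ^ 2
      * (8 * (2 / (1 - θ) * (2 + CU)) ^ 2 / (1 - θ)),
    3 / 2 * ν⁻¹ * (5 * (b' * (S * Cp * c) ^ 2 + 16 * (c + (ν + 2 * (d * S ^ 3 * (c * M))) * c) ^ 2
      + ((ν + 2 * (d * S ^ 3 * (c * M))) * (Cp * (c * M))) ^ 2
      + (d * |Capp|) ^ 2 + 8 * (2 * c * (d * S ^ 4)) ^ 2 * (ν * b' ^ 2))),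
    by positivity, by positivity, ?_⟩
  intro h hh Xh Qh P hfe hP N t hg hr J u₀ f u ut p U a uh ph j hsol tb hdln hcfl n hn hnN w hw
  have hk : 0 < step t n := hg.step_pos hnN
  have hl : 0 < step t (n - 1) := hg.step_pos (by omega)
  obtain ⟨hκ1, hκ2, hκ⟩ := khat_bounds hθ hk hl
  have hε := abs_eps_lt_one hk hl
  have hkm : step t n + step t (n - 1) ≤ 2 * stepMax t N := by
    have h1 : step t n ≤ stepMax t N := IsGrid.step_le_stepMax hnN
    have h2 : step t (n - 1) ≤ stepMax t N := IsGrid.step_le_stepMax (by omega)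
    linarith
  have hKb : step t n + step t (n - 1) ≤ b' * khat θ t n := by
    rw [hb', div_mul_eq_mul_div, le_div_iff₀ h1θ]
    linarith
  have hcflₙ := hcfl j n hn hnN
  have hest := tested_error_step hS hΩ hΩb hθ hr1 hCis hCU hν hM hh hfe hP hg hr j hsol hCp hc tb
    hdln hn hnN w hw rfl rfl rfl rfl
  have hgc := (cfl_bounds hS0 (abs_nonneg Cinv) hθ hε hκ hh.1 hν (abs_beta_le hθ hε).2.1 hcflₙ).1
  have hrec := energy_recursion hS0 (abs_nonneg Cinv) hθ hn hk hl (hr n hn hnN).2 hh.1 hν _ hcflₙ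
    hest
  refine hrec.trans (add_le_add_right ?_ _)
  have hgc' : khat θ t n * gradNorm (starComb θ t (uh j) n - starComb θ t (ensMean uh) n) ^ 2
      ≤ ν * b' ^ 2 * h := by
    rw [hb']
    exact hgc
  have hcons := consistency_sq_le (r := r) (s := s) (e := ‖w‖) (c₁ := S * Cp * c)
    (c₂ := c + (ν + 2 * (d * S ^ 3 * (c * M))) * c)
    (c₃ := (ν + 2 * (d * S ^ 3 * (c * M))) * (Cp * (c * M))) (c₄ := d * |Capp|)
    (c₅ := 2 * c * (d * S ^ 4)) hh.1 hκ hκ2 hKb hkm (tb.nonneg n) hgc' (by positivity)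
  refine (mul_le_mul_of_nonneg_left hcons (by positivity : 0 ≤ 3 / 2 * ν⁻¹)).trans_eq ?_
  ring

end

/-! ### Summation over the time steps -/

section

variable {d : ℕ} {Ω : Set (EuclideanSpace ℝ (Fin d))}

/-- The pressure at the time levels of the scheme has representatives in `H^{s+1}`. -/
theorem Regularity.exists_pressure (hΩ : IsOpen Ω) {r s N : ℕ} {θ T R : ℝ} {t : ℕ → ℝ}
    (hg : IsGrid T N t) {u : ℝ → X Ω} {ut : ℝ → L2 Ω (EuclideanSpace ℝ (Fin d))}
    {p : ℝ → L2 Ω ℝ} (hreg : Regularity r s θ T R N t u ut p) :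
    ∃ w : ℕ → Hs Ω ℝ (s + 1),
      (∀ n, 1 ≤ n → n + 1 ≤ N → Hs.toL2 (w n) = p (tbeta θ t n)) ∧
      ∑ n ∈ Finset.Ico 1 N, (step t n + step t (n - 1)) * ‖w n‖ ^ 2 ≤ max R 0 ^ 2 := by
  have hpos : ∀ n ∈ Finset.Ico 1 N, 0 < step t n + step t (n - 1) := fun n hn => by
    rw [Finset.mem_Ico] at hn
    exact add_pos (hg.step_pos (by omega)) (hg.step_pos (by omega))
  have hex : ∀ n, ∃ w : Hs Ω ℝ (s + 1), n ∈ Finset.Ico 1 N → Hs.toL2 w = p (tbeta θ t n) := by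
    intro n
    by_cases hn : n ∈ Finset.Ico 1 N
    · have h1 := (Finset.single_le_sum (f := fun n => ENNReal.ofReal (step t n + step t (n - 1)) *
        sobNorm (s + 1) (p (tbeta θ t n)) ^ 2) (fun _ _ => zero_le) hn).trans hreg.p_beta
      have h2 : sobNorm (s + 1) (p (tbeta θ t n)) ≠ ⊤ := by
        intro htop
        simp only [htop] at h1
        rw [ENNReal.top_pow two_ne_zero, ENNReal.mul_top (by simpa using hpos n hn)] at h1
        exact absurd h1 (by simp)
      have h3 := h2.lt_top
      simp only [sobNorm, iInf_lt_iff] at h3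
      obtain ⟨w, hw, -⟩ := h3
      exact ⟨w, fun _ => hw⟩
    · exact ⟨0, fun h => absurd h hn⟩
  choose w hw using hex
  refine ⟨w, fun n h1 h2 => hw n (Finset.mem_Ico.2 ⟨h1, by omega⟩), ?_⟩
  have h1 : ENNReal.ofReal (∑ n ∈ Finset.Ico 1 N, (step t n + step t (n - 1)) * ‖w n‖ ^ 2)
      ≤ ENNReal.ofReal (max R 0 ^ 2) := by
    rw [ENNReal.ofReal_sum_of_nonneg fun n hn => mul_nonneg (hpos n hn).le (sq_nonneg _),
      ENNReal.ofReal_pow (le_max_right R 0), ENNReal.ofReal_max, ENNReal.ofReal_zero,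
      max_eq_left zero_le]
    refine le_trans (Finset.sum_le_sum fun n hn => ?_) hreg.p_beta
    rw [ENNReal.ofReal_mul (hpos n hn).le, ENNReal.ofReal_pow (norm_nonneg _), ofReal_norm,
      ← hw n hn, sobNorm_eq hΩ]
  exact (ENNReal.ofReal_le_ofReal_iff (sq_nonneg _)).1 h1

/-- The recursion for the energies, summed up by the Gronwall inequality. -/
theorem energy_sum_le {θ ν T Λ C R A W g₁ ρ : ℝ} (hθ : θ ∈ Ioo (0 : ℝ) 1) (hν : 0 < ν)
    (hΛ : 0 ≤ Λ) (hC : 0 ≤ C) (hT : 0 ≤ T) (hR : 0 ≤ R) {N : ℕ} {t : ℕ → ℝ} (hN : 1 ≤ N)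
    (hg : IsGrid T N t) {φ : ℕ → X Ω} {a e : ℕ → ℝ} (ha : ∀ n, 0 ≤ a n)
    (hA : ∑ n ∈ Finset.Ico 1 N, a n ≤ A)
    (hW : ∑ n ∈ Finset.Ico 1 N, (step t n + step t (n - 1)) * e n ^ 2 ≤ W) (hR' : A + 2 * T + W ≤ R)
    (h₀ : ‖fld (φ 0)‖ ≤ g₁ * ρ) (h₁ : ‖fld (φ 1)‖ ≤ g₁ * ρ)
    (hstep : ∀ n, 1 ≤ n → n + 1 ≤ N →
      energy θ φ (n + 1) + khat θ t n * ν * gradNorm (betaComb θ t φ n) ^ 2 / 2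
        ≤ (1 + Λ * khat θ t n) * energy θ φ n + C * ρ ^ 2 * (a n + (step t n + step t (n - 1))
          + (step t n + step t (n - 1)) * e n ^ 2)) :
    (∀ m ≤ N, ‖fld (φ m)‖ ^ 2 ≤ 4 * (Real.exp (Λ * (2 * T)) * (g₁ ^ 2 + C * R) * ρ ^ 2)) ∧
      ∑ n ∈ Finset.Ico 1 N, khat θ t n * ν * gradNorm (betaComb θ t φ n) ^ 2
        ≤ 2 * (Real.exp (Λ * (2 * T)) * (g₁ ^ 2 + C * R) * ρ ^ 2) := by
  have hk : ∀ n, 1 ≤ n → n + 1 ≤ N → 0 < step t n ∧ 0 < step t (n - 1) := fun n _ h2 =>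
    ⟨hg.step_pos h2, hg.step_pos (by omega)⟩
  have hκ : ∀ n, 1 ≤ n → n + 1 ≤ N → 0 ≤ khat θ t n := fun n h1 h2 =>
    (khat_bounds hθ (hk n h1 h2).1 (hk n h1 h2).2).2.2.le
  have hD : ∀ n, 1 ≤ n → n + 1 ≤ N →
      0 ≤ khat θ t n * ν * gradNorm (betaComb θ t φ n) ^ 2 / 2 := fun n h1 h2 => by
    have := hκ n h1 h2
    positivity
  have hδ : ∀ n, 1 ≤ n → n + 1 ≤ N → 0 ≤ C * ρ ^ 2 * (a n + (step t n + step t (n - 1))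
          + (step t n + step t (n - 1)) * e n ^ 2) := fun n h1 h2 => by
    have := ha n
    obtain ⟨h3, h4⟩ := hk n h1 h2
    positivity
  have hκsum : ∀ m ≤ N, ∑ n ∈ Finset.Ico 1 m, khat θ t n ≤ 2 * T := fun m hm => by
    refine le_trans ?_ hg.sum_step
    calc ∑ n ∈ Finset.Ico 1 m, khat θ t n ≤ ∑ n ∈ Finset.Ico 1 N, khat θ t n := by
          refine Finset.sum_le_sum_of_subset_of_nonneg (Finset.Ico_subset_Ico_right hm)
            fun n hn _ => ?_
          rw [Finset.mem_Ico] at hn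
          exact hκ n hn.1 (by omega)
      _ ≤ _ := by
          refine Finset.sum_le_sum fun n hn => ?_
          rw [Finset.mem_Ico] at hn
          obtain ⟨h3, h4⟩ := hk n hn.1 (by omega)
          exact (khat_bounds hθ h3 h4).2.1
  have hδsum : ∀ m ≤ N, ∑ n ∈ Finset.Ico 1 m, C * ρ ^ 2 * (a n + (step t n + step t (n - 1))
          + (step t n + step t (n - 1)) * e n ^ 2) ≤ C * R * ρ ^ 2 := fun m hm => by
    calc _ ≤ ∑ n ∈ Finset.Ico 1 N, C * ρ ^ 2 * (a n + (step t n + step t (n - 1))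
          + (step t n + step t (n - 1)) * e n ^ 2) := by
          refine Finset.sum_le_sum_of_subset_of_nonneg (Finset.Ico_subset_Ico_right hm)
            fun n hn _ => ?_
          rw [Finset.mem_Ico] at hn
          exact hδ n hn.1 (by omega)
      _ ≤ C * ρ ^ 2 * R := by
          rw [← Finset.mul_sum, Finset.sum_add_distrib, Finset.sum_add_distrib]
          have := hg.sum_step
          gcongr
          linarith
      _ = _ := by ring
  have hE1 : energy θ φ 1 ≤ g₁ ^ 2 * ρ ^ 2 := by
    have h2 : ‖fld (φ 1)‖ ^ 2 ≤ (g₁ * ρ) ^ 2 := by gcongr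
    have h3 : ‖fld (φ 0)‖ ^ 2 ≤ (g₁ * ρ) ^ 2 := by gcongr
    rw [mul_pow] at h2 h3
    have h4 : 0 ≤ 1 + θ := by linarith [hθ.1]
    have h5 : 0 ≤ 1 - θ := by linarith [hθ.2]
    calc energy θ φ 1 ≤ (1 + θ) / 4 * (g₁ ^ 2 * ρ ^ 2) + (1 - θ) / 4 * (g₁ ^ 2 * ρ ^ 2) := by
          rw [energy]
          gcongr
      _ ≤ _ := by nlinarith [mul_nonneg (sq_nonneg g₁) (sq_nonneg ρ)]
  have key : ∀ m, 1 ≤ m → m ≤ N →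
      energy θ φ m + ∑ n ∈ Finset.Ico 1 m, khat θ t n * ν * gradNorm (betaComb θ t φ n) ^ 2 / 2
        ≤ Real.exp (Λ * (2 * T)) * (g₁ ^ 2 + C * R) * ρ ^ 2 := fun m h1 hm => by
    refine (discrete_gronwall hΛ (energy_nonneg hθ φ) hD hδ hκ hstep h1 hm).trans ?_
    calc _ ≤ Real.exp (Λ * (2 * T)) * (g₁ ^ 2 * ρ ^ 2 + C * R * ρ ^ 2) := by
          have h4 := hκsum m hm
          have h5 := hδsum m hm
          have h6 := energy_nonneg hθ φ 1
          have h7 : 0 ≤ ∑ n ∈ Finset.Ico 1 m, C * ρ ^ 2 * (a n + (step t n + step t (n - 1))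
              + (step t n + step t (n - 1)) * e n ^ 2) := Finset.sum_nonneg fun n hn => by
            rw [Finset.mem_Ico] at hn
            exact hδ n hn.1 (by omega)
          exact mul_le_mul (Real.exp_le_exp.2 (mul_le_mul_of_nonneg_left h4 hΛ))
            (add_le_add hE1 h5) (add_nonneg h6 h7) (Real.exp_nonneg _)
      _ = _ := by ring
  refine ⟨fun m hm => ?_, ?_⟩
  · rcases Nat.eq_zero_or_pos m with rfl | hm0
    · have h3 : ‖fld (φ 0)‖ ^ 2 ≤ (g₁ * ρ) ^ 2 := by gcongr
      have h4 : 1 ≤ Real.exp (Λ * (2 * T)) := Real.one_le_exp (by positivity)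
      calc ‖fld (φ 0)‖ ^ 2 ≤ 1 * (1 * g₁ ^ 2 * ρ ^ 2) := by linarith
        _ ≤ 4 * (Real.exp (Λ * (2 * T)) * (g₁ ^ 2 + C * R) * ρ ^ 2) := by
            gcongr
            · norm_num
            · exact le_add_of_nonneg_right (by positivity)
    · have h1 := key m hm0 hm
      have h2 : 0 ≤ ∑ n ∈ Finset.Ico 1 m,
          khat θ t n * ν * gradNorm (betaComb θ t φ n) ^ 2 / 2 := Finset.sum_nonneg fun n hn => by
        rw [Finset.mem_Ico] at hn
        exact hD n hn.1 (by omega)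
      have h3 : ‖fld (φ m)‖ ^ 2 ≤ 4 * energy θ φ m := by
        rw [energy]
        nlinarith [mul_nonneg hθ.1.le (sq_nonneg ‖fld (φ m)‖),
          mul_nonneg (sub_nonneg.2 hθ.2.le) (sq_nonneg ‖fld (φ (m - 1))‖)]
      linarith
  · have h1 := key N hN le_rfl
    have h2 := energy_nonneg hθ φ N
    rw [← Finset.sum_div] at h1
    linarith

theorem stepMax_nonneg {T : ℝ} {N : ℕ} {t : ℕ → ℝ} (hg : IsGrid T N t) : 0 ≤ stepMax t N :=
  Real.iSup_nonneg fun n => (hg.step_pos n.2).le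

end

/-! ### The error estimate -/

section

variable {d : ℕ} {Ω : Set (EuclideanSpace ℝ (Fin d))}

/-- From the bounds of the discrete error `φ = P u - u^h` to the bounds of the error. -/
theorem error_le_of_proj {θ ν T Cp Mb ρ E hr : ℝ} (hθ : θ ∈ Ioo (0 : ℝ) 1) (hν : 0 < ν)
    (hMb : 0 ≤ Cp * Mb) (hρ : 0 ≤ ρ) (hE : 0 ≤ E)
    (hrρ : hr ≤ ρ) {N : ℕ} {t : ℕ → ℝ} (hg : IsGrid T N t) {P : X Ω →ₗ[ℝ] X Ω} {z y : ℕ → X Ω}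
    (hz : ∀ n ≤ N, ‖z n - P (z n)‖ ≤ Cp * hr * Mb)
    (hzb : ∀ n, 1 ≤ n → n + 1 ≤ N →
      ‖betaComb θ t z n - P (betaComb θ t z n)‖ ≤ Cp * hr * Mb)
    (h₁ : ∀ n ≤ N, ‖fld (P (z n) - y n)‖ ^ 2 ≤ 4 * (E * ρ ^ 2))
    (h₂ : ∑ n ∈ Finset.Ico 1 N,
      khat θ t n * ν * gradNorm (betaComb θ t (fun m => P (z m) - y m) n) ^ 2 ≤ 2 * (E * ρ ^ 2)) :
    (∀ n ≤ N, ‖fld (z n - y n)‖ ≤ (Cp * Mb + 2 * √E) * ρ) ∧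
      √(ν * ∑ n ∈ Finset.Ico 1 N, khat θ t n * gradNorm (betaComb θ t z n - betaComb θ t y n) ^ 2)
        ≤ √(4 * ν * T * (Cp * Mb) ^ 2 + 4 * E) * ρ := by
  have hρE : √(4 * (E * ρ ^ 2)) = 2 * √E * ρ := by
    rw [show 4 * (E * ρ ^ 2) = E * (2 * ρ) ^ 2 by ring, Real.sqrt_mul hE,
      Real.sqrt_sq (by positivity)]
    ring
  have hη : Cp * hr * Mb ≤ Cp * Mb * ρ := by nlinarith
  constructor
  · intro n hn
    have e : fld (z n - y n) = fld (z n - P (z n)) + fld (P (z n) - y n) := by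
      rw [← map_add, sub_add_sub_cancel]
    have e1 : ‖fld (z n - P (z n))‖ ≤ Cp * Mb * ρ :=
      (norm_fld_le_norm _).trans ((hz n hn).trans hη)
    have e2 : ‖fld (P (z n) - y n)‖ ≤ 2 * √E * ρ := hρE ▸ Real.le_sqrt_of_sq_le (h₁ n hn)
    rw [e]
    linarith [norm_add_le (fld (z n - P (z n))) (fld (P (z n) - y n))]
  · have hstep : ∀ n ∈ Finset.Ico 1 N,
        khat θ t n * gradNorm (betaComb θ t z n - betaComb θ t y n) ^ 2
          ≤ 2 * (Cp * Mb * ρ) ^ 2 * (step t n + step t (n - 1))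
            + 2 * ν⁻¹ * (khat θ t n * ν *
              gradNorm (betaComb θ t (fun m => P (z m) - y m) n) ^ 2) := by
      intro n hn
      rw [Finset.mem_Ico] at hn
      obtain ⟨-, hκ1, hκ0⟩ := khat_bounds (n := n) hθ (hg.step_pos (by omega))
        (hg.step_pos (by omega))
      have e1 := (hzb n hn.1 (by omega)).trans hη
      have e2 := gradNorm_add_le (betaComb θ t z n - P (betaComb θ t z n))
        (P (betaComb θ t z n) - betaComb θ t y n)
      rw [sub_add_sub_cancel, ← (comb_map_sub P z y θ t n).2.1] at e2
      have e3 := gradNorm_le_norm (betaComb θ t z n - P (betaComb θ t z n))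
      generalize gradNorm (betaComb θ t (fun m => P (z m) - y m) n) = g at *
      have e4 : gradNorm (betaComb θ t z n - betaComb θ t y n) ≤ Cp * Mb * ρ + g := by linarith
      have e5 := gradNorm_nonneg (betaComb θ t z n - betaComb θ t y n)
      calc khat θ t n * gradNorm (betaComb θ t z n - betaComb θ t y n) ^ 2
          ≤ khat θ t n * (Cp * Mb * ρ + g) ^ 2 := by gcongr
        _ ≤ khat θ t n * (2 * (Cp * Mb * ρ) ^ 2 + 2 * g ^ 2) := by
            gcongr
            linarith [add_sq_le (a := Cp * Mb * ρ) (b := g)]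
        _ = 2 * (Cp * Mb * ρ) ^ 2 * khat θ t n + 2 * ν⁻¹ * (khat θ t n * ν * g ^ 2) := by
            field_simp
        _ ≤ _ := by gcongr
    have hsum := Finset.sum_le_sum hstep
    rw [Finset.sum_add_distrib, ← Finset.mul_sum, ← Finset.mul_sum] at hsum
    have hT := hg.sum_step
    refine Real.sqrt_le_iff.2 ⟨by positivity, ?_⟩
    have hT0 : 0 ≤ T := by
      have := hg.mem_Icc (n := N) le_rfl
      exact this.1.trans this.2
    rw [mul_pow, Real.sq_sqrt (by positivity)]
    calc _ ≤ ν * (2 * (Cp * Mb * ρ) ^ 2 * (2 * T) + 2 * ν⁻¹ * (2 * (E * ρ ^ 2))) := by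
          refine mul_le_mul_of_nonneg_left (hsum.trans ?_) hν.le
          gcongr
      _ = _ := by
          field_simp
          ring

set_option maxHeartbeats 1000000 in
/-- The error estimate for one member of the ensemble on a grid with at least two steps. -/
theorem exists_error_le {S : ℝ} (hS : SobolevBounds Ω S) (hΩ : IsOpen Ω)
    (hΩb : Bornology.IsBounded Ω) {θ : ℝ} (hθ : θ ∈ Ioo (0 : ℝ) 1) {r : ℕ} (hr1 : 1 ≤ r) (s : ℕ)
    (Capp Cinv : ℝ) {Cis CU ν T : ℝ} (CL R c₀ : ℝ) (hCis : 0 < Cis) (hCU : 0 < CU) (hν : 0 < ν)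
    (hT : 0 < T) :
    ∃ C₁ C₂ : ℝ, 0 ≤ C₁ ∧ 0 ≤ C₂ ∧ ∀ {h : ℝ}, h ∈ Ioc (0 : ℝ) 1 →
      ∀ {Xh : Submodule ℝ (X Ω)} {Qh : Submodule ℝ (L2 Ω ℝ)},
      IsFEPair r s Capp Cinv Cis h Xh Qh →
      ∀ {N : ℕ} {t : ℕ → ℝ}, 2 ≤ N → IsGrid T N t → RatioBounds CL CU N t →
      ∀ {J : ℕ} {u₀ : X Ω} {f : Fin J → ℝ → StrongDual ℝ (X Ω)} {u : ℝ → X Ω}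
        {ut : ℝ → L2 Ω (EuclideanSpace ℝ (Fin d))} {p : ℝ → L2 Ω ℝ}
        {uh : Fin J → ℕ → X Ω} {ph : Fin J → ℕ → L2 Ω ℝ} (j : Fin J),
      IsNSESolution ν T u₀ (f j) u ut p → Regularity r s θ T R N t u ut p →
      IsDLNEnsemble θ ν N t Xh Qh f uh ph → CFLLike (cflConst d S θ |Cinv|) θ ν h N t uh →
      (∀ n ≤ 1, ‖fld (u (t n) - uh j n)‖ ≤ c₀ * rate r s h (stepMax t N)) →
      (∀ n ≤ N, ‖fld (u (t n) - uh j n)‖ ≤ C₁ * rate r s h (stepMax t N)) ∧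
        √(ν * ∑ n ∈ Finset.Ico 1 N, khat θ t n *
            gradNorm (betaComb θ t (fun m => u (t m)) n - betaComb θ t (uh j) n) ^ 2)
          ≤ C₂ * rate r s h (stepMax t N) := by
  have hS0 := hS.nonneg
  have h1θ : 0 < 1 - θ := by linarith [hθ.2]
  obtain ⟨M, hM⟩ : ∃ x, x = max R 0 + √(T * max R 0 ^ 2) := ⟨_, rfl⟩
  have hM0 : 0 ≤ M := by rw [hM]; positivity
  obtain ⟨c, hc⟩ : ∃ x, x = 3 * (2 / (1 - θ) * (2 + CU)) := ⟨_, rfl⟩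
  have hc1 : 1 ≤ c := by
    have : 2 ≤ 2 / (1 - θ) := by
      rw [le_div_iff₀ h1θ]
      linarith [hθ.1]
    rw [hc]
    nlinarith
  obtain ⟨Cp, hCp⟩ : ∃ x, x = (1 + d * S / Cis) * |Capp| := ⟨_, rfl⟩
  have hCp0 : 0 ≤ Cp := by rw [hCp]; positivity
  obtain ⟨Λ, C, hΛ, hC, hstep⟩ := exists_energy_step hS hΩ hΩb hθ hr1 s Capp Cinv (T := T) CL hCis
    hCU hν (6 * max R 0 ^ 2) hM0
  obtain ⟨E, hE⟩ : ∃ x, x = Real.exp (Λ * (2 * T)) * ((|c₀| + Cp * (c * M)) ^ 2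
    + C * (6 * max R 0 ^ 2 + 2 * T + max R 0 ^ 2)) := ⟨_, rfl⟩
  have hE0 : 0 ≤ E := by rw [hE]; positivity
  refine ⟨Cp * (c * M) + 2 * √E, √(4 * ν * T * (Cp * (c * M)) ^ 2 + 4 * E), by positivity,
    by positivity, ?_⟩
  intro h hh Xh Qh hfe N t hN hg hr J u₀ f u ut p uh ph j hsol hreg hdln hcfl hinit
  have := hfe.finX
  obtain ⟨P, hP⟩ := exists_isProj Xh Qh
  obtain ⟨U, a, tb⟩ := exists_timeBounds hS hΩ hθ hCU hN hg hr hsol hreg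
  rw [← hM] at tb
  obtain ⟨w, hw, hwR⟩ := hreg.exists_pressure hΩ hg
  obtain ⟨hρ, hrρ, -⟩ := rate_bounds (r := r) (s := s) hh.1 (stepMax_nonneg hg)
  have hproj : ∀ v ∈ V Ω, ∀ W : Hs Ω (EuclideanSpace ℝ (Fin d)) (r + 1), Hs.toL2 W = fld v →
      ‖v - P v‖ ≤ Cp * h ^ r * ‖W‖ := fun v hv W hW => by
    rw [hCp]
    exact hfe.norm_sub_proj_le hP hS hCis hh.1 hv W hW
  have hCh : 0 ≤ Cp * h ^ r := mul_nonneg hCp0 (pow_nonneg hh.1.le r)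
  have hz : ∀ n ≤ N, ‖u (t n) - P (u (t n))‖ ≤ Cp * h ^ r * (c * M) := fun n hn => by
    have hmem := hg.mem_Icc hn
    exact (hproj _ (hsol.div_free _ hmem) _ (tb.toL2 _ hmem)).trans (mul_le_mul_of_nonneg_left
      ((tb.norm_le _ hmem).trans (le_mul_of_one_le_left hM0 hc1)) hCh)
  have hzb : ∀ n, 1 ≤ n → n + 1 ≤ N → ‖betaComb θ t (fun m => u (t m)) n
      - P (betaComb θ t (fun m => u (t m)) n)‖ ≤ Cp * h ^ r * (c * M) := fun n h1 h2 => by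
    rw [hc]
    exact (tb.proj_errors hΩ hθ hCU hM0 hg hr h1 h2 hsol.div_free hCh hproj).2.1
  have hφ : ∀ n ≤ 1, ‖fld (P (u (t n)) - uh j n)‖
      ≤ (|c₀| + Cp * (c * M)) * rate r s h (stepMax t N) := fun n hn => by
    have e : fld (P (u (t n)) - uh j n) = fld (u (t n) - uh j n) - fld (u (t n) - P (u (t n))) := by
      rw [← map_sub, sub_sub_sub_cancel_left]
    have e1 := (norm_fld_le_norm (u (t n) - P (u (t n)))).trans (hz n (by omega))
    have e2 := hinit n hn
    have e3 := mul_le_mul_of_nonneg_right (le_abs_self c₀) hρ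
    have e4 : Cp * h ^ r * (c * M) ≤ Cp * (c * M) * rate r s h (stepMax t N) := by
      have : 0 ≤ Cp * (c * M) := by positivity
      nlinarith
    rw [e]
    linarith [norm_sub_le (fld (u (t n) - uh j n)) (fld (u (t n) - P (u (t n))))]
  obtain ⟨b1, b2⟩ := energy_sum_le (φ := fun m => P (u (t m)) - uh j m) (e := fun n => ‖w n‖)
    hθ hν hΛ hC hT.le (by positivity : 0 ≤ 6 * max R 0 ^ 2 + 2 * T + max R 0 ^ 2) (by omega) hg
    tb.nonneg tb.sum_le hwR le_rfl (hφ 0 (by omega)) (hφ 1 le_rfl) fun n h1 h2 =>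
      hstep hh hfe hP hg hr j hsol tb hdln hcfl n h1 h2 (w n) (hw n h1 h2)
  rw [← hE] at b1 b2
  exact error_le_of_proj (z := fun m => u (t m)) (y := uh j) hθ hν (by positivity) hρ hE0 hrρ hg
    hz hzb b1 b2

end

end DLN

end

theorem mainTheorem1 {d : ℕ} (hd : d = 2 ∨ d = 3) (Ω : Set (EuclideanSpace ℝ (Fin d)))
    (hΩ_open : IsOpen Ω) (hΩ_bdd : Bornology.IsBounded Ω) (hΩ_cone : DLN.ConeCondition Ω)
    (θ : ℝ) (hθ : θ ∈ Set.Ioo (0 : ℝ) 1) (Cinv : ℝ) :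
    ∃ Ccfl : ℝ, 0 < Ccfl ∧
    ∀ (r s : ℕ), 1 ≤ r →
    ∀ (Capp Cis CL CU ν T R c₀ : ℝ), 0 < Cis → 0 < CL → 0 < CU → 0 < ν → 0 < T →
    ∃ C : ℝ,
    ∀ (h : ℝ), h ∈ Set.Ioc (0 : ℝ) 1 →
    ∀ (Xh : Submodule ℝ (DLN.X Ω)) (Qh : Submodule ℝ (DLN.L2 Ω ℝ)),
      DLN.IsFEPair r s Capp Cinv Cis h Xh Qh →
    ∀ (N : ℕ) (t : ℕ → ℝ), DLN.IsGrid T N t → DLN.RatioBounds CL CU N t →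
    ∀ (J : ℕ) (u₀ : Fin J → DLN.X Ω) (f : Fin J → ℝ → StrongDual ℝ (DLN.X Ω))
      (u : Fin J → ℝ → DLN.X Ω) (ut : Fin J → ℝ → DLN.L2 Ω (EuclideanSpace ℝ (Fin d)))
      (p : Fin J → ℝ → DLN.L2 Ω ℝ),
      (∀ j, DLN.IsNSESolution ν T (u₀ j) (f j) (u j) (ut j) (p j)) →
      (∀ j, DLN.Regularity r s θ T R N t (u j) (ut j) (p j)) →
    ∀ (uh : Fin J → ℕ → DLN.X Ω) (ph : Fin J → ℕ → DLN.L2 Ω ℝ),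
      DLN.IsDLNEnsemble θ ν N t Xh Qh f uh ph →
      DLN.CFLLike Ccfl θ ν h N t uh →
      (∀ j, ∀ n ≤ 1, ‖DLN.fld (u j (t n) - uh j n)‖ ≤ c₀ * DLN.rate r s h (DLN.stepMax t N)) →
    ∀ j,
      (⨆ n : Fin (N + 1), ‖DLN.fld (u j (t n) - uh j n)‖)
        + √(ν * ∑ n ∈ Finset.Ico 1 N, DLN.khat θ t n *
            DLN.gradNorm (DLN.betaComb θ t (fun m => u j (t m)) n
              - DLN.betaComb θ t (uh j) n) ^ 2)
      ≤ C * DLN.rate r s h (DLN.stepMax t N) := by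
  obtain ⟨S, hS⟩ := DLN.exists_sobolevBounds hd hΩ_open hΩ_bdd hΩ_cone
  refine ⟨DLN.cflConst d S θ |Cinv|, DLN.cflConst_pos hS.nonneg hθ (abs_nonneg _), ?_⟩
  intro r s hr Capp Cis CL CU ν T R c₀ hCis _ hCU hν hT
  obtain ⟨C₁, C₂, hC₁, hC₂, H⟩ := DLN.exists_error_le hS hΩ_open hΩ_bdd hθ hr s Capp Cinv CL R c₀
    hCis hCU hν hT
  refine ⟨|c₀| + C₁ + C₂, ?_⟩
  intro h hh Xh Qh hfe N t hg hrat J u₀ f u ut p hsol hreg uh ph hdln hcfl hinit j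
  have hρ := (DLN.rate_bounds (r := r) (s := s) hh.1 (DLN.stepMax_nonneg hg)).1
  have hc : c₀ * DLN.rate r s h (DLN.stepMax t N) ≤ |c₀| * DLN.rate r s h (DLN.stepMax t N) :=
    mul_le_mul_of_nonneg_right (le_abs_self c₀) hρ
  have h₁ := mul_nonneg hC₁ hρ
  have h₂ := mul_nonneg hC₂ hρ
  have h₀ := mul_nonneg (abs_nonneg c₀) hρ
  rw [add_mul, add_mul]
  rcases Nat.lt_or_ge N 2 with hN | hN
  · -- on a grid with at most one step only the starting values enter
    rw [Finset.Ico_eq_empty (by omega), Finset.sum_empty, mul_zero, Real.sqrt_zero, add_zero]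
    exact ciSup_le fun n => (hinit j n (by omega)).trans (by linarith)
  · obtain ⟨e₁, e₂⟩ := H hh hfe hN hg hrat j (hsol j) (hreg j) hdln hcfl (hinit j)
    refine add_le_add (ciSup_le fun n => ?_) e₂
    exact (e₁ n (by omega)).trans (by linarith)
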